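/- **Setting.** For $\operatorname{Im}\mu>0$ let $\Lambda_\mu=\mathbb Z+\mu\mathbb Z$, let $\vartheta[p,q](\lambda|\mu)=\sum_{m\in\mathbb Z}e^{\pi i\mu(m+p)^2+2\pi i(m+p)(\lambda+q)}$, and $\vartheta_1=-\vartheta[\tfrac12,\tfrac12]$, $\vartheta_2=\vartheta[\tfrac12,0]$, $\vartheta_3=\vartheta[0,0]$, $\vartheta_4=\vartheta[0,\tfrac12]$, $\vartheta_j:=\vartheta_j(0)$. Put $$w_1(\lambda)=\pi\vartheta_2\vartheta_3\frac{\vartheta_4(\lambda)}{\vartheta_1(\lambda)},\quad w_2(\lambda)=\pi\vartheta_2\vartheta_4\frac{\vartheta_3(\lambda)}{\vartheta_1(\lambda)},\quad w_3(\lambda)=\pi\vartheta_3\vartheta_4\frac{\vartheta_2(\lambda)}{\vartheta_1(\lambda)},$$ $$\mathcal Z_1=\frac{w_1}{2\pi i}\frac{\vartheta_4'}{\vartheta_4},\quad \mathcal Z_2=\frac{w_2}{2\pi i}\frac{\vartheta_3'}{\vartheta_3},\quad \mathcal Z_3=\frac{w_3}{2\pi i}\frac{\vartheta_2'}{\vartheta_2}$$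 (with removable singularities removed; in particular $\mathcal Z_a$ is holomorphic at $0$). Let $\sigma_1=\begin{pmatrix}0&1\\1&0\end{pmatrix}$, $\sigma_2=\begin{pmatrix}0&i\\-i&0\end{pmatrix}$, $\sigma_3=\begin{pmatrix}1&0\\0&-1\end{pmatrix}$, and write $M=\sum_a M^a\sigma_a$ for $M\in\mathfrak{sl}(2,\mathbb C)$. Let $D$ be an open set of parameters $p=(\lambda_1,\dots,\lambda_N,\mu)$ with $\operatorname{Im}\mu>0$ and $\lambda_i-\lambda_j\notin\Lambda_\mu$ for $i\ne j$, and let $A_j:D\to\mathfrak{sl}(2,\mathbb C)$ be holomorphic solutions of the elliptic Schlesinger system $$\frac{\partial A_j}{\partial\lambda_i}=\Big[A_j,\sum_aA_i^aw_a(\lambda_j-\lambda_i)\sigma_a\Big]\ (i\ne j),\qquad \frac{\partial A_j}{\partial\lambda_j}=-\sum_{i\ne j}\Big[A_j,\sum_aA_i^aw_a(\lambda_j-\lambda_i)\sigma_a\Big],$$ $$\frac{\partial A_j}{\partial\mu}=-\sum_{i=1}^N\Big[A_j,\sum_aA_i^a\mathcal Z_a(\lambda_j-\lambda_i)\sigma_a\Big].\tag{S}$$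 Let $X$ be a universal covering (a simply connected covering space, with surjective covering map) of the space of all $(\lambda,p)$ with $p\in D$, $\lambda\notin\bigcup_j(\lambda_j+\Lambda_\mu)$ (so $D$ is a domain). Let $\Psi$, with values in $SL(2,\mathbb C)$, be a solution on $X$ of the associated linear system $$\frac{\partial\Psi}{\partial\lambda}=\sum_{j,a}A_j^aw_a(\lambda-\lambda_j)\sigma_a\Psi,\quad \frac{\partial\Psi}{\partial\lambda_j}=-\sum_aA_j^aw_a(\lambda-\lambda_j)\sigma_a\Psi,\quad \frac{\partial\Psi}{\partial\mu}=\sum_{j,a}A_j^a\mathcal Z_a(\lambda-\lambda_j)\sigma_a\Psi.\tag{L}$$ Let $A_j=G_j\,\mathrm{diag}(t_j,-t_j)\,G_j^{-1}$ with $G_j=G_j(p)\in SL(2,\mathbb C)$ and constants $t_j$, none of which is an integer or a half-integer. Fix $k\neq l$, let $G=(G_k^1,G_l^1)$ be the matrix formed by the first columns of $G_k$ and $G_l$, and assume $\det G\ne0$ on $D$. **Theorem.** (i) For every $p\in D$ there are unique $J_1,J_2,J_3\in\mathbb C$ with $$\sum_aJ_a\,w_a\big(\tfrac12(\lambda_k-\lambda_l)\big)\,\sigma_a=-\tfrac12\,G\,\sigma_3\,G^{-1}.$$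 Put $f(\lambda)=\tfrac12+\sum_aJ_a\,w_a\big(\lambda-\tfrac12(\lambda_k+\lambda_l)\big)\sigma_a$ and suppose that, for every $p\in D$, $\det f(\lambda)$ does not vanish identically in $\lambda$. (ii) $f/\sqrt{\det f}$ has a continuous branch $F$ on $X$ (its singularities at $\lambda\in\tfrac12(\lambda_k+\lambda_l)+\Lambda_\mu$ being removed). For every such branch let $\widehat\Psi=F\Psi$. Then: * the residues $\widehat A_j=\operatorname{res}_{\lambda=\lambda_j}\big\{\tfrac{\partial\widehat\Psi}{\partial\lambda}\widehat\Psi^{-1}\big\}$ exist, $\det\widehat\Psi=1$, and $\widehat\Psi$ satisfies the three equations (L) with $\widehat A_j$ in place of $A_j$; * the $\widehat A_j$ are $\mathfrak{sl}(2,\mathbb C)$-valued and satisfy the elliptic Schlesinger system (S) on $D$; * $\widehat A_j=\widehat G_j\,\mathrm{diag}(\widehat t_j,-\widehat t_j)\,\widehat G_j^{-1}$ with $\widehat G_j\in SL(2,\mathbb C)$, where $\widehat t_j=t_j+\tfrac12$ for $j=k,l$ and $\widehat t_j=t_j$ otherwise; * under analytic continuation along loops in the punctured $\lambda$-plane freely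 homotopic to a small positive circle around a point of $\lambda_j+\Lambda_\mu$, one has $\Psi\to\Psi M_j$ and $\widehat\Psi\to\widehat\Psi\widehat M_j$ with constant matrices (independent of $\lambda$ and of all parameters) such that $\widehat M_j=-M_j$ for $j=k,l$ and $\widehat M_j=M_j$ otherwise; * $\Psi(\lambda+1)=\sigma_3\Psi(\lambda)M_a$, $\Psi(\lambda+\mu)=\sigma_1\Psi(\lambda)M_b$ with constant matrices $M_a,M_b$ (which depend on the choice of the paths of continuation from $\lambda$ to $\lambda+1$ and to $\lambda+\mu$), and $\widehat\Psi(\lambda+1)=\sigma_3\widehat\Psi(\lambda)\widehat M_a$, $\widehat\Psi(\lambda+\mu)=\sigma_1\widehat\Psi(\lambda)\widehat M_b$ with $\widehat M_a=\pm M_a$, $\widehat M_b=\pm M_b$. If the path defining $M_a$ (respectively $M_b$) does not meet the $\Lambda_\mu$-translates of some cut joining $\lambda_k$ to $\lambda_l$ in $\mathbb C$, then $\widehat M_a=M_a$ (respectively $\widehat M_b=M_b$). -/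

import Mathlib

open Filter Topology Asymptotics

noncomputable section

namespace EllipticSchlesinger

/-- Complex `2 × 2` matrices. -/
abbrev Mat2 : Type := Matrix (Fin 2) (Fin 2) ℂ

/-- The deformation parameters `p = ((λ₁, …, λ_N), μ)`: `p.1 j` is the position of the `j`-th pole
and `p.2` is the module of the torus. -/
abbrev Param (N : ℕ) : Type := (Fin N → ℂ) × ℂ

/-- The variables `(λ, p)` on which the function `Ψ` depends. -/
abbrev Total (N : ℕ) : Type := ℂ × Param N

/-! ### Theta functions and the functions `w_a`, `Z_a` -/

/-- The theta function with characteristic `[p, q]`. -/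
def theta (p q z μ : ℂ) : ℂ :=
  ∑' m : ℤ, Complex.exp (Real.pi * Complex.I * μ * (m + p) ^ 2
    + 2 * Real.pi * Complex.I * (m + p) * (z + q))

def theta1 (z μ : ℂ) : ℂ := -theta (1 / 2) (1 / 2) z μ
def theta2 (z μ : ℂ) : ℂ := theta (1 / 2) 0 z μ
def theta3 (z μ : ℂ) : ℂ := theta 0 0 z μ
def theta4 (z μ : ℂ) : ℂ := theta 0 (1 / 2) z μ

/-- The theta functions in the numerators of `w₁, w₂, w₃`. Throughout, the index `a = 1, 2, 3` of
the text is `0, 1, 2 : Fin 3`. -/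
def thetaNum (a : Fin 3) (z μ : ℂ) : ℂ := ![theta4 z μ, theta3 z μ, theta2 z μ] a

/-- The constants `π ϑ₂ ϑ₃`, `π ϑ₂ ϑ₄`, `π ϑ₃ ϑ₄` in front of `w₁, w₂, w₃`. -/
def thetaConst (a : Fin 3) (μ : ℂ) : ℂ :=
  ![Real.pi * theta2 0 μ * theta3 0 μ, Real.pi * theta2 0 μ * theta4 0 μ,
    Real.pi * theta3 0 μ * theta4 0 μ] a

/-- `w₁ = π ϑ₂ ϑ₃ ϑ₄(z) / ϑ₁(z)`, `w₂ = π ϑ₂ ϑ₄ ϑ₃(z) / ϑ₁(z)`, `w₃ = π ϑ₃ ϑ₄ ϑ₂(z) / ϑ₁(z)`. -/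
def w (a : Fin 3) (z μ : ℂ) : ℂ := thetaConst a μ * thetaNum a z μ / theta1 z μ

/-- The function `Z_a = w_a / (2πi) · ϑ' / ϑ`, where `ϑ = ϑ₄, ϑ₃, ϑ₂` is the numerator of `w_a`;
the zeros of `ϑ` cancel, and the formula is written in the cancelled form
`π ϑ ϑ ϑ'(z) / (2πi ϑ₁(z))`. This function is holomorphic at `z = 0` (and at all integers),
where both `ϑ'` and `ϑ₁` have a (simple) zero; there it is given its limit `π ϑ ϑ ϑ'' / (2πi ϑ₁')`.
(At the remaining zeros of `ϑ₁` it has poles; its value there is irrelevant.) -/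
def Z (a : Fin 3) (z μ : ℂ) : ℂ :=
  if theta1 z μ = 0 then
    thetaConst a μ / (2 * Real.pi * Complex.I) *
      (deriv (deriv fun u => thetaNum a u μ) z / deriv (fun u => theta1 u μ) z)
  else
    thetaConst a μ / (2 * Real.pi * Complex.I) *
      (deriv (fun u => thetaNum a u μ) z / theta1 z μ)

/-- `z ∈ ℤ + μ ℤ`. -/
def InLattice (μ z : ℂ) : Prop := ∃ m n : ℤ, z = m + n * μ

/-! ### Pauli matrices and the connection -/

def pauli (a : Fin 3) : Mat2 :=
  ![!![0, 1; 1, 0], !![0, Complex.I; -Complex.I, 0], !![1, 0; 0, -1]] a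

/-- The component `M^a` of a traceless matrix `M = ∑ a, M^a σ_a`. -/
def coord (M : Mat2) (a : Fin 3) : ℂ := (pauli a * M).trace / 2

theorem sum_coord_smul_pauli (M : Mat2) (hM : M.trace = 0) :
    ∑ a, coord M a • pauli a = M := by
  have h : M 1 1 = -M 0 0 := by
    rw [Matrix.trace_fin_two] at hM
    linear_combination hM
  have hI : Complex.I * Complex.I = -1 := Complex.I_mul_I
  ext r c
  fin_cases r <;> fin_cases c <;>
    simp [Fin.sum_univ_three, coord, pauli, Matrix.trace_fin_two, Matrix.mul_apply,
      Matrix.add_apply, h]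
  · linear_combination (M 1 0 / 2 - M 0 1 / 2) * hI
  · linear_combination (M 0 1 / 2 - M 1 0 / 2) * hI

/-- `∑ a, M^a s_a σ_a`. -/
def twistSum (M : Mat2) (s : Fin 3 → ℂ) : Mat2 := ∑ a, (coord M a * s a) • pauli a

/-- The parameters of a torus (`Im μ > 0`) with pairwise distinct poles on it. -/
def configSpace (N : ℕ) : Set (Param N) :=
  {p | 0 < p.2.im ∧ ∀ i j, i ≠ j → ¬ InLattice p.2 (p.1 i - p.1 j)}

/-- The points `(λ, p)` with `p ∈ D` and `λ` different from all the poles `λ_j + m + n μ`. -/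
def puncturedSpace {N : ℕ} (D : Set (Param N)) : Set (Total N) :=
  {q | q.2 ∈ D ∧ ∀ j, ¬ InLattice q.2.2 (q.1 - q.2.1 j)}

/-- The direction of `∂/∂λ_i` in the space of parameters. -/
def dirPole {N : ℕ} (i : Fin N) : Param N := (Pi.single i 1, 0)

/-- The direction of `∂/∂μ` in the space of parameters. -/
def dirModule (N : ℕ) : Param N := (0, 1)

/-- The matrix of the values of a matrix of linear forms. -/
def evalForms {V : Type*} [NormedAddCommGroup V] [NormedSpace ℂ V]
    (L : Fin 2 → Fin 2 → (V →L[ℂ] ℂ)) (v : V) : Mat2 := Matrix.of fun r c => L r c v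

/-- The elliptic Schlesinger system for holomorphic functions `A_j : D → sl(2, ℂ)`. -/
def SchlesingerSystem {N : ℕ} (D : Set (Param N)) (A : Fin N → Param N → Mat2) : Prop :=
  ∀ p ∈ D, ∀ j, (A j p).trace = 0 ∧
    ∃ L : Fin 2 → Fin 2 → (Param N →L[ℂ] ℂ),
      (∀ r c, HasFDerivAt (fun q => A j q r c) (L r c) p) ∧
      (∀ i, i ≠ j → evalForms L (dirPole i)
        = ⁅A j p, twistSum (A i p) fun a => w a (p.1 j - p.1 i) p.2⁆) ∧
      (evalForms L (dirPole j)
        = -∑ i ∈ Finset.univ.erase j,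
            ⁅A j p, twistSum (A i p) fun a => w a (p.1 j - p.1 i) p.2⁆) ∧
      (evalForms L (dirModule N)
        = -∑ i, ⁅A j p, twistSum (A i p) fun a => Z a (p.1 j - p.1 i) p.2⁆)

/-! ### Multivalued functions

A multivalued function of `(λ, p)` is a function on a covering space `π : X → puncturedSpace D`. -/

section Cover

variable {N : ℕ} {D : Set (Param N)} {X : Type*} [TopologicalSpace X]

/-- The value of `λ` at a point of the covering. -/
def lam (π : X → puncturedSpace D) (x : X) : ℂ := (π x).1.1

/-- The value of the parameters at a point of the covering. -/
def par (π : X → puncturedSpace D) (x : X) : Param N := (π x).1.2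

/-- `L` is the (complex, Fréchet) derivative at `x` of the multivalued matrix function `Φ` with
respect to the variables `(λ, p)`. As `π` is a local homeomorphism onto an open subset of
`Total N`, this is differentiability of the branch of `Φ` through `x`. -/
def HasCoverDeriv (π : X → puncturedSpace D) (Φ : X → Mat2)
    (L : Fin 2 → Fin 2 → (Total N →L[ℂ] ℂ)) (x : X) : Prop :=
  ∀ r c, (fun y => Φ y r c - Φ x r c - L r c ((π y).1 - (π x).1))
    =o[𝓝 x] fun y => (π y).1 - (π x).1

/-- `Φ` takes values in `SL(2, ℂ)` and satisfies the linear system associated with `A`: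
`∂Φ/∂λ = ∑_j ∑_a A_j^a w_a(λ - λ_j) σ_a Φ`, `∂Φ/∂λ_j = -∑_a A_j^a w_a(λ - λ_j) σ_a Φ` and
`∂Φ/∂μ = ∑_j ∑_a A_j^a Z_a(λ - λ_j) σ_a Φ`. -/
def LinearSystem (π : X → puncturedSpace D) (A : Fin N → Param N → Mat2) (Φ : X → Mat2) : Prop :=
  ∀ x, (Φ x).det = 1 ∧
    ∃ L : Fin 2 → Fin 2 → (Total N →L[ℂ] ℂ), HasCoverDeriv π Φ L x ∧
      (evalForms L (1, 0) = (∑ j, twistSum (A j (par π x))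
        fun a => w a (lam π x - (par π x).1 j) (par π x).2) * Φ x) ∧
      (∀ j, evalForms L (0, dirPole j) = -(twistSum (A j (par π x))
        fun a => w a (lam π x - (par π x).1 j) (par π x).2) * Φ x) ∧
      (evalForms L (0, dirModule N) = (∑ j, twistSum (A j (par π x))
        fun a => Z a (lam π x - (par π x).1 j) (par π x).2) * Φ x)

/-- `g` is the (single-valued) function `(∂Φ/∂λ) Φ⁻¹`. -/
def IsLogDeriv (π : X → puncturedSpace D) (Φ : X → Mat2) (g : Param N → ℂ → Mat2) : Prop :=
  ∀ x, ∃ L : Fin 2 → Fin 2 → (Total N →L[ℂ] ℂ), HasCoverDeriv π Φ L x ∧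
    evalForms L (1, 0) * (Φ x)⁻¹ = g (par π x) (lam π x)

/-- The continuous lift `T` to `X` of a map of the punctured space (given by `π ∘ T`) acts on `Φ` by
`Φ(T x) = S Φ(x) M`, with a constant matrix `M`, independent of `λ` and of all parameters. -/
def HasMonodromy (Φ : X → Mat2) (T : X → X) (S M : Mat2) : Prop := ∀ x, Φ (T x) = S * Φ x * M

/-- `T x` is the end point of the lift, starting at `x`, of a loop in the `λ`-plane punctured at all
the poles (with the parameters fixed) that is freely homotopic there to a small positively
oriented circle around one of the points `λ_j + m + n μ`. -/
def Encircles (π : X → puncturedSpace D) (T : X → X) (j : Fin N) : Prop :=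
  ∃ (x : X) (Γ : Path x (T x)) (c : ℂ) (r : ℝ) (H : C(unitInterval × unitInterval, ℂ)),
    (∀ t, par π (Γ t) = par π x) ∧
    InLattice (par π x).2 (c - (par π x).1 j) ∧ 0 < r ∧
    (∀ i, ∀ z ∈ Metric.closedBall c r, InLattice (par π x).2 (z - (par π x).1 i) → z = c) ∧
    (∀ s t i, ¬ InLattice (par π x).2 (H (s, t) - (par π x).1 i)) ∧
    (∀ t, H (0, t) = lam π (Γ t)) ∧
    (∀ s, H (s, 0) = H (s, 1)) ∧
    (∀ t : unitInterval, H (1, t)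
      = c + r * Complex.exp (2 * Real.pi * Complex.I * ((t : ℝ) : ℂ)))

/-- `T x` is the end point of a path from `x`, along which the parameters are fixed, whose
projection to the torus does not meet (the projection of) some cut `κ` joining `λ_k` to `λ_l`. -/
def AvoidsCut (π : X → puncturedSpace D) (T : X → X) (k l : Fin N) : Prop :=
  ∃ (x : X) (Γ : Path x (T x)) (κ : Path ((par π x).1 k) ((par π x).1 l)),
    (∀ t, par π (Γ t) = par π x) ∧ ∀ s t, ¬ InLattice (par π x).2 (lam π (Γ t) - κ s)

end Cover

/-- `R` is the residue of the matrix function `g` at its isolated singularity `z`. -/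
def HasResidue (g : ℂ → Mat2) (z : ℂ) (R : Mat2) : Prop :=
  ∀ r c, MeromorphicAt (fun u => g u r c) z ∧
    ∀ᶠ ρ : ℝ in 𝓝[>] 0, (2 * Real.pi * Complex.I)⁻¹ * (∮ u in C(z, ρ), g u r c) = R r c

/-- `M = G diag(t, -t) G⁻¹` with `G ∈ SL(2, ℂ)`. -/
def Diagonalizes (G : Mat2) (t : ℂ) (M : Mat2) : Prop :=
  G.det = 1 ∧ M = G * Matrix.diagonal ![t, -t] * G⁻¹

/-! ### The transformation -/

/-- The matrix formed by the first columns of `Gk` and `Gl`. -/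
def firstColumns (Gk Gl : Mat2) : Mat2 := !![Gk 0 0, Gl 0 0; Gk 1 0, Gl 1 0]

/-- The equation `∑_a J_a w_a((λ_k - λ_l)/2) σ_a = -(1/2) G σ₃ G⁻¹` that defines `J`. -/
def DefinesJ {N : ℕ} (k l : Fin N) (G : Mat2) (p : Param N) (J : Fin 3 → ℂ) : Prop :=
  ∑ a, (J a * w a ((p.1 k - p.1 l) / 2) p.2) • pauli a = -(1 / 2 : ℂ) • (G * pauli 2 * G⁻¹)

/-- `f(λ) = 1/2 + ∑_a J_a w_a(λ - (λ_k + λ_l)/2) σ_a`. -/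
def dressing {N : ℕ} (k l : Fin N) (p : Param N) (J : Fin 3 → ℂ) (z : ℂ) : Mat2 :=
  (1 / 2 : ℂ) • (1 : Mat2) + ∑ a, (J a * w a (z - (p.1 k + p.1 l) / 2) p.2) • pauli a

/-- `F` is a continuous branch of the multivalued function `f / √(det f)`. At the poles
`λ = (λ_k + λ_l)/2 + m + n μ` of `f`, which are removable singularities of `f / √(det f)`, the value
of `F` is the one given by continuity. -/
def IsNormalizedDressing {N : ℕ} {D : Set (Param N)} {X : Type*} [TopologicalSpace X]
    (π : X → puncturedSpace D) (k l : Fin N) (J : Param N → Fin 3 → ℂ) (F : X → Mat2) : Prop :=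
  Continuous F ∧
    ∀ x, ¬ InLattice (par π x).2 (lam π x - ((par π x).1 k + (par π x).1 l) / 2) →
      ∃ s : ℂ, s ^ 2 = (dressing k l (par π x) (J (par π x)) (lam π x)).det ∧ s ≠ 0 ∧
        F x = s⁻¹ • dressing k l (par π x) (J (par π x)) (lam π x)

end EllipticSchlesinger

end

open EllipticSchlesinger

/-!
Write `H(λ) = ϑ₁(λ - (λ_k + λ_l)/2) f(λ)`. This is an entire matrix function of `λ`, it is
quasi-periodic up to conjugation with the Pauli matrices `σ₃` (for the period `1`) and `σ₁` (for the
period `μ`), and the choice of `J` says that `H(λ_k)` and `H(λ_l)` are multiples of the two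
complementary projections along the first columns of `G_k` and `G_l`. Hence `H(λ_j)` annihilates the
`t_j`-eigenvector of `A_j` for `j = k, l`. In particular `det H` vanishes at `λ_k` and `λ_l`, and by
Liouville's theorem it is `K(p) ϑ₁(λ - λ_k) ϑ₁(λ - λ_l)` with a factor `K(p) ≠ 0`
(`exists_det_dressMat`). These properties are collected in `IsDressing`. On the simply connected covering `X` the function
`det H`, which has no zeros there, has a continuous square root `s`, and `F = H / s` is a branch of
`f / √(det f)`; up to sign there are no others (`IsNormalizedDressing.exists_sqrt`).

The function `Ψ` is a solution of `dΨ = Ω Ψ`, where the form `Ω` (`conn`) has the coefficients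
`w_a`, `Z_a`. The transformed function `FΨ` then solves `d(FΨ) = Ω' FΨ`, where `Ω'` (`newConn`) is
the traceless part of `(dH + H Ω) H⁻¹`. In the direction of `λ`, the form `Ω'` has at most simple
poles at the `λ_j`: at `λ_k`, `λ_l` the double pole cancels because `H(λ_j) (A_j + t_j) = 0`. The
derivative of this relation with respect to the parameters, together with the Schlesinger system,
shows that `Ω'` is regular at `λ_j` in the directions along which `λ` moves with `λ_j`. So `Ω'` and
the form built from the residues `newRes` of `Ω'` have the same poles. The components of their
difference are elliptic up to signs, one of which is `-1`, without poles; by Liouville's theorem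
they vanish (`IsDressing.newConn_eq_conn`). This is the linear system for `FΨ`
(`IsDressing.linearSystem_mul`). As a linear system with a solution of determinant one has no
curvature, the comparison of residues in the zero curvature equation gives the Schlesinger system
(`LinearSystem.schlesingerSystem`). At `λ_k` and `λ_l` the column space of `H(λ_j)` is an
eigenspace of the residue, with the eigenvalue `-(t_j + 1/2)` (`IsDressing.newRes_mul`), and at the
other poles the residue is conjugate to `A_j`.

The monodromies of `Ψ` and `FΨ` differ by the monodromy of `s`, that is of
`√(ϑ₁(λ - λ_k) ϑ₁(λ - λ_l))`. Around a pole this changes its sign exactly for `j = k, l`, as the zeros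
are simple (`IsDressing.sqrt_of_encircles`). Along a path that avoids a cut from `λ_k` to `λ_l`, the
pole `λ_k` can be moved along the cut to `λ_l`, where the root becomes `ϑ₁(λ - λ_l)` and its
quasi-period is known (`IsDressing.sqrt_of_avoidsCut`).

The facts about theta functions that are needed, the position and the simplicity of their zeros and
Jacobi's formula `ϑ₁' = π ϑ₂ ϑ₃ ϑ₄` (`jacobi_derivative`), by which all `w_a` have residue one, are
derived from the series: the former by comparison with an infinite product, the latter from the
duplication formula and the heat equation.
-/

noncomputable section

namespace EllipticSchlesinger

/-! ### Theta series and their derivatives -/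

/-- The `m`-th term of the `k`-th `z`-derivative of the theta series. -/
def thetaTerm (k : ℕ) (p q : ℂ) (m : ℤ) (z μ : ℂ) : ℂ :=
  (2 * Real.pi * Complex.I * (m + p)) ^ k *
    Complex.exp (Real.pi * Complex.I * μ * (m + p) ^ 2 +
      2 * Real.pi * Complex.I * (m + p) * (z + q))

/-- The `k`-th `z`-derivative of the theta function with characteristic `[p, q]`. -/
def thetaD (k : ℕ) (p q z μ : ℂ) : ℂ := ∑' m : ℤ, thetaTerm k p q m z μ

lemma thetaD_zero (p q z μ : ℂ) : thetaD 0 p q z μ = theta p q z μ := by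
  simp [thetaD, theta, thetaTerm]

lemma thetaTerm_eq (k : ℕ) (p q : ℂ) (m : ℤ) (z μ : ℂ) :
    thetaTerm k p q m z μ = (2 * Real.pi * Complex.I * (m + p)) ^ k *
      Complex.exp (Real.pi * Complex.I * μ * p ^ 2 + 2 * Real.pi * Complex.I * p * (z + q)) *
      jacobiTheta₂_term m (z + q + p * μ) μ := by
  rw [thetaTerm, jacobiTheta₂_term, mul_assoc _ (Complex.exp _), ← Complex.exp_add]
  congr 2
  ring

/-- The exponential prefactor relating a theta series to `jacobiTheta₂` is locally bounded. -/
lemma norm_exp_prefactor_le (p q z μ : ℂ) {R : ℝ} (hz : ‖z‖ ≤ R) (hμ : ‖μ‖ ≤ R) :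
    ‖Complex.exp (Real.pi * Complex.I * μ * p ^ 2 + 2 * Real.pi * Complex.I * p * (z + q))‖ ≤
      Real.exp (Real.pi * R * ‖p‖ ^ 2 + 2 * Real.pi * ‖p‖ * (R + ‖q‖)) := by
  rw [Complex.norm_exp]
  refine Real.exp_le_exp.2 ((Complex.re_le_norm _).trans ((norm_add_le _ _).trans ?_))
  have h1 : ‖z + q‖ ≤ R + ‖q‖ := (norm_add_le _ _).trans (by gcongr)
  simp only [norm_mul, norm_pow, Complex.norm_I, Complex.norm_real, mul_one,
    Complex.norm_ofNat, Real.norm_eq_abs, abs_of_pos Real.pi_pos]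
  gcongr

lemma norm_factor_pow_le (k : ℕ) (p : ℂ) (m : ℤ) :
    ‖(2 * Real.pi * Complex.I * (m + p) : ℂ) ^ k‖ ≤
      (2 * Real.pi * (1 + ‖p‖)) ^ k * (|(m : ℝ)| ^ k + |(m : ℝ)| ^ 0) := by
  have h : ‖(2 * Real.pi * Complex.I * (m + p) : ℂ)‖ ≤
      2 * Real.pi * (1 + ‖p‖) * max |(m : ℝ)| 1 := by
    simp only [norm_mul, Complex.norm_I, Complex.norm_real, mul_one,
      Complex.norm_ofNat, Real.norm_eq_abs, abs_of_pos Real.pi_pos]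
    rw [mul_assoc (2 * Real.pi)]
    refine mul_le_mul_of_nonneg_left ((norm_add_le _ _).trans ?_) (by positivity)
    have : ‖(m : ℂ)‖ = |(m : ℝ)| := by rw [Complex.norm_intCast]
    rw [this, add_mul, one_mul]
    exact add_le_add (le_max_left _ _) (le_mul_of_one_le_right (norm_nonneg _) (le_max_right _ _))
  rw [norm_pow]
  refine (pow_le_pow_left₀ (norm_nonneg _) h k).trans ?_
  rw [mul_pow]
  refine mul_le_mul_of_nonneg_left ?_ (by positivity)
  rcases le_total |(m : ℝ)| 1 with h1 | h1
  · rw [max_eq_right h1]; simp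
  · rw [max_eq_left h1]; simp

/-- A summable bound for the terms of all theta series, uniform on a compact set. -/
def thetaBound (k : ℕ) (p q : ℂ) (R T : ℝ) (m : ℤ) : ℝ :=
  (2 * Real.pi * (1 + ‖p‖)) ^ k *
    Real.exp (Real.pi * R * ‖p‖ ^ 2 + 2 * Real.pi * ‖p‖ * (R + ‖q‖)) *
    (|(m : ℝ)| ^ k * Real.exp (-Real.pi * (T * m ^ 2 - 2 * (R + ‖q‖ + ‖p‖ * R) * |(m : ℝ)|)) +
      |(m : ℝ)| ^ 0 * Real.exp (-Real.pi * (T * m ^ 2 - 2 * (R + ‖q‖ + ‖p‖ * R) * |(m : ℝ)|)))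

lemma summable_thetaBound (k : ℕ) (p q : ℂ) (R : ℝ) {T : ℝ} (hT : 0 < T) :
    Summable (thetaBound k p q R T) := by
  have h := ((summable_pow_mul_jacobiTheta₂_term_bound (R + ‖q‖ + ‖p‖ * R) hT k).add
    (summable_pow_mul_jacobiTheta₂_term_bound (R + ‖q‖ + ‖p‖ * R) hT 0)).mul_left
    ((2 * Real.pi * (1 + ‖p‖)) ^ k *
      Real.exp (Real.pi * R * ‖p‖ ^ 2 + 2 * Real.pi * ‖p‖ * (R + ‖q‖)))
  refine h.congr fun m => ?_
  simp [thetaBound]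

lemma norm_thetaTerm_le (k : ℕ) (p q : ℂ) (m : ℤ) {z μ : ℂ} {R T : ℝ} (hT : 0 < T)
    (hz : ‖z‖ ≤ R) (hμ : ‖μ‖ ≤ R) (hμT : T ≤ μ.im) :
    ‖thetaTerm k p q m z μ‖ ≤ thetaBound k p q R T m := by
  have hS : |(z + q + p * μ).im| ≤ R + ‖q‖ + ‖p‖ * R := by
    refine (Complex.abs_im_le_norm _).trans ((norm_add_le _ _).trans ?_)
    refine add_le_add ((norm_add_le _ _).trans (by gcongr)) ?_
    rw [norm_mul]; gcongr
  have h3 := norm_jacobiTheta₂_term_le hT hS hμT m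
  have h1 := norm_factor_pow_le k p m
  have h2 := norm_exp_prefactor_le p q z μ hz hμ
  rw [thetaTerm_eq, norm_mul, norm_mul]
  refine (mul_le_mul (mul_le_mul h1 h2 (norm_nonneg _) (by positivity)) h3 (norm_nonneg _)
    (by positivity)).trans (le_of_eq ?_)
  simp only [thetaBound, Int.cast_abs]; ring

lemma summable_thetaTerm (k : ℕ) (p q z : ℂ) {μ : ℂ} (hμ : 0 < μ.im) :
    Summable fun m => thetaTerm k p q m z μ :=
  (summable_thetaBound k p q (max ‖z‖ ‖μ‖) hμ).of_norm_bounded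
    fun m => norm_thetaTerm_le k p q m hμ (le_max_left _ _) (le_max_right _ _) le_rfl

/-- The heat equation is built in: the `μ`-derivative is `1 / (4 π i)` times the second
`z`-derivative. -/
theorem hasFDerivAt_thetaD (k : ℕ) (p q z : ℂ) {μ : ℂ} (hμ : 0 < μ.im) :
    HasFDerivAt (fun x : ℂ × ℂ => thetaD k p q x.1 x.2)
      (thetaD (k + 1) p q z μ • ContinuousLinearMap.fst ℂ ℂ ℂ +
        (thetaD (k + 2) p q z μ / (4 * Real.pi * Complex.I)) • ContinuousLinearMap.snd ℂ ℂ ℂ)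
      (z, μ) := by
  set f' : ℤ → ℂ × ℂ → (ℂ × ℂ →L[ℂ] ℂ) := fun m x =>
    thetaTerm (k + 1) p q m x.1 x.2 • ContinuousLinearMap.fst ℂ ℂ ℂ +
      (thetaTerm (k + 2) p q m x.1 x.2 / (4 * Real.pi * Complex.I)) •
        ContinuousLinearMap.snd ℂ ℂ ℂ with hf'
  have hpi : (4 * Real.pi * Complex.I : ℂ) ≠ 0 := by simp [Real.pi_ne_zero]
  have hf (m : ℤ) (x : ℂ × ℂ) :
      HasFDerivAt (fun x : ℂ × ℂ => thetaTerm k p q m x.1 x.2) (f' m x) x := by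
    have h1 : HasFDerivAt (fun x : ℂ × ℂ => (Real.pi * Complex.I * (m + p) ^ 2) * x.2
        + (2 * Real.pi * Complex.I * (m + p)) * (x.1 + q))
        ((Real.pi * Complex.I * (m + p) ^ 2) • ContinuousLinearMap.snd ℂ ℂ ℂ +
          (2 * Real.pi * Complex.I * (m + p)) • ContinuousLinearMap.fst ℂ ℂ ℂ) x :=
      (hasFDerivAt_snd.const_mul _).add ((hasFDerivAt_fst.add_const q).const_mul _)
    have h2 := h1.cexp.const_mul ((2 * Real.pi * Complex.I * (m + p)) ^ k)
    have h3 : (fun x : ℂ × ℂ => thetaTerm k p q m x.1 x.2) = fun x : ℂ × ℂ =>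
        (2 * Real.pi * Complex.I * (m + p)) ^ k *
            Complex.exp ((Real.pi * Complex.I * (m + p) ^ 2) * x.2
        + (2 * Real.pi * Complex.I * (m + p)) * (x.1 + q)) := by
      funext x; rw [thetaTerm]; ring_nf
    rw [h3]
    refine h2.congr_fderiv ?_
    ext
    · simp [hf', thetaTerm, pow_succ]; ring_nf
    · simp [hf', thetaTerm, pow_succ]; field_simp; ring
  obtain ⟨T, hT, hTμ⟩ := exists_between hμ
  set R : ℝ := max ‖z‖ ‖μ‖ + 1 with hR
  set V : Set (ℂ × ℂ) := Metric.ball 0 R ×ˢ (Metric.ball 0 R ∩ {v | T < v.im}) with hV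
  have hVo : IsOpen V := Metric.isOpen_ball.prod (Metric.isOpen_ball.inter
    (isOpen_lt continuous_const Complex.continuous_im))
  have hVp : IsPreconnected V := ((convex_ball _ _).prod
    ((convex_ball _ _).inter (convex_halfSpace_im_gt T))).isPreconnected
  have hmem : (z, μ) ∈ V := by
    simp only [hV, Set.mem_prod, Metric.mem_ball, dist_zero_right, Set.mem_inter_iff,
      Set.mem_ofPred_eq]
    exact ⟨by linarith [le_max_left ‖z‖ ‖μ‖], by linarith [le_max_right ‖z‖ ‖μ‖], hTμ⟩
  have hnorm4 : (1 : ℝ) ≤ ‖(4 * Real.pi * Complex.I : ℂ)‖ := by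
    simp [abs_of_pos Real.pi_pos]; linarith [Real.pi_gt_three]
  have hb (m : ℤ) (x : ℂ × ℂ) (hx : x ∈ V) :
      ‖f' m x‖ ≤ thetaBound (k + 1) p q R T m + thetaBound (k + 2) p q R T m := by
    simp only [hV, Set.mem_prod, Metric.mem_ball, dist_zero_right, Set.mem_inter_iff,
      Set.mem_ofPred_eq] at hx
    refine (norm_add_le _ _).trans (add_le_add ?_ ?_)
    · rw [norm_smul]
      refine (mul_le_of_le_one_right (norm_nonneg _) (ContinuousLinearMap.norm_fst_le ..)).trans ?_
      exact norm_thetaTerm_le _ p q m hT hx.1.le hx.2.1.le hx.2.2.le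
    · rw [norm_smul]
      refine (mul_le_of_le_one_right (norm_nonneg _) (ContinuousLinearMap.norm_snd_le ..)).trans ?_
      rw [norm_div]
      exact (div_le_self (norm_nonneg _) hnorm4).trans
        (norm_thetaTerm_le _ p q m hT hx.1.le hx.2.1.le hx.2.2.le)
  have key := hasFDerivAt_tsum_of_isPreconnected
    ((summable_thetaBound (k + 1) p q R hT).add (summable_thetaBound (k + 2) p q R hT)) hVo hVp
    (fun m x _ => hf m x) hb hmem (summable_thetaTerm k p q z hμ) hmem
  refine key.congr_fderiv ?_
  have s1 := (summable_thetaTerm (k + 1) p q z hμ)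
  have s2 := (summable_thetaTerm (k + 2) p q z hμ)
  have e1 : HasSum (fun m => f' m (z, μ)) (thetaD (k + 1) p q z μ • ContinuousLinearMap.fst ℂ ℂ ℂ +
        (thetaD (k + 2) p q z μ / (4 * Real.pi * Complex.I)) • ContinuousLinearMap.snd ℂ ℂ ℂ) :=
    (s1.hasSum.smul_const _).add ((s2.hasSum.div_const _).smul_const _)
  exact e1.tsum_eq

theorem hasDerivAt_thetaD (k : ℕ) (p q z : ℂ) {μ : ℂ} (hμ : 0 < μ.im) :
    HasDerivAt (fun u => thetaD k p q u μ) (thetaD (k + 1) p q z μ) z := by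
  have h := (hasFDerivAt_thetaD k p q z hμ).comp_hasDerivAt z
    ((hasDerivAt_id z).prodMk (hasDerivAt_const z μ))
  simpa [Function.comp_def] using h

theorem hasDerivAt_thetaD_module (k : ℕ) (p q z : ℂ) {μ : ℂ} (hμ : 0 < μ.im) :
    HasDerivAt (fun ν => thetaD k p q z ν)
      (thetaD (k + 2) p q z μ / (4 * Real.pi * Complex.I)) μ := by
  have h := (hasFDerivAt_thetaD k p q z hμ).comp_hasDerivAt μ
    ((hasDerivAt_const μ z).prodMk (hasDerivAt_id μ))
  simpa [Function.comp_def] using h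

lemma contDiffOn_thetaD (n : ℕ) : ∀ (k : ℕ) (p q : ℂ),
    ContDiffOn ℂ n (fun x : ℂ × ℂ => thetaD k p q x.1 x.2) {x | 0 < x.2.im} := by
  have ho : IsOpen {x : ℂ × ℂ | 0 < x.2.im} :=
    isOpen_lt continuous_const (Complex.continuous_im.comp continuous_snd)
  induction n with
  | zero =>
    intro k p q
    rw [Nat.cast_zero, contDiffOn_zero]
    exact fun x hx => (hasFDerivAt_thetaD k p q x.1 hx).continuousAt.continuousWithinAt
  | succ n ih =>
    intro k p q
    rw [Nat.cast_succ, contDiffOn_succ_iff_hasFDerivWithinAt_of_uniqueDiffOn ho.uniqueDiffOn]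
    refine ⟨by simp, fun x => thetaD (k + 1) p q x.1 x.2 • ContinuousLinearMap.fst ℂ ℂ ℂ +
        (thetaD (k + 2) p q x.1 x.2 / (4 * Real.pi * Complex.I)) •
          ContinuousLinearMap.snd ℂ ℂ ℂ, ?_,
      fun x hx => (hasFDerivAt_thetaD k p q x.1 hx).hasFDerivWithinAt⟩
    exact ((ih _ p q).smul contDiffOn_const).add
      (((ih _ p q).div_const _).smul contDiffOn_const)

theorem contDiffAt_thetaD (n k : ℕ) (p q z : ℂ) {μ : ℂ} (hμ : 0 < μ.im) :
    ContDiffAt ℂ n (fun x : ℂ × ℂ => thetaD k p q x.1 x.2) (z, μ) :=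
  (contDiffOn_thetaD n k p q).contDiffAt
    ((isOpen_lt continuous_const (Complex.continuous_im.comp continuous_snd)).mem_nhds hμ)

/-! ### Quasi-periodicity and parity of the theta functions -/

section

lemma exp_two_pi_I_mul_half : Complex.exp (2 * Real.pi * Complex.I * (1 / 2)) = -1 := by
  rw [← Complex.exp_pi_mul_I]; ring_nf

lemma exp_two_pi_I_mul_int (n : ℤ) : Complex.exp (2 * Real.pi * Complex.I * n) = 1 := by
  rw [← Complex.exp_int_mul_two_pi_mul_I n]; ring_nf

lemma theta_add_one (p q z μ : ℂ) :
    theta p q (z + 1) μ = Complex.exp (2 * Real.pi * Complex.I * p) * theta p q z μ := by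
  rw [theta, theta, ← tsum_mul_left]
  refine tsum_congr fun m => ?_
  calc _ = Complex.exp (2 * Real.pi * Complex.I * m) * _ :=
        (by rw [← Complex.exp_add, ← Complex.exp_add]; congr 1; ring : _ =
          Complex.exp (2 * Real.pi * Complex.I * m) *
            (Complex.exp (2 * Real.pi * Complex.I * p) * Complex.exp (Real.pi * Complex.I * μ *
              (m + p) ^ 2 + 2 * Real.pi * Complex.I * (m + p) * (z + q))))
    _ = _ := by rw [exp_two_pi_I_mul_int, one_mul]

lemma theta_add_char_one (p q z μ : ℂ) :
    theta p (q + 1) z μ = Complex.exp (2 * Real.pi * Complex.I * p) * theta p q z μ := by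
  rw [← theta_add_one, theta, theta]
  refine tsum_congr fun m => ?_
  congr 1; ring

/-- The factor by which a theta function changes under `z ↦ z + μ`. -/
def quasiFactor (z μ : ℂ) : ℂ :=
  Complex.exp (-Real.pi * Complex.I * μ - 2 * Real.pi * Complex.I * z)

lemma quasiFactor_ne_zero (z μ : ℂ) : quasiFactor z μ ≠ 0 := Complex.exp_ne_zero _

lemma theta_add_module (p q z μ : ℂ) :
    theta p q (z + μ) μ =
      Complex.exp (-(2 * Real.pi * Complex.I * q)) * (quasiFactor z μ * theta p q z μ) := by
  rw [theta, theta, ← (Equiv.addRight (1 : ℤ)).tsum_eq (fun m : ℤ => Complex.exp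
    (Real.pi * Complex.I * μ * (m + p) ^ 2 + 2 * Real.pi * Complex.I * (m + p) * (z + q))),
    ← tsum_mul_left, ← tsum_mul_left]
  refine tsum_congr fun m => ?_
  rw [quasiFactor, ← Complex.exp_add, ← Complex.exp_add]
  congr 1; simp; ring

lemma theta_add_half_module (q z μ : ℂ) :
    theta 0 q (z + μ / 2) μ =
      Complex.exp (-Real.pi * Complex.I * (μ / 4 + z + q)) * theta (1 / 2) q z μ := by
  rw [theta, theta, ← tsum_mul_left]
  refine tsum_congr fun m => ?_
  rw [← Complex.exp_add]
  congr 1; ring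

lemma theta_neg_zero (q z μ : ℂ) : theta 0 q (-z) μ = theta 0 (-q) z μ := by
  rw [theta, theta, ← (Equiv.neg ℤ).tsum_eq]
  refine tsum_congr fun m => ?_
  congr 1; simp; ring

lemma theta_neg_half (q z μ : ℂ) : theta (1 / 2) q (-z) μ = theta (1 / 2) (-q) z μ := by
  rw [theta, theta, ← (Equiv.subLeft (-1 : ℤ)).tsum_eq]
  refine tsum_congr fun m => ?_
  congr 1; simp; ring

variable (z μ : ℂ)

lemma theta1_add_one : theta1 (z + 1) μ = -theta1 z μ := by
  rw [theta1, theta_add_one, exp_two_pi_I_mul_half, theta1]; ring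
lemma theta2_add_one : theta2 (z + 1) μ = -theta2 z μ := by
  rw [theta2, theta_add_one, exp_two_pi_I_mul_half, theta2]; ring
lemma theta3_add_one : theta3 (z + 1) μ = theta3 z μ := by
  rw [theta3, theta_add_one, theta3]; simp
lemma theta4_add_one : theta4 (z + 1) μ = theta4 z μ := by
  rw [theta4, theta_add_one, theta4]; simp

lemma theta1_add_module : theta1 (z + μ) μ = -quasiFactor z μ * theta1 z μ := by
  rw [theta1, theta_add_module, Complex.exp_neg, exp_two_pi_I_mul_half, theta1]; ring
lemma theta2_add_module : theta2 (z + μ) μ = quasiFactor z μ * theta2 z μ := by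
  rw [theta2, theta_add_module, theta2]; simp
lemma theta3_add_module : theta3 (z + μ) μ = quasiFactor z μ * theta3 z μ := by
  rw [theta3, theta_add_module, theta3]; simp
lemma theta4_add_module : theta4 (z + μ) μ = -quasiFactor z μ * theta4 z μ := by
  rw [theta4, theta_add_module, Complex.exp_neg, exp_two_pi_I_mul_half, theta4]; ring

lemma theta1_neg : theta1 (-z) μ = -theta1 z μ := by
  have h := theta_add_char_one (1 / 2) (-(1 / 2)) z μ
  rw [exp_two_pi_I_mul_half, show (-(1 / 2) + 1 : ℂ) = 1 / 2 by norm_num] at h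
  rw [theta1, theta_neg_half, theta1, h]; ring
lemma theta2_neg : theta2 (-z) μ = theta2 z μ := by
  rw [theta2, theta_neg_half, theta2, neg_zero]
lemma theta3_neg : theta3 (-z) μ = theta3 z μ := by
  rw [theta3, theta_neg_zero, theta3, neg_zero]
lemma theta4_neg : theta4 (-z) μ = theta4 z μ := by
  have h := theta_add_char_one 0 (-(1 / 2)) z μ
  rw [show (-(1 / 2) + 1 : ℂ) = 1 / 2 by norm_num] at h
  rw [theta4, theta_neg_zero, theta4, h]; simp

lemma theta1_add_half : theta1 (z + 1 / 2) μ = theta2 z μ := by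
  have h := theta_add_char_one (1 / 2) 0 z μ
  rw [exp_two_pi_I_mul_half] at h
  have h' : theta (1 / 2) (1 / 2) (z + 1 / 2) μ = theta (1 / 2) (0 + 1) z μ := by
    rw [theta, theta]
    refine tsum_congr fun m => ?_
    congr 1; ring
  rw [theta1, h', h, theta2]; ring
lemma theta3_add_half : theta3 (z + 1 / 2) μ = theta4 z μ := by
  rw [theta3, theta4, theta, theta]
  refine tsum_congr fun m => ?_
  congr 1; ring
lemma theta4_add_half : theta4 (z + 1 / 2) μ = theta3 z μ := by
  rw [← theta3_add_half, ← theta3_add_one z]; congr 1; ring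
lemma theta3_add_half_module :
    theta3 (z + μ / 2) μ = Complex.exp (-Real.pi * Complex.I * (μ / 4 + z + 0)) * theta2 z μ := by
  rw [theta3, theta_add_half_module, theta2]
lemma theta4_add_half_module :
    theta4 (z + μ / 2) μ =
      -Complex.exp (-Real.pi * Complex.I * (μ / 4 + z + 1 / 2)) * theta1 z μ := by
  rw [theta4, theta_add_half_module, theta1]; ring

lemma theta1_zero : theta1 0 μ = 0 := by
  have h := theta1_neg 0 μ
  rw [neg_zero] at h
  linear_combination h / 2

/-! ### The lattice -/

variable {z μ}

lemma InLattice.add {a b : ℂ} (ha : InLattice μ a) (hb : InLattice μ b) : InLattice μ (a + b) := by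
  obtain ⟨m, n, rfl⟩ := ha
  obtain ⟨m', n', rfl⟩ := hb
  exact ⟨m + m', n + n', by push_cast; ring⟩

lemma InLattice.neg {a : ℂ} (ha : InLattice μ a) : InLattice μ (-a) := by
  obtain ⟨m, n, rfl⟩ := ha
  exact ⟨-m, -n, by push_cast; ring⟩

lemma InLattice.sub {a b : ℂ} (ha : InLattice μ a) (hb : InLattice μ b) : InLattice μ (a - b) := by
  rw [sub_eq_add_neg]; exact ha.add hb.neg

lemma inLattice_one : InLattice μ 1 := ⟨1, 0, by simp⟩
lemma inLattice_module : InLattice μ μ := ⟨0, 1, by simp⟩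

lemma inLattice_add_iff {a b : ℂ} (hb : InLattice μ b) : InLattice μ (a + b) ↔ InLattice μ a :=
  ⟨fun h => by simpa using h.sub hb, fun h => h.add hb⟩

lemma inLattice_neg_iff {a : ℂ} : InLattice μ (-a) ↔ InLattice μ a :=
  ⟨fun h => by simpa using h.neg, fun h => h.neg⟩

lemma inLattice_add_one_sub {z a : ℂ} : InLattice μ (z + 1 - a) ↔ InLattice μ (z - a) := by
  rw [add_sub_right_comm, inLattice_add_iff inLattice_one]

lemma inLattice_add_module_sub {z a : ℂ} : InLattice μ (z + μ - a) ↔ InLattice μ (z - a) := by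
  rw [add_sub_right_comm, inLattice_add_iff inLattice_module]

lemma InLattice.eq_zero {a : ℂ} (hμ : 0 < μ.im) (ha : InLattice μ a) (h1 : ‖a‖ < 1)
    (h2 : ‖a‖ < μ.im) : a = 0 := by
  obtain ⟨m, n, rfl⟩ := ha
  have hn : n = 0 := by
    have h3 := (Complex.abs_im_le_norm _).trans_lt h2
    have h4 : ((m : ℂ) + n * μ).im = n * μ.im := by simp
    rw [h4, abs_mul, abs_of_pos hμ] at h3
    have h5 : |(n : ℝ)| < 1 := by
      by_contra h; push Not at h; nlinarith
    have h6 : |n| < 1 := by exact_mod_cast h5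
    simpa using Int.abs_lt_one_iff.1 h6
  subst hn
  have h5 : |(m : ℝ)| < 1 := by simpa [Complex.norm_intCast] using h1
  have h6 : |m| < 1 := by exact_mod_cast h5
  simp [Int.abs_lt_one_iff.1 h6]

lemma eventually_not_inLattice (hμ : 0 < μ.im) (z a : ℂ) :
    ∀ᶠ u in 𝓝[≠] z, ¬ InLattice μ (u - a) := by
  set δ := min 1 μ.im / 2 with hδ
  have hδ0 : 0 < δ := by rw [hδ]; have := lt_min one_pos hμ; linarith
  by_cases h : ∃ b ∈ Metric.ball z δ, b ≠ z ∧ InLattice μ (b - a)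
  · obtain ⟨b, hb, hbz, hbL⟩ := h
    have h1 : ∀ᶠ u in 𝓝[≠] z, u ≠ b :=
      (isOpen_ne.mem_nhds (Ne.symm hbz)) |> fun h => mem_nhdsWithin_of_mem_nhds h
    have h2 : ∀ᶠ u in 𝓝[≠] z, u ∈ Metric.ball z δ :=
      mem_nhdsWithin_of_mem_nhds (Metric.ball_mem_nhds z hδ0)
    filter_upwards [h1, h2] with u hu1 hu2 hu3
    apply hu1
    have h4 : InLattice μ (u - b) := by simpa using hu3.sub hbL
    have h5 : ‖u - b‖ < 2 * δ := by
      rw [← dist_eq_norm]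
      have := dist_triangle_right u b z
      rw [Metric.mem_ball] at hb hu2
      linarith
    have h6 : 2 * δ = min 1 μ.im := by rw [hδ]; ring
    rw [h6] at h5
    exact sub_eq_zero.1 (h4.eq_zero hμ (h5.trans_le (min_le_left _ _))
      (h5.trans_le (min_le_right _ _)))
  · push Not at h
    filter_upwards [mem_nhdsWithin_of_mem_nhds (Metric.ball_mem_nhds z hδ0),
      self_mem_nhdsWithin] with u hu1 hu2
    exact h u hu1 hu2

lemma eventually_not_inLattice_nhds (hμ : 0 < μ.im) {z a : ℂ} (h : ¬ InLattice μ (z - a)) :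
    ∀ᶠ u in 𝓝 z, ¬ InLattice μ (u - a) := by
  have h1 := eventually_not_inLattice hμ z a
  rw [eventually_nhdsWithin_iff] at h1
  filter_upwards [h1] with u hu
  by_cases huz : u = z
  · rwa [huz]
  · exact hu huz

/-! ### Liouville's theorem for quasi-periodic functions -/

/-- A function that is holomorphic off finitely many classes `s j + Λ`, with removable
singularities there, and that is periodic up to sign for both periods, is constant. -/
theorem exists_const_of_periodic_up_to_sign {ι : Type*} [Finite ι] (hμ : 0 < μ.im) (s : ι → ℂ)
    (g : ℂ → ℂ) (hd : ∀ z, (∀ j, ¬ InLattice μ (z - s j)) → DifferentiableAt ℂ g z)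
    (hs : ∀ j, Tendsto (fun z => (z - s j) * g z) (𝓝[≠] (s j)) (𝓝 0)) {ε ε' : ℂ}
    (hε : ε = 1 ∨ ε = -1) (hε' : ε' = 1 ∨ ε' = -1)
    (h1 : ∀ z, (∀ j, ¬ InLattice μ (z - s j)) → g (z + 1) = ε * g z)
    (hmu : ∀ z, (∀ j, ¬ InLattice μ (z - s j)) → g (z + μ) = ε' * g z) :
    ∃ c, ∀ z, (∀ j, ¬ InLattice μ (z - s j)) → g z = c := by
  set S : Set ℂ := {z | ∀ j, ¬ InLattice μ (z - s j)} with hS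
  have hiso (z : ℂ) : ∀ᶠ u in 𝓝[≠] z, u ∈ S :=
    eventually_all.2 fun j => eventually_not_inLattice hμ z (s j)
  have hopen {z : ℂ} (hz : z ∈ S) : ∀ᶠ u in 𝓝 z, u ∈ S :=
    eventually_all.2 fun j => eventually_not_inLattice_nhds hμ (hz j)
  have hS1 {z : ℂ} : z + 1 ∈ S ↔ z ∈ S := forall_congr' fun j => by rw [inLattice_add_one_sub]
  have hSm {z : ℂ} : z + μ ∈ S ↔ z ∈ S := forall_congr' fun j => by rw [inLattice_add_module_sub]
  -- translation by any lattice vector multiplies `g` by a sign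
  have hint (n : ℤ) : ∃ e : ℂ, (e = 1 ∨ e = -1) ∧ ∀ z ∈ S, z + n ∈ S ∧ g (z + n) = e * g z := by
    induction n using Int.induction_on with
    | zero => exact ⟨1, Or.inl rfl, fun z hz => by simpa using hz⟩
    | succ n ih =>
      obtain ⟨e, he, ih⟩ := ih
      refine ⟨ε * e, by rcases hε with rfl | rfl <;> rcases he with rfl | rfl <;> simp,
        fun z hz => ?_⟩
      have h2 := ih z hz
      have h3 : z + ((n + 1 : ℤ) : ℂ) = z + (n : ℤ) + 1 := by push_cast; ring
      rw [h3, hS1, h1 _ h2.1, h2.2]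
      exact ⟨h2.1, by ring⟩
    | pred n ih =>
      obtain ⟨e, he, ih⟩ := ih
      refine ⟨ε * e, by rcases hε with rfl | rfl <;> rcases he with rfl | rfl <;> simp,
        fun z hz => ?_⟩
      have h2 := ih z hz
      have h3 : z + ((-n - 1 : ℤ) : ℂ) + 1 = z + ((-n : ℤ) : ℂ) := by push_cast; ring
      have h4 : z + ((-n - 1 : ℤ) : ℂ) ∈ S := by rw [← hS1, h3]; exact h2.1
      refine ⟨h4, ?_⟩
      have h5 := h1 _ h4
      rw [h3, h2.2] at h5
      rw [mul_assoc, h5, ← mul_assoc]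
      rcases hε with rfl | rfl <;> simp
  have hintm (n : ℤ) : ∃ e : ℂ, (e = 1 ∨ e = -1) ∧
      ∀ z ∈ S, z + n * μ ∈ S ∧ g (z + n * μ) = e * g z := by
    induction n using Int.induction_on with
    | zero => exact ⟨1, Or.inl rfl, fun z hz => by simpa using hz⟩
    | succ n ih =>
      obtain ⟨e, he, ih⟩ := ih
      refine ⟨ε' * e, by rcases hε' with rfl | rfl <;> rcases he with rfl | rfl <;> simp,
        fun z hz => ?_⟩
      have h2 := ih z hz
      have h3 : z + ((n + 1 : ℤ) : ℂ) * μ = z + (n : ℤ) * μ + μ := by push_cast; ring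
      rw [h3, hSm, hmu _ h2.1, h2.2]
      exact ⟨h2.1, by ring⟩
    | pred n ih =>
      obtain ⟨e, he, ih⟩ := ih
      refine ⟨ε' * e, by rcases hε' with rfl | rfl <;> rcases he with rfl | rfl <;> simp,
        fun z hz => ?_⟩
      have h2 := ih z hz
      have h3 : z + ((-n - 1 : ℤ) : ℂ) * μ + μ = z + ((-n : ℤ) : ℂ) * μ := by push_cast; ring
      have h4 : z + ((-n - 1 : ℤ) : ℂ) * μ ∈ S := by rw [← hSm, h3]; exact h2.1
      refine ⟨h4, ?_⟩
      have h5 := hmu _ h4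
      rw [h3, h2.2] at h5
      rw [mul_assoc, h5, ← mul_assoc]
      rcases hε' with rfl | rfl <;> simp
  have hlat (l : ℂ) (hl : InLattice μ l) : ∃ e : ℂ, (e = 1 ∨ e = -1) ∧
      ∀ z ∈ S, z + l ∈ S ∧ g (z + l) = e * g z := by
    obtain ⟨m, n, rfl⟩ := hl
    obtain ⟨e, he, h⟩ := hint m
    obtain ⟨e', he', h'⟩ := hintm n
    refine ⟨e' * e, by rcases he with rfl | rfl <;> rcases he' with rfl | rfl <;> simp,
        fun z hz => ?_⟩
    have h2 := h z hz
    have h3 := h' _ h2.1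
    rw [← add_assoc]
    exact ⟨h3.1, by rw [h3.2, h2.2]; ring⟩
  -- all singularities are removable
  have hsing (a : ℂ) (ha : a ∉ S) : Tendsto (fun z => (z - a) * g z) (𝓝[≠] a) (𝓝 0) := by
    obtain ⟨j, hj⟩ : ∃ j, InLattice μ (a - s j) := by simpa [hS] using ha
    obtain ⟨e, he, h⟩ := hlat (a - s j) hj
    have h2 : Tendsto (fun z => z - (a - s j)) (𝓝[≠] a) (𝓝[≠] (s j)) := by
      refine tendsto_nhdsWithin_of_tendsto_nhds_of_eventually_within _ ?_ ?_
      · have : Tendsto (fun z => z - (a - s j)) (𝓝 a) (𝓝 (a - (a - s j))) :=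
          (continuous_id.sub continuous_const).tendsto a
        rw [sub_sub_cancel] at this
        exact this.mono_left nhdsWithin_le_nhds
      · filter_upwards [self_mem_nhdsWithin] with u hu hu2
        apply hu
        simp only [Set.mem_singleton_iff] at hu2 ⊢
        linear_combination hu2
    have h3 := ((hs j).comp h2).const_mul e
    rw [mul_zero] at h3
    refine h3.congr' ?_
    filter_upwards [h2.eventually (hiso (s j))] with u hu
    have h4 := (h _ hu).2
    rw [sub_add_cancel] at h4
    simp only [Function.comp, h4]
    ring
  set G : ℂ → ℂ := fun z => limUnder (𝓝[≠] z) g with hG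
  have hGg {z : ℂ} (hz : z ∈ S) : G z = g z :=
    ((hd z hz).continuousAt.tendsto.mono_left nhdsWithin_le_nhds).limUnder_eq
  have hGd : Differentiable ℂ G := by
    intro a
    by_cases ha : a ∈ S
    · refine (hd a ha).congr_of_eventuallyEq ?_
      filter_upwards [hopen ha] with u hu using hGg hu
    · have h1 := hiso a
      rw [eventually_nhdsWithin_iff] at h1
      obtain ⟨U, hU, hUo⟩ := h1.exists_mem
      have h2 : DifferentiableOn ℂ g (U \ {a}) := fun u hu =>
        (hd u (hUo u hu.1 hu.2)).differentiableWithinAt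
      have h3 : (fun z => g z - g a) =o[𝓝[≠] a] fun z => (z - a)⁻¹ := by
        rw [isLittleO_iff_tendsto']
        · have h4 : Tendsto (fun z => (z - a) * g z - (z - a) * g a) (𝓝[≠] a) (𝓝 (0 - 0)) := by
            refine (hsing a ha).sub ?_
            have : Tendsto (fun z => (z - a) * g a) (𝓝 a) (𝓝 ((a - a) * g a)) :=
              ((continuous_id.sub continuous_const).mul continuous_const).tendsto a
            rw [sub_self, zero_mul] at this
            exact this.mono_left nhdsWithin_le_nhds
          rw [sub_zero] at h4
          refine h4.congr fun u => ?_
          rw [div_inv_eq_mul]; ring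
        · filter_upwards [self_mem_nhdsWithin] with u hu h5
          exact absurd (sub_eq_zero.1 (inv_eq_zero.1 h5)) hu
      have h4 :=
        (Complex.differentiableOn_update_limUnder_of_isLittleO hU h2 h3).differentiableAt hU
      refine h4.congr_of_eventuallyEq ?_
      filter_upwards [hU] with u hu
      by_cases hua : u = a
      · rw [hua, Function.update_self]
      · rw [Function.update_of_ne hua]; exact hGg (hUo u hu hua)
  -- `G` is bounded on the fundamental parallelogram, hence everywhere
  have hcomp : IsCompact ((fun x : ℝ × ℝ => (x.1 : ℂ) + x.2 * μ) '' (Set.Icc 0 1 ×ˢ Set.Icc 0 1)) :=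
    (isCompact_Icc.prod isCompact_Icc).image (by fun_prop)
  obtain ⟨M, hM⟩ := hcomp.exists_bound_of_continuousOn hGd.continuous.continuousOn
  have hb1 (z : ℂ) (hz : z ∈ S) : ‖G z‖ ≤ M := by
    set y := z.im / μ.im with hy
    set x := z.re - y * μ.re with hx
    have hzxy : z = x + y * μ := by
      apply Complex.ext
      · simp [hx]
      · simp [hy, hμ.ne']
    obtain ⟨e, he, h⟩ := hlat (((-⌊x⌋ : ℤ) : ℂ) + ((-⌊y⌋ : ℤ) : ℂ) * μ) ⟨_, _, rfl⟩
    have h2 := h z hz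
    have h3 : ‖g (z + (((-⌊x⌋ : ℤ) : ℂ) + ((-⌊y⌋ : ℤ) : ℂ) * μ))‖ = ‖g z‖ := by
      rw [h2.2]; rcases he with rfl | rfl <;> simp
    rw [hGg hz, ← h3, ← hGg h2.1]
    apply hM
    refine ⟨(Int.fract x, Int.fract y), ⟨⟨Int.fract_nonneg _, (Int.fract_lt_one _).le⟩,
      ⟨Int.fract_nonneg _, (Int.fract_lt_one _).le⟩⟩, ?_⟩
    simp only [Int.fract]
    rw [hzxy]; push_cast; ring
  have hb2 (z : ℂ) : ‖G z‖ ≤ M := by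
    have hc : Tendsto (fun u => ‖G u‖) (𝓝[≠] z) (𝓝 ‖G z‖) :=
      (hGd.continuous.norm.tendsto z).mono_left nhdsWithin_le_nhds
    exact le_of_tendsto hc ((hiso z).mono fun u hu => hb1 u hu)
  refine ⟨G 0, fun z hz => ?_⟩
  rw [← hGg hz]
  refine hGd.apply_eq_apply_of_bounded ?_ _ _
  rw [isBounded_iff_forall_norm_le]
  exact ⟨M, by rintro _ ⟨z, rfl⟩; exact hb2 z⟩

/-- If moreover one of the two signs is `-1`, the function vanishes. -/
theorem eq_zero_of_periodic_up_to_sign {ι : Type*} [Finite ι] (hμ : 0 < μ.im) (s : ι → ℂ)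
    (g : ℂ → ℂ) (hd : ∀ z, (∀ j, ¬ InLattice μ (z - s j)) → DifferentiableAt ℂ g z)
    (hs : ∀ j, Tendsto (fun z => (z - s j) * g z) (𝓝[≠] (s j)) (𝓝 0)) {ε ε' : ℂ}
    (hε : ε = 1 ∨ ε = -1) (hε' : ε' = 1 ∨ ε' = -1) (hεε' : ε = -1 ∨ ε' = -1)
    (h1 : ∀ z, (∀ j, ¬ InLattice μ (z - s j)) → g (z + 1) = ε * g z)
    (hmu : ∀ z, (∀ j, ¬ InLattice μ (z - s j)) → g (z + μ) = ε' * g z)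
    (z : ℂ) (hz : ∀ j, ¬ InLattice μ (z - s j)) : g z = 0 := by
  obtain ⟨c, hc⟩ := exists_const_of_periodic_up_to_sign hμ s g hd hs hε hε' h1 hmu
  have hz1 : ∀ j, ¬ InLattice μ (z + 1 - s j) := fun j => by
    rw [inLattice_add_one_sub]; exact hz j
  have hzm : ∀ j, ¬ InLattice μ (z + μ - s j) := fun j => by
    rw [inLattice_add_module_sub]; exact hz j
  rcases hεε' with h | h
  · have := h1 z hz
    rw [hc _ hz, hc _ hz1, h] at this
    rw [hc _ hz]; linear_combination this / 2
  · have := hmu z hz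
    rw [hc _ hz, hc _ hzm, h] at this
    rw [hc _ hz]; linear_combination this / 2

end

/-! ### The zeros of the theta functions -/

section

lemma tendsto_div_of_hasDerivAt {f : ℂ → ℂ} {f' a : ℂ} (h : HasDerivAt f f' a) (h0 : f a = 0) :
    Tendsto (fun z => f z / (z - a)) (𝓝[≠] a) (𝓝 f') := by
  refine (hasDerivAt_iff_tendsto_slope.1 h).congr fun z => ?_
  rw [slope_def_field, h0, sub_zero]

lemma tendsto_sub_div_of_hasDerivAt {f : ℂ → ℂ} {f' a : ℂ} (h : HasDerivAt f f' a) (h0 : f a = 0)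
    (h' : f' ≠ 0) : Tendsto (fun z => (z - a) / f z) (𝓝[≠] a) (𝓝 f'⁻¹) := by
  refine ((tendsto_div_of_hasDerivAt h h0).inv₀ h').congr fun z => ?_
  rw [inv_div]

lemma tendsto_sub_nhdsNE (a : ℂ) : Tendsto (fun z => z - a) (𝓝[≠] a) (𝓝 0) := by
  have : Tendsto (fun z => z - a) (𝓝 a) (𝓝 (a - a)) :=
    (continuous_id.sub continuous_const).tendsto a
  rw [sub_self] at this
  exact this.mono_left nhdsWithin_le_nhds

/-- The infinite product `∏ (1 - Q ^ n w)`. -/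
def qProd (Q w : ℂ) : ℂ := ∏' n : ℕ, (1 + -(Q ^ n * w))

lemma summable_norm_qProd_term {Q : ℂ} (hQ : ‖Q‖ < 1) (w : ℂ) :
    Summable fun n : ℕ => ‖-(Q ^ n * w)‖ := by
  simp only [norm_neg, norm_mul, norm_pow]
  exact (summable_geometric_of_lt_one (norm_nonneg _) hQ).mul_right _

lemma qProd_eq_mul {Q : ℂ} (hQ : ‖Q‖ < 1) (w : ℂ) : qProd Q w = (1 - w) * qProd Q (Q * w) := by
  have h : Multipliable fun n : ℕ => 1 + -(Q ^ (n + 1) * w) := by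
    have := multipliable_one_add_of_summable (summable_norm_qProd_term hQ (Q * w))
    refine this.congr fun n => ?_
    rw [pow_succ, mul_assoc]
  have h1 := tprod_eq_zero_mul' (f := fun n : ℕ => 1 + -(Q ^ n * w)) h
  have h2 : ∏' n : ℕ, (1 + -(Q ^ (n + 1) * w)) = qProd Q (Q * w) :=
    tprod_congr fun n => by rw [pow_succ, mul_assoc]
  rw [h2, pow_zero, one_mul, ← sub_eq_add_neg] at h1
  exact h1

lemma qProd_ne_zero {Q w : ℂ} (hQ : ‖Q‖ < 1) (h : ∀ n : ℕ, Q ^ n * w ≠ 1) : qProd Q w ≠ 0 := by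
  refine tprod_one_add_ne_zero_of_summable (fun n => ?_) (summable_norm_qProd_term hQ w)
  rw [← sub_eq_add_neg, sub_ne_zero]
  exact (h n).symm

lemma differentiable_qProd {Q : ℂ} (hQ : ‖Q‖ < 1) : Differentiable ℂ (qProd Q) := by
  have h : HasProdLocallyUniformlyOn (fun (n : ℕ) (w : ℂ) => 1 + -(Q ^ n * w)) (qProd Q)
      Set.univ := by
    apply hasProdLocallyUniformlyOn_of_forall_compact isOpen_univ
    intro K _ hcK
    obtain ⟨R, hR⟩ := hcK.exists_bound_of_continuousOn (continuous_id.continuousOn)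
    refine ((summable_geometric_of_lt_one (norm_nonneg _) hQ).mul_right
      R).hasProdUniformlyOn_nat_one_add hcK (.of_forall fun n x hx => ?_)
      (fun _ => by fun_prop)
    rw [norm_neg, norm_mul, norm_pow]
    exact mul_le_mul_of_nonneg_left (hR x hx) (by positivity)
  have := h.differentiableOn (.of_forall fun _ => by
    simpa [Finset.prod_fn] using DifferentiableOn.finsetProd (fun _ _ => by fun_prop)) isOpen_univ
  exact fun z => (this z trivial).differentiableAt univ_mem

variable {μ : ℂ}

lemma norm_exp_module_lt_one (hμ : 0 < μ.im) :
    ‖Complex.exp (2 * Real.pi * Complex.I * μ)‖ < 1 := by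
  rw [Complex.norm_exp, Real.exp_lt_one_iff]
  have : (2 * Real.pi * Complex.I * μ : ℂ).re = -(2 * Real.pi * μ.im) := by simp
  rw [this]
  have := Real.pi_pos
  have := mul_pos this hμ
  linarith

/-- An entire function with the zeros and the quasi-periods of `exp (π i z) ϑ₁(z)`. -/
def thetaProd (z μ : ℂ) : ℂ :=
  qProd (Complex.exp (2 * Real.pi * Complex.I * μ)) (Complex.exp (2 * Real.pi * Complex.I * z)) *
  qProd (Complex.exp (2 * Real.pi * Complex.I * μ))
    (Complex.exp (2 * Real.pi * Complex.I * (μ - z)))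

lemma differentiable_thetaProd (hμ : 0 < μ.im) : Differentiable ℂ fun z => thetaProd z μ := by
  have h := differentiable_qProd (norm_exp_module_lt_one hμ)
  have h1 : Differentiable ℂ fun z : ℂ => Complex.exp (2 * Real.pi * Complex.I * z) := by fun_prop
  have h2 : Differentiable ℂ fun z : ℂ => Complex.exp (2 * Real.pi * Complex.I * (μ - z)) := by
    fun_prop
  exact (h.comp h1).mul (h.comp h2)

lemma thetaProd_add_one (z : ℂ) : thetaProd (z + 1) μ = thetaProd z μ := by
  have h1 : Complex.exp (2 * Real.pi * Complex.I * (z + 1)) =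
      Complex.exp (2 * Real.pi * Complex.I * z) := by
    rw [Complex.exp_eq_exp_iff_exists_int]; exact ⟨1, by push_cast; ring⟩
  have h2 : Complex.exp (2 * Real.pi * Complex.I * (μ - (z + 1))) =
      Complex.exp (2 * Real.pi * Complex.I * (μ - z)) := by
    rw [Complex.exp_eq_exp_iff_exists_int]; exact ⟨-1, by push_cast; ring⟩
  rw [thetaProd, h1, h2, thetaProd]

lemma thetaProd_add_module (hμ : 0 < μ.im) (z : ℂ) :
    thetaProd (z + μ) μ = -Complex.exp (-(2 * Real.pi * Complex.I * z)) * thetaProd z μ := by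
  have hQ := norm_exp_module_lt_one hμ
  have h1 : Complex.exp (2 * Real.pi * Complex.I * (z + μ)) =
      Complex.exp (2 * Real.pi * Complex.I * μ) * Complex.exp (2 * Real.pi * Complex.I * z) := by
    rw [← Complex.exp_add]; congr 1; ring
  have h2 : Complex.exp (2 * Real.pi * Complex.I * (μ - (z + μ))) =
      Complex.exp (-(2 * Real.pi * Complex.I * z)) := by congr 1; ring
  have h3 : Complex.exp (2 * Real.pi * Complex.I * (μ - z)) =
      Complex.exp (2 * Real.pi * Complex.I * μ) * Complex.exp (-(2 * Real.pi * Complex.I * z)) := by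
    rw [← Complex.exp_add]; congr 1; ring
  have h4 : Complex.exp (-(2 * Real.pi * Complex.I * z)) *
      Complex.exp (2 * Real.pi * Complex.I * z) = 1 := by rw [← Complex.exp_add]; simp
  rw [thetaProd, thetaProd, h1, h2, h3,
    qProd_eq_mul hQ (Complex.exp (-(2 * Real.pi * Complex.I * z))),
    qProd_eq_mul hQ (Complex.exp (2 * Real.pi * Complex.I * z))]
  linear_combination qProd (Complex.exp (2 * Real.pi * Complex.I * μ))
    (Complex.exp (2 * Real.pi * Complex.I * μ) * Complex.exp (2 * Real.pi * Complex.I * z)) *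
    qProd (Complex.exp (2 * Real.pi * Complex.I * μ))
    (Complex.exp (2 * Real.pi * Complex.I * μ) * Complex.exp (-(2 * Real.pi * Complex.I * z))) *
        (-h4)

lemma qProd_exp_ne_zero (hμ : 0 < μ.im) {z : ℂ} (h : ¬ InLattice μ z) :
    qProd (Complex.exp (2 * Real.pi * Complex.I * μ))
      (Complex.exp (2 * Real.pi * Complex.I * z)) ≠ 0 := by
  refine qProd_ne_zero (norm_exp_module_lt_one hμ) fun n hn => h ?_
  rw [← Complex.exp_nat_mul, ← Complex.exp_add, Complex.exp_eq_one_iff] at hn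
  obtain ⟨m, hm⟩ := hn
  have hpi : (2 * Real.pi * Complex.I : ℂ) ≠ 0 := Complex.two_pi_I_ne_zero
  refine ⟨m, -n, ?_⟩
  have : (2 * Real.pi * Complex.I : ℂ) * (n * μ + z) = 2 * Real.pi * Complex.I * m := by
    linear_combination hm
  have := mul_left_cancel₀ hpi this
  push_cast
  linear_combination this

lemma thetaProd_ne_zero (hμ : 0 < μ.im) {z : ℂ} (h : ¬ InLattice μ z) : thetaProd z μ ≠ 0 :=
  mul_ne_zero (qProd_exp_ne_zero hμ h) (qProd_exp_ne_zero hμ fun h' =>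
    h (by simpa using inLattice_module.sub h'))

lemma thetaProd_zero (hμ : 0 < μ.im) : thetaProd 0 μ = 0 := by
  rw [thetaProd, qProd_eq_mul (norm_exp_module_lt_one hμ)]; simp

lemma qProd_self_ne_zero (hμ : 0 < μ.im) :
    qProd (Complex.exp (2 * Real.pi * Complex.I * μ))
      (Complex.exp (2 * Real.pi * Complex.I * μ)) ≠ 0 := by
  have hQ := norm_exp_module_lt_one hμ
  refine qProd_ne_zero hQ fun n hn => ?_
  rw [← pow_succ] at hn
  have h2 := congrArg norm hn
  rw [norm_pow, norm_one] at h2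
  exact (pow_lt_one₀ (norm_nonneg _) hQ n.succ_ne_zero).ne h2

lemma exists_hasDerivAt_thetaProd (hμ : 0 < μ.im) :
    ∃ c ≠ 0, HasDerivAt (fun z => thetaProd z μ) c 0 := by
  have hQ := norm_exp_module_lt_one hμ
  set Q := Complex.exp (2 * Real.pi * Complex.I * μ) with hQdef
  have hd := differentiable_qProd hQ
  have h1 : HasDerivAt (fun z : ℂ => 1 - Complex.exp (2 * Real.pi * Complex.I * z))
      (-(2 * Real.pi * Complex.I)) 0 := by
    have := (((hasDerivAt_id (0 : ℂ)).const_mul (2 * Real.pi * Complex.I)).cexp).const_sub 1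
    simpa using this
  set B : ℂ → ℂ := fun z => qProd Q (Q * Complex.exp (2 * Real.pi * Complex.I * z)) *
    qProd Q (Complex.exp (2 * Real.pi * Complex.I * (μ - z))) with hB
  have hBd : Differentiable ℂ B := by
    have h1 : Differentiable ℂ fun z : ℂ => Q * Complex.exp (2 * Real.pi * Complex.I * z) := by
      fun_prop
    have h2 : Differentiable ℂ fun z : ℂ => Complex.exp (2 * Real.pi * Complex.I * (μ - z)) := by
      fun_prop
    exact (hd.comp h1).mul (hd.comp h2)
  have hB0 : B 0 ≠ 0 := by
    simp only [hB, mul_zero, Complex.exp_zero, mul_one, sub_zero]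
    exact mul_ne_zero (qProd_self_ne_zero hμ) (qProd_self_ne_zero hμ)
  have h2 := h1.mul (hBd 0).hasDerivAt
  refine ⟨-(2 * Real.pi * Complex.I) * B 0,
    mul_ne_zero (neg_ne_zero.2 Complex.two_pi_I_ne_zero) hB0,
    ?_⟩
  have h3 : (fun z => thetaProd z μ) =
      (fun z : ℂ => 1 - Complex.exp (2 * Real.pi * Complex.I * z)) * B := by
    funext z
    simp only [thetaProd, Pi.mul_apply, hB, ← hQdef]
    rw [qProd_eq_mul hQ]; ring
  rw [h3]
  simpa using h2

/-- The mean value of the theta series over a period is its constant term, so it is not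
identically zero. -/
lemma exists_jacobiTheta₂_ne_zero (hμ : 0 < μ.im) : ∃ z, jacobiTheta₂ z μ ≠ 0 := by
  by_contra! hall
  have hcont (n : ℤ) : Continuous fun x : ℝ => jacobiTheta₂_term n x μ := by
    unfold jacobiTheta₂_term; fun_prop
  set F : ℤ → C(ℝ, ℂ) := fun n => ⟨fun x => jacobiTheta₂_term n x μ, hcont n⟩
  have hsum : Summable fun n => ‖(F n).restrict (⟨Set.uIcc (0 : ℝ) 1, isCompact_uIcc⟩ :
      TopologicalSpace.Compacts ℝ)‖ := by
    refine Summable.of_nonneg_of_le (fun _ => norm_nonneg _) (fun n => ?_)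
      (summable_pow_mul_jacobiTheta₂_term_bound 0 hμ 0)
    rw [ContinuousMap.norm_le _ (by positivity)]
    intro x
    rw [pow_zero, one_mul]
    exact norm_jacobiTheta₂_term_le hμ (by simp) le_rfl n
  have h := intervalIntegral.hasSum_intervalIntegral_of_summable_norm hsum
  have h0 (n : ℤ) : ∫ x in (0 : ℝ)..1, F n x = if n = 0 then 1 else 0 := by
    split_ifs with hn
    · subst hn
      simp [F, jacobiTheta₂_term]
    · have hc : (2 * Real.pi * Complex.I * n : ℂ) ≠ 0 :=
        mul_ne_zero Complex.two_pi_I_ne_zero (by exact_mod_cast hn)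
      have e : ∀ x : ℝ, F n x = Complex.exp (Real.pi * Complex.I * n ^ 2 * μ) *
          Complex.exp (2 * Real.pi * Complex.I * n * x) := by
        intro x
        simp only [F, ContinuousMap.coe_mk, jacobiTheta₂_term, ← Complex.exp_add]
        congr 1; ring
      simp only [e, intervalIntegral.integral_const_mul]
      rw [integral_exp_mul_complex hc]
      have : (2 * Real.pi * Complex.I * n * (1 : ℝ) : ℂ) = 2 * Real.pi * Complex.I * n := by simp
      rw [this, exp_two_pi_I_mul_int]
      simp
  simp only [h0] at h
  have h1 : ∫ x in (0 : ℝ)..1, ∑' n, F n x = 0 := by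
    have : ∀ x : ℝ, ∑' n, F n x = 0 := fun x => hall x
    simp [this]
  rw [h1] at h
  have h2 := hasSum_ite_eq (0 : ℤ) (1 : ℂ)
  exact one_ne_zero (h2.unique h)

lemma theta1_eq_thetaD (z μ : ℂ) : theta1 z μ = -thetaD 0 (1 / 2) (1 / 2) z μ := by
  rw [theta1, thetaD_zero]

lemma hasDerivAt_theta1 (z : ℂ) (hμ : 0 < μ.im) :
    HasDerivAt (fun u => theta1 u μ) (-thetaD 1 (1 / 2) (1 / 2) z μ) z := by
  simp only [theta1_eq_thetaD]
  exact (hasDerivAt_thetaD 0 _ _ z hμ).neg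

lemma differentiable_theta1 (hμ : 0 < μ.im) : Differentiable ℂ fun z => theta1 z μ :=
  fun z => (hasDerivAt_theta1 z hμ).differentiableAt

lemma exists_theta1_ne_zero (hμ : 0 < μ.im) : ∃ z, theta1 z μ ≠ 0 := by
  obtain ⟨z, hz⟩ := exists_jacobiTheta₂_ne_zero hμ
  refine ⟨z - (1 / 2 + 1 / 2 * μ), ?_⟩
  rw [theta1_eq_thetaD, thetaD]
  simp only [thetaTerm_eq, pow_zero, one_mul]
  rw [tsum_mul_left, neg_ne_zero]
  refine mul_ne_zero (Complex.exp_ne_zero _) ?_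
  convert hz using 1
  rw [jacobiTheta₂]
  congr! 2
  ring_nf

/-- The product formula for `ϑ₁`, up to a constant factor, obtained from Liouville's theorem. -/
lemma exists_theta1_eq_thetaProd (hμ : 0 < μ.im) :
    ∃ c ≠ 0, ∀ z, theta1 z μ = c * (Complex.exp (-(Real.pi * Complex.I * z)) * thetaProd z μ) := by
  obtain ⟨d, hd0, hd⟩ := exists_hasDerivAt_thetaProd hμ
  have hexp (z : ℂ) : Complex.exp (-(Real.pi * Complex.I * z)) *
      Complex.exp (Real.pi * Complex.I * z) = 1 := by rw [← Complex.exp_add]; simp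
  obtain ⟨c, hc⟩ := exists_const_of_periodic_up_to_sign (ε := 1) (ε' := 1) hμ (fun _ : Unit => 0)
    (fun z => theta1 z μ * Complex.exp (Real.pi * Complex.I * z) / thetaProd z μ)
    (fun z hz => by
      have h := thetaProd_ne_zero hμ (by simpa using hz : ¬ InLattice μ z)
      exact (((differentiable_theta1 hμ).mul (by fun_prop)) z).div
        (differentiable_thetaProd hμ z) h)
    (fun _ => by
      have h1 := tendsto_sub_div_of_hasDerivAt hd (thetaProd_zero hμ) hd0
      have h2 : Tendsto (fun z => theta1 z μ * Complex.exp (Real.pi * Complex.I * z)) (𝓝[≠] 0)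
          (𝓝 (theta1 0 μ * Complex.exp (Real.pi * Complex.I * 0))) :=
        (((differentiable_theta1 hμ).continuous.mul (by fun_prop)).tendsto 0).mono_left
          nhdsWithin_le_nhds
      have h3 := h2.mul h1
      rw [theta1_zero, zero_mul, zero_mul] at h3
      refine h3.congr fun z => ?_
      ring)
    (Or.inl rfl) (Or.inl rfl)
    (fun z _ => by
      have : Complex.exp (Real.pi * Complex.I * (z + 1)) =
        -Complex.exp (Real.pi * Complex.I * z) := by
        rw [mul_add, Complex.exp_add, mul_one, Complex.exp_pi_mul_I]; ring
      rw [theta1_add_one, thetaProd_add_one, this]; ring)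
    (fun z hz => by
      have h := thetaProd_ne_zero hμ (by simpa using hz : ¬ InLattice μ z)
      have h2 := Complex.exp_ne_zero (-(2 * Real.pi * Complex.I * z))
      have : quasiFactor z μ * Complex.exp (Real.pi * Complex.I * (z + μ)) =
          Complex.exp (-(2 * Real.pi * Complex.I * z)) * Complex.exp (Real.pi * Complex.I * z) := by
        rw [quasiFactor, ← Complex.exp_add, ← Complex.exp_add]; congr 1; ring
      rw [theta1_add_module, thetaProd_add_module hμ]
      generalize Complex.exp (-(2 * Real.pi * Complex.I * z)) = E at h2 this ⊢
      field_simp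
      linear_combination theta1 z μ * this)
  have hEq : ∀ z, theta1 z μ = c * (Complex.exp (-(Real.pi * Complex.I * z)) * thetaProd z μ) := by
    intro z
    have hcont1 : Tendsto (fun z => theta1 z μ) (𝓝[≠] z) (𝓝 (theta1 z μ)) :=
      ((differentiable_theta1 hμ).continuous.tendsto z).mono_left nhdsWithin_le_nhds
    have hcont2 : Continuous fun z : ℂ =>
        c * (Complex.exp (-(Real.pi * Complex.I * z)) * thetaProd z μ) :=
      continuous_const.mul ((by fun_prop : Continuous fun z : ℂ =>
        Complex.exp (-(Real.pi * Complex.I * z))).mul (differentiable_thetaProd hμ).continuous)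
    refine tendsto_nhds_unique hcont1 (((hcont2.tendsto z).mono_left nhdsWithin_le_nhds).congr' ?_)
    filter_upwards [eventually_not_inLattice hμ z 0] with u hu
    have h := hc u (fun _ => hu)
    have h2 := thetaProd_ne_zero hμ (by simpa using hu : ¬ InLattice μ u)
    rw [div_eq_iff h2] at h
    linear_combination (theta1 u μ) * hexp u - Complex.exp (-(Real.pi * Complex.I * u)) * h
  refine ⟨c, ?_, hEq⟩
  rintro rfl
  obtain ⟨z, hz⟩ := exists_theta1_ne_zero hμ
  exact hz (by rw [hEq]; simp)

lemma exists_theta1_add_lattice {l : ℂ} (hl : InLattice μ l) :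
    ∃ a b : ℂ, ∀ z, theta1 (z + l) μ = Complex.exp (a + b * z) * theta1 z μ := by
  obtain ⟨m, n, rfl⟩ := hl
  have h1 : ∀ m : ℤ, ∃ a : ℂ, ∀ z, theta1 (z + m) μ = Complex.exp a * theta1 z μ := by
    intro m
    induction m using Int.induction_on with
    | zero => exact ⟨0, fun z => by simp⟩
    | succ n ih =>
      obtain ⟨a, ha⟩ := ih
      refine ⟨a + Real.pi * Complex.I, fun z => ?_⟩
      rw [Complex.exp_add, Complex.exp_pi_mul_I, mul_neg_one, neg_mul, ← ha, ← theta1_add_one]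
      push_cast; ring_nf
    | pred n ih =>
      obtain ⟨a, ha⟩ := ih
      refine ⟨a + Real.pi * Complex.I, fun z => ?_⟩
      have h := theta1_add_one (z + ((-n - 1 : ℤ) : ℂ)) μ
      rw [show z + ((-n - 1 : ℤ) : ℂ) + 1 = z + ((-n : ℤ) : ℂ) by push_cast; ring, ha] at h
      rw [Complex.exp_add, Complex.exp_pi_mul_I]
      linear_combination h
  have h2 : ∀ n : ℤ, ∃ a b : ℂ, ∀ z,
      theta1 (z + n * μ) μ = Complex.exp (a + b * z) * theta1 z μ := by
    intro n
    induction n using Int.induction_on with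
    | zero => exact ⟨0, 0, fun z => by simp⟩
    | succ n ih =>
      obtain ⟨a, b, ha⟩ := ih
      refine ⟨a + (Real.pi * Complex.I - Real.pi * Complex.I * μ -
        2 * Real.pi * Complex.I * (n * μ)),
        b - 2 * Real.pi * Complex.I, fun z => ?_⟩
      have e : z + ((n + 1 : ℤ) : ℂ) * μ = (z + ((n : ℤ) : ℂ) * μ) + μ := by push_cast; ring
      rw [e, theta1_add_module, ha, ← neg_one_mul, ← Complex.exp_pi_mul_I,
        quasiFactor, ← mul_assoc, ← Complex.exp_add, ← Complex.exp_add]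
      congr 2; push_cast; ring
    | pred n ih =>
      obtain ⟨a, b, ha⟩ := ih
      refine ⟨a - (Real.pi * Complex.I - Real.pi * Complex.I * μ -
        2 * Real.pi * Complex.I * ((-n - 1) * μ)), b + 2 * Real.pi * Complex.I, fun z => ?_⟩
      have h := theta1_add_module (z + ((-n - 1 : ℤ) : ℂ) * μ) μ
      rw [show z + ((-n - 1 : ℤ) : ℂ) * μ + μ = z + ((-n : ℤ) : ℂ) * μ by push_cast; ring, ha] at h
      have hq := quasiFactor_ne_zero (z + ((-n - 1 : ℤ) : ℂ) * μ) μ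
      apply mul_left_cancel₀ (neg_ne_zero.2 hq)
      rw [← h, ← mul_assoc]
      congr 1
      rw [← neg_one_mul, ← Complex.exp_pi_mul_I, quasiFactor, ← Complex.exp_add, ← Complex.exp_add]
      congr 1; push_cast; ring
  obtain ⟨a, ha⟩ := h1 m
  obtain ⟨a', b, hb⟩ := h2 n
  refine ⟨a + a' + b * m, b, fun z => ?_⟩
  rw [← add_assoc, hb, ha, ← mul_assoc, ← Complex.exp_add]
  congr 2; ring

theorem theta1_eq_zero_iff (hμ : 0 < μ.im) {z : ℂ} : theta1 z μ = 0 ↔ InLattice μ z := by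
  constructor
  · intro h
    by_contra hz
    obtain ⟨c, hc, hEq⟩ := exists_theta1_eq_thetaProd hμ
    rw [hEq] at h
    exact mul_ne_zero hc (mul_ne_zero (Complex.exp_ne_zero _) (thetaProd_ne_zero hμ hz)) h
  · intro h
    obtain ⟨a, b, hab⟩ := exists_theta1_add_lattice h
    have := hab 0
    rwa [zero_add, theta1_zero, mul_zero] at this

lemma theta1_ne_zero (hμ : 0 < μ.im) {z : ℂ} (h : ¬ InLattice μ z) : theta1 z μ ≠ 0 :=
  fun h' => h ((theta1_eq_zero_iff hμ).1 h')

/-- The zeros of `ϑ₁` are simple. -/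
theorem thetaD_one_zero_ne_zero (hμ : 0 < μ.im) : thetaD 1 (1 / 2) (1 / 2) 0 μ ≠ 0 := by
  obtain ⟨c, hc, hEq⟩ := exists_theta1_eq_thetaProd hμ
  obtain ⟨d, hd0, hd⟩ := exists_hasDerivAt_thetaProd hμ
  have h1 : HasDerivAt (fun z : ℂ => Complex.exp (-(Real.pi * Complex.I * z)))
      (deriv (fun z : ℂ => Complex.exp (-(Real.pi * Complex.I * z))) 0) 0 :=
    (by fun_prop : Differentiable ℂ fun z : ℂ => Complex.exp (-(Real.pi * Complex.I * z))) 0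
      |>.hasDerivAt
  have h2 := (h1.mul hd).const_mul c
  have h3 := hasDerivAt_theta1 0 hμ
  have h4 : (fun u => theta1 u μ) = fun z =>
      c * ((fun z : ℂ => Complex.exp (-(Real.pi * Complex.I * z))) * fun z => thetaProd z μ) z := by
    funext z; exact hEq z
  rw [h4] at h3
  have h5 := h3.unique h2
  rw [thetaProd_zero hμ] at h5
  simp only [mul_zero, Complex.exp_zero, zero_add, neg_zero, one_mul] at h5
  intro h
  rw [h, neg_zero] at h5
  exact mul_ne_zero hc hd0 h5.symm

theorem theta2_eq_zero_iff (hμ : 0 < μ.im) {z : ℂ} : theta2 z μ = 0 ↔ InLattice μ (z + 1 / 2) := by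
  rw [← theta1_add_half, theta1_eq_zero_iff hμ]

theorem theta3_eq_zero_iff (hμ : 0 < μ.im) {z : ℂ} :
    theta3 z μ = 0 ↔ InLattice μ (z + 1 / 2 - μ / 2) := by
  have h := theta3_add_half_module (z - μ / 2) μ
  rw [sub_add_cancel] at h
  rw [h, mul_eq_zero, or_iff_right (Complex.exp_ne_zero _), theta2_eq_zero_iff hμ,
    sub_add_eq_add_sub]

theorem theta4_eq_zero_iff (hμ : 0 < μ.im) {z : ℂ} :
    theta4 z μ = 0 ↔ InLattice μ (z - μ / 2) := by
  have h := theta4_add_half_module (z - μ / 2) μ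
  rw [sub_add_cancel] at h
  rw [h, mul_eq_zero, or_iff_right (neg_ne_zero.2 (Complex.exp_ne_zero _)), theta1_eq_zero_iff hμ]

end

/-! ### Jacobi's derivative formula -/

section

variable {μ : ℂ}


lemma theta2_eq_thetaD (z μ : ℂ) : theta2 z μ = thetaD 0 (1 / 2) 0 z μ := by
  rw [theta2, thetaD_zero]
lemma theta3_eq_thetaD (z μ : ℂ) : theta3 z μ = thetaD 0 0 0 z μ := by rw [theta3, thetaD_zero]
lemma theta4_eq_thetaD (z μ : ℂ) : theta4 z μ = thetaD 0 0 (1 / 2) z μ := by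
  rw [theta4, thetaD_zero]

lemma hasDerivAt_theta2 (z : ℂ) (hμ : 0 < μ.im) :
    HasDerivAt (fun u => theta2 u μ) (thetaD 1 (1 / 2) 0 z μ) z := by
  simp only [theta2_eq_thetaD]; exact hasDerivAt_thetaD 0 _ _ z hμ
lemma hasDerivAt_theta3 (z : ℂ) (hμ : 0 < μ.im) :
    HasDerivAt (fun u => theta3 u μ) (thetaD 1 0 0 z μ) z := by
  simp only [theta3_eq_thetaD]; exact hasDerivAt_thetaD 0 _ _ z hμ
lemma hasDerivAt_theta4 (z : ℂ) (hμ : 0 < μ.im) :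
    HasDerivAt (fun u => theta4 u μ) (thetaD 1 0 (1 / 2) z μ) z := by
  simp only [theta4_eq_thetaD]; exact hasDerivAt_thetaD 0 _ _ z hμ

lemma not_inLattice_half (hμ : 0 < μ.im) : ¬ InLattice μ (1 / 2) := by
  rintro ⟨m, n, h⟩
  have him := congrArg Complex.im h
  have hre := congrArg Complex.re h
  simp [hμ.ne'] at him
  subst him
  simp at hre
  have : (2 * m : ℝ) = 1 := by rw [← hre]; norm_num
  have : (2 * m : ℤ) = 1 := by exact_mod_cast this
  omega

lemma not_inLattice_half_module (hμ : 0 < μ.im) (m : ℤ) : ¬ InLattice μ (m / 2 - μ / 2) := by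
  rintro ⟨m', n, h⟩
  have him := congrArg Complex.im h
  simp at him
  have h1 : -1 / 2 = (n : ℝ) := by
    apply mul_right_cancel₀ hμ.ne'
    rw [← him]; ring
  have h2 : (2 * n : ℝ) = -1 := by rw [← h1]; norm_num
  have : (2 * n : ℤ) = -1 := by exact_mod_cast h2
  omega

lemma theta2_zero_ne_zero (hμ : 0 < μ.im) : theta2 0 μ ≠ 0 := by
  rw [Ne, theta2_eq_zero_iff hμ, zero_add]; exact not_inLattice_half hμ
lemma theta3_zero_ne_zero (hμ : 0 < μ.im) : theta3 0 μ ≠ 0 := by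
  rw [Ne, theta3_eq_zero_iff hμ, zero_add]
  simpa using not_inLattice_half_module hμ 1
lemma theta4_zero_ne_zero (hμ : 0 < μ.im) : theta4 0 μ ≠ 0 := by
  rw [Ne, theta4_eq_zero_iff hμ]
  simpa using not_inLattice_half_module hμ 0

lemma thetaProduct_add_half (z : ℂ) :
    theta1 (z + 1 / 2) μ * (theta2 (z + 1 / 2) μ * theta3 (z + 1 / 2) μ * theta4 (z + 1 / 2) μ) =
      -(theta1 z μ * (theta2 z μ * theta3 z μ * theta4 z μ)) := by
  have h : theta2 (z + 1 / 2) μ = -theta1 z μ := by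
    rw [← theta1_add_half, ← theta1_add_one]; congr 1; ring
  rw [theta1_add_half, h, theta3_add_half, theta4_add_half]; ring

lemma thetaProduct_add_half_module (z : ℂ) :
    theta1 (z + μ / 2) μ * (theta2 (z + μ / 2) μ * theta3 (z + μ / 2) μ * theta4 (z + μ / 2) μ) =
      -quasiFactor (2 * z) μ * (theta1 z μ * (theta2 z μ * theta3 z μ * theta4 z μ)) := by
  have h3 := theta3_add_half_module z μ
  have h4 := theta4_add_half_module z μ
  have h3' := theta3_add_half_module (z + μ / 2) μ
  have h4' := theta4_add_half_module (z + μ / 2) μ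
  rw [show z + μ / 2 + μ / 2 = z + μ by ring] at h3' h4'
  rw [theta3_add_module] at h3'
  rw [theta4_add_module] at h4'
  have n3 := Complex.exp_ne_zero (-Real.pi * Complex.I * (μ / 4 + (z + μ / 2) + 0))
  have n4 := Complex.exp_ne_zero (-Real.pi * Complex.I * (μ / 4 + (z + μ / 2) + 1 / 2))
  apply mul_left_cancel₀ (mul_ne_zero n3 n4)
  have e : Complex.exp (-Real.pi * Complex.I * (μ / 4 + (z + μ / 2) + 0)) *
      Complex.exp (-Real.pi * Complex.I * (μ / 4 + (z + μ / 2) + 1 / 2)) * quasiFactor (2 * z) μ =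
      Complex.exp (-Real.pi * Complex.I * (μ / 4 + z + 0)) *
      Complex.exp (-Real.pi * Complex.I * (μ / 4 + z + 1 / 2)) *
        (quasiFactor z μ * quasiFactor z μ) := by
    simp only [quasiFactor, ← Complex.exp_add]
    congr 1; ring
  rw [h3, h4]
  linear_combination (theta1 z μ * (theta2 z μ * theta3 z μ * theta4 z μ)) * e
    + (Complex.exp (-Real.pi * Complex.I * (μ / 4 + z + 0)) *
        Complex.exp (-Real.pi * Complex.I * (μ / 4 + z + 1 / 2))) * theta1 z μ * theta2 z μ *
      (h3' * (quasiFactor z μ * theta4 z μ)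
        - h4' * (Complex.exp (-Real.pi * Complex.I * (μ / 4 + (z + μ / 2) + 0)) *
        theta2 (z + μ / 2) μ))

/-- The duplication formula `2 ϑ₁ϑ₂ϑ₃ϑ₄(z) = ϑ₂ϑ₃ϑ₄ ϑ₁(2z)`, near `z = 0`. -/
lemma eventually_duplication (hμ : 0 < μ.im) :
    ∀ᶠ z in 𝓝 (0 : ℂ), theta1 z μ * (theta2 z μ * theta3 z μ * theta4 z μ) =
      (theta2 0 μ * theta3 0 μ * theta4 0 μ / 2) * theta1 (2 * z) μ := by
  set D : ℂ → ℂ := fun z => theta1 z μ * (theta2 z μ * theta3 z μ * theta4 z μ) with hD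
  have hDd : Differentiable ℂ D := fun z => by
    exact (hasDerivAt_theta1 z hμ).differentiableAt.mul
      (((hasDerivAt_theta2 z hμ).differentiableAt.mul (hasDerivAt_theta3 z hμ).differentiableAt).mul
        (hasDerivAt_theta4 z hμ).differentiableAt)
  have hD2 : Differentiable ℂ fun u : ℂ => D (u / 2) := hDd.comp (by fun_prop)
  have hD0 : D 0 = 0 := by simp [hD, theta1_zero]
  have ha1 : -thetaD 1 (1 / 2) (1 / 2) 0 μ ≠ 0 := neg_ne_zero.2 (thetaD_one_zero_ne_zero hμ)
  have hlim := tendsto_sub_div_of_hasDerivAt (hasDerivAt_theta1 0 hμ) (theta1_zero μ) ha1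
  obtain ⟨c, hc⟩ := exists_const_of_periodic_up_to_sign (ε := 1) (ε' := 1) hμ (fun _ : Unit => 0)
    (fun u => D (u / 2) / theta1 u μ)
    (fun z hz => (hD2 z).div (differentiable_theta1 hμ z)
      (theta1_ne_zero hμ (by simpa using hz)))
    (fun _ => by
      have h2 : Tendsto (fun u => D (u / 2)) (𝓝[≠] 0) (𝓝 (D (0 / 2))) :=
        (hD2.continuous.tendsto 0).mono_left nhdsWithin_le_nhds
      have h3 := h2.mul hlim
      rw [zero_div, hD0, zero_mul] at h3
      exact h3.congr fun z => by ring)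
    (Or.inl rfl) (Or.inl rfl)
    (fun u _ => by
      have : D ((u + 1) / 2) = -D (u / 2) := by
        simp only [hD]
        rw [← thetaProduct_add_half, show (u + 1) / 2 = u / 2 + 1 / 2 by ring]
      rw [this, theta1_add_one, neg_div_neg_eq, one_mul])
    (fun u hu => by
      have : D ((u + μ) / 2) = -quasiFactor u μ * D (u / 2) := by
        have h := thetaProduct_add_half_module (μ := μ) (u / 2)
        rw [mul_div_cancel₀ u two_ne_zero] at h
        simp only [hD]
        rw [← h, add_div]
      have hq := neg_ne_zero.2 (quasiFactor_ne_zero u μ)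
      rw [this, theta1_add_module, mul_div_mul_left _ _ hq, one_mul])
  have hcval : theta2 0 μ * theta3 0 μ * theta4 0 μ / 2 = c := by
    have hR : HasDerivAt (fun u : ℂ => D (u / 2))
        (-thetaD 1 (1 / 2) (1 / 2) 0 μ * (theta2 0 μ * theta3 0 μ * theta4 0 μ / 2)) 0 := by
      have h1 := (hasDerivAt_theta1 0 hμ).mul (((hasDerivAt_theta2 0 hμ).mul
        (hasDerivAt_theta3 0 hμ)).mul (hasDerivAt_theta4 0 hμ))
      have h1' : HasDerivAt D (-thetaD 1 (1 / 2) (1 / 2) 0 μ *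
          (theta2 0 μ * theta3 0 μ * theta4 0 μ)) (0 / 2) := by
        rw [zero_div]
        refine h1.congr_deriv ?_
        simp [theta1_zero]
      have h2 := HasDerivAt.comp (0 : ℂ) h1' ((hasDerivAt_id (0 : ℂ)).div_const 2)
      refine h2.congr_deriv ?_
      ring
    have h3 := (tendsto_div_of_hasDerivAt hR (by simp [hD0])).mul hlim
    rw [mul_right_comm, mul_inv_cancel₀ ha1, one_mul] at h3
    refine tendsto_nhds_unique h3 (tendsto_const_nhds.congr' ?_)
    filter_upwards [eventually_not_inLattice hμ 0 0, self_mem_nhdsWithin] with u hu hu0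
    have hu0' : u - 0 ≠ 0 := by simpa using hu0
    rw [← hc u (fun _ => hu)]
    have := theta1_ne_zero hμ (by simpa using hu : ¬ InLattice μ u)
    field_simp
  have h5 : Tendsto (fun z : ℂ => 2 * z) (𝓝[≠] 0) (𝓝[≠] 0) := by
    refine tendsto_nhdsWithin_of_tendsto_nhds_of_eventually_within _ ?_ ?_
    · have : Tendsto (fun z : ℂ => 2 * z) (𝓝 0) (𝓝 (2 * 0)) := (by fun_prop : Continuous
        fun z : ℂ => 2 * z).tendsto 0
      rw [mul_zero] at this
      exact this.mono_left nhdsWithin_le_nhds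
    · filter_upwards [self_mem_nhdsWithin] with u hu
      simpa using hu
  have h6 := h5.eventually (eventually_not_inLattice hμ 0 0)
  rw [eventually_nhdsWithin_iff] at h6
  filter_upwards [h6] with z hz
  rw [hcval]
  by_cases h0 : z = 0
  · subst h0
    simp [theta1_zero]
  · have h7 := hc (2 * z) (fun _ => hz h0)
    rw [div_eq_iff (theta1_ne_zero hμ (by simpa using hz h0)),
      mul_div_cancel_left₀ _ two_ne_zero] at h7
    exact h7

lemma deriv_zero_of_even {f : ℂ → ℂ} {f' : ℂ} (h : HasDerivAt f f' 0) (he : ∀ z, f (-z) = f z) :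
    f' = 0 := by
  have h1 : HasDerivAt (fun z => f (-z)) (f' * -1) 0 :=
    HasDerivAt.comp (0 : ℂ) (by simpa using h) (hasDerivAt_neg (0 : ℂ))
  simp only [he] at h1
  have := h.unique h1
  linear_combination this / 2

lemma deriv_odd {f f' : ℂ → ℂ} (h : ∀ z, HasDerivAt f (f' z) z) (he : ∀ z, f (-z) = -f z) (z : ℂ) :
    f' (-z) = f' z := by
  have h1 : HasDerivAt (fun z => f (-z)) (f' (-z) * -1) z :=
    HasDerivAt.comp z (h (-z)) (hasDerivAt_neg z)
  simp only [he] at h1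
  have := (h z).neg.unique h1
  linear_combination this

/-- Comparison of the third Taylor coefficients in the duplication formula. -/
lemma third_derivative_identity (hμ : 0 < μ.im) :
    thetaD 1 (1 / 2) (1 / 2) 0 μ *
        ((thetaD 2 (1 / 2) 0 0 μ * theta3 0 μ + theta2 0 μ * thetaD 2 0 0 0 μ) * theta4 0 μ +
          theta2 0 μ * theta3 0 μ * thetaD 2 0 (1 / 2) 0 μ) =
      theta2 0 μ * theta3 0 μ * theta4 0 μ * thetaD 3 (1 / 2) (1 / 2) 0 μ := by
  set a : ℕ → ℂ → ℂ := fun k z => thetaD k (1 / 2) (1 / 2) z μ with ha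
  set b : ℕ → ℂ → ℂ := fun k z => thetaD k (1 / 2) 0 z μ with hb
  set c : ℕ → ℂ → ℂ := fun k z => thetaD k 0 0 z μ with hc
  set d : ℕ → ℂ → ℂ := fun k z => thetaD k 0 (1 / 2) z μ with hd
  have da (k : ℕ) (z : ℂ) : HasDerivAt (a k) (a (k + 1) z) z := hasDerivAt_thetaD k _ _ z hμ
  have db (k : ℕ) (z : ℂ) : HasDerivAt (b k) (b (k + 1) z) z := hasDerivAt_thetaD k _ _ z hμ
  have dc (k : ℕ) (z : ℂ) : HasDerivAt (c k) (c (k + 1) z) z := hasDerivAt_thetaD k _ _ z hμ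
  have dd (k : ℕ) (z : ℂ) : HasDerivAt (d k) (d (k + 1) z) z := hasDerivAt_thetaD k _ _ z hμ
  have a0 : a 0 0 = 0 := by
    have := theta1_zero μ
    rwa [theta1_eq_thetaD, neg_eq_zero] at this
  have a2 : a 2 0 = 0 := by
    refine deriv_zero_of_even (da 1 0) (deriv_odd (da 0) fun z => ?_)
    have := theta1_neg z μ
    rw [theta1_eq_thetaD, theta1_eq_thetaD] at this
    exact neg_injective this
  have b1 : b 1 0 = 0 := deriv_zero_of_even (db 0 0) fun z => by
    have := theta2_neg z μ
    rwa [theta2_eq_thetaD, theta2_eq_thetaD] at this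
  have c1 : c 1 0 = 0 := deriv_zero_of_even (dc 0 0) fun z => by
    have := theta3_neg z μ
    rwa [theta3_eq_thetaD, theta3_eq_thetaD] at this
  have d1 : d 1 0 = 0 := deriv_zero_of_even (dd 0 0) fun z => by
    have := theta4_neg z μ
    rwa [theta4_eq_thetaD, theta4_eq_thetaD] at this
  set R : ℂ → ℂ := fun z => b 0 z * c 0 z * d 0 z with hR
  set R1 : ℂ → ℂ := fun z =>
    (b 1 z * c 0 z + b 0 z * c 1 z) * d 0 z + b 0 z * c 0 z * d 1 z with hR1
  set R2 : ℂ → ℂ := fun z =>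
    ((b 2 z * c 0 z + b 1 z * c 1 z) + (b 1 z * c 1 z + b 0 z * c 2 z)) * d 0 z +
    (b 1 z * c 0 z + b 0 z * c 1 z) * d 1 z +
    ((b 1 z * c 0 z + b 0 z * c 1 z) * d 1 z + b 0 z * c 0 z * d 2 z) with hR2
  have dR (z : ℂ) : HasDerivAt R (R1 z) z := ((db 0 z).mul (dc 0 z)).mul (dd 0 z)
  have dR1 (z : ℂ) : HasDerivAt R1 (R2 z) z :=
    ((((db 1 z).mul (dc 0 z)).add ((db 0 z).mul (dc 1 z))).mul (dd 0 z)).add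
      (((db 0 z).mul (dc 0 z)).mul (dd 1 z))
  have dR2 : DifferentiableAt ℂ R2 0 := by
    have B (k : ℕ) : DifferentiableAt ℂ (b k) 0 := (db k 0).differentiableAt
    have C (k : ℕ) : DifferentiableAt ℂ (c k) 0 := (dc k 0).differentiableAt
    have D (k : ℕ) : DifferentiableAt ℂ (d k) 0 := (dd k 0).differentiableAt
    have := B 0; have := B 1; have := B 2; have := C 0; have := C 1; have := C 2
    have := D 0; have := D 1; have := D 2
    simp only [hR2]
    fun_prop
  -- three derivatives of `ϑ₁ · ϑ₂ϑ₃ϑ₄`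
  have e1 (z : ℂ) : HasDerivAt (fun z => a 0 z * R z) (a 1 z * R z + a 0 z * R1 z) z :=
    (da 0 z).mul (dR z)
  have e2 (z : ℂ) : HasDerivAt (fun z => a 1 z * R z + a 0 z * R1 z)
      ((a 2 z * R z + a 1 z * R1 z) + (a 1 z * R1 z + a 0 z * R2 z)) z :=
    ((da 1 z).mul (dR z)).add ((da 0 z).mul (dR1 z))
  have e3 : HasDerivAt (fun z => (a 2 z * R z + a 1 z * R1 z) + (a 1 z * R1 z + a 0 z * R2 z))
      (((a 3 0 * R 0 + a 2 0 * R1 0) + (a 2 0 * R1 0 + a 1 0 * R2 0)) +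
        ((a 2 0 * R1 0 + a 1 0 * R2 0) + (a 1 0 * R2 0 + a 0 0 * deriv R2 0))) 0 :=
    (((da 2 0).mul (dR 0)).add ((da 1 0).mul (dR1 0))).add
      (((da 1 0).mul (dR1 0)).add ((da 0 0).mul dR2.hasDerivAt))
  -- three derivatives of `ϑ₁(2z)`
  have f1 (k : ℕ) (z : ℂ) : HasDerivAt (fun z => a k (2 * z)) (a (k + 1) (2 * z) * 2) z := by
    have h : HasDerivAt (fun z : ℂ => 2 * z) 2 z := by simpa using (hasDerivAt_id z).const_mul 2
    exact HasDerivAt.comp z (da k (2 * z)) h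
  have key : (fun z => a 0 z * R z) =ᶠ[𝓝 0] fun z => (R 0 / 2) * a 0 (2 * z) := by
    filter_upwards [eventually_duplication hμ] with z hz
    simp only [theta1_eq_thetaD, theta2_eq_thetaD, theta3_eq_thetaD, theta4_eq_thetaD] at hz
    simp only [hR, ha, hb, hc, hd]
    linear_combination -hz
  have key1 : (fun z => a 1 z * R z + a 0 z * R1 z) =ᶠ[𝓝 0]
      fun z => (R 0 / 2) * (a 1 (2 * z) * 2) := by
    filter_upwards [key.eventuallyEq_nhds] with z hz
    exact ((e1 z).congr_of_eventuallyEq hz.symm).unique ((f1 0 z).const_mul (R 0 / 2))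
  have key2 : (fun z => (a 2 z * R z + a 1 z * R1 z) + (a 1 z * R1 z + a 0 z * R2 z)) =ᶠ[𝓝 0]
      fun z => (R 0 / 2) * (a 2 (2 * z) * 2 * 2) := by
    filter_upwards [key1.eventuallyEq_nhds] with z hz
    exact ((e2 z).congr_of_eventuallyEq hz.symm).unique
      (((f1 1 z).mul_const 2).const_mul (R 0 / 2))
  have key3 := (e3.congr_of_eventuallyEq key2.symm).unique
    ((((f1 2 0).mul_const 2).mul_const 2).const_mul (R 0 / 2))
  have hR10 : R1 0 = 0 := by simp [hR1, b1, c1, d1]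
  rw [mul_zero, a0, a2, hR10] at key3
  simp only [theta2_eq_thetaD, theta3_eq_thetaD, theta4_eq_thetaD]
  have hR20 : R2 0 = (b 2 0 * c 0 0 + b 0 0 * c 2 0) * d 0 0 + b 0 0 * c 0 0 * d 2 0 := by
    simp [hR2, b1, c1, d1]
  rw [hR20] at key3
  simp only [hR, ha, hb, hc, hd] at key3
  norm_num at key3 ⊢
  linear_combination key3 / 3

lemma tendsto_tsum_exp_atTop (c : ℤ → ℂ) (d : ℤ → ℝ) (hd : ∀ m, 0 ≤ d m)
    (hs : Summable fun m => ‖c m‖ * Real.exp (-Real.pi * d m)) :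
    Tendsto (fun y : ℝ => ∑' m, c m * Complex.exp (-Real.pi * y * d m)) atTop
      (𝓝 (∑' m, if d m = 0 then c m else 0)) := by
  have hn (y : ℝ) (m : ℤ) : ‖c m * Complex.exp (-Real.pi * y * d m)‖ =
      ‖c m‖ * Real.exp (-Real.pi * (y * d m)) := by
    rw [norm_mul, Complex.norm_exp]
    congr 2
    rw [show (-Real.pi * y * d m : ℂ) = ((-Real.pi * (y * d m) : ℝ) : ℂ) by push_cast; ring,
      Complex.ofReal_re]
  refine tendsto_tsum_of_dominated_convergence hs (fun m => ?_) ?_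
  · split_ifs with h
    · simp [h]
    · have hpos : 0 < d m := lt_of_le_of_ne (hd m) (Ne.symm h)
      rw [tendsto_zero_iff_norm_tendsto_zero]
      simp only [hn]
      rw [← mul_zero ‖c m‖]
      refine Tendsto.const_mul _ (Real.tendsto_exp_atBot.comp ?_)
      have : Tendsto (fun y : ℝ => (-Real.pi * d m) * y) atTop atBot :=
        tendsto_id.const_mul_atTop_of_neg (by have := mul_pos Real.pi_pos hpos; linarith)
      exact this.congr fun y => by ring
  · filter_upwards [eventually_ge_atTop 1] with y hy m
    rw [hn]
    refine mul_le_mul_of_nonneg_left (Real.exp_le_exp.2 ?_) (norm_nonneg _)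
    have h1 := mul_le_mul_of_nonneg_right hy (hd m)
    have := mul_le_mul_of_nonneg_left h1 Real.pi_pos.le
    linarith

/-- The behaviour of a theta constant at the cusp `i ∞`, after division by its leading
exponential. -/
lemma tendsto_thetaD_atTop (k : ℕ) (p : ℝ) (q : ℂ) (hp : ∀ m : ℤ, 0 ≤ (m + p) ^ 2 - p ^ 2) :
    Tendsto (fun y : ℝ => Complex.exp (Real.pi * y * p ^ 2) * thetaD k p q 0 (y * Complex.I)) atTop
      (𝓝 (∑' m : ℤ, if (m + p) ^ 2 - p ^ 2 = 0 then (2 * Real.pi * Complex.I * (m + p)) ^ k *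
        Complex.exp (2 * Real.pi * Complex.I * (m + p) * q) else 0)) := by
  have hI : Complex.I * Complex.I = -1 := Complex.I_mul_I
  have e (y : ℝ) (m : ℤ) : Complex.exp (Real.pi * y * p ^ 2) * thetaTerm k p q m 0 (y * Complex.I) =
      ((2 * Real.pi * Complex.I * (m + p)) ^ k *
        Complex.exp (2 * Real.pi * Complex.I * (m + p) * q)) *
      Complex.exp (-Real.pi * y * ((m + p) ^ 2 - p ^ 2 : ℝ)) := by
    rw [thetaTerm, mul_left_comm, ← Complex.exp_add, mul_assoc (_ ^ k), ← Complex.exp_add]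
    congr 2
    push_cast
    linear_combination (Real.pi * y * (m + p) ^ 2 : ℂ) * hI
  have h := tendsto_tsum_exp_atTop (fun m : ℤ => (2 * Real.pi * Complex.I * (m + p)) ^ k *
        Complex.exp (2 * Real.pi * Complex.I * (m + p) * q)) (fun m => (m + p) ^ 2 - p ^ 2) hp ?_
  · refine h.congr fun y => ?_
    rw [thetaD, ← tsum_mul_left]
    exact tsum_congr fun m => (e y m).symm
  · have h1 := ((summable_thetaTerm k p q 0 (μ := (1 : ℝ) * Complex.I) (by simp)).mul_left
      (Complex.exp (Real.pi * (1 : ℝ) * p ^ 2))).norm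
    refine h1.congr fun m => ?_
    rw [e, norm_mul, Complex.norm_exp]
    congr 2
    rw [show (-Real.pi * (1 : ℝ) * ((m + p) ^ 2 - p ^ 2 : ℝ) : ℂ) =
      ((-Real.pi * ((m + p) ^ 2 - p ^ 2) : ℝ) : ℂ) by push_cast; ring, Complex.ofReal_re]

lemma tendsto_thetaD_zero_atTop (q : ℂ) :
    Tendsto (fun y : ℝ => thetaD 0 0 q 0 (y * Complex.I)) atTop (𝓝 1) := by
  have h := tendsto_thetaD_atTop 0 0 q (fun m => by simpa using sq_nonneg (m : ℝ))
  have e : (fun m : ℤ => if ((m : ℝ) + 0) ^ 2 - (0 : ℝ) ^ 2 = 0 then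
      (2 * Real.pi * Complex.I * (m + (0 : ℝ))) ^ 0 *
        Complex.exp (2 * Real.pi * Complex.I * (m + (0 : ℝ)) * q) else 0) =
      fun m : ℤ => if m = 0 then 1 else 0 := by
    funext m
    by_cases hm : m = 0 <;> simp [hm]
  rw [e, tsum_ite_eq] at h
  simpa using h

lemma tendsto_thetaD_half_atTop (k : ℕ) (q : ℂ) :
    Tendsto (fun y : ℝ => Complex.exp (Real.pi * y / 4) *
      thetaD k (1 / 2) q 0 (y * Complex.I)) atTop
      (𝓝 ((Real.pi * Complex.I) ^ k * Complex.exp (Real.pi * Complex.I * q) +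
        (-(Real.pi * Complex.I)) ^ k * Complex.exp (-(Real.pi * Complex.I * q)))) := by
  have hm (m : ℤ) : 0 ≤ ((m : ℝ) + (1 / 2 : ℝ)) ^ 2 - (1 / 2 : ℝ) ^ 2 := by
    have : 0 ≤ m * (m + 1) := by
      rcases le_or_gt 0 m with h | h
      · positivity
      · nlinarith
    have : (0 : ℝ) ≤ m * (m + 1) := by exact_mod_cast this
    nlinarith
  have h := tendsto_thetaD_atTop k (1 / 2) q hm
  have hz (m : ℤ) (hm : m ∉ ({0, -1} : Finset ℤ)) :
      ((m : ℝ) + (1 / 2 : ℝ)) ^ 2 - (1 / 2 : ℝ) ^ 2 ≠ 0 := by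
    intro h0
    have h1 : (m : ℝ) * (m + 1) = 0 := by linear_combination h0
    have h2 : m * (m + 1) = 0 := by exact_mod_cast h1
    rcases mul_eq_zero.1 h2 with h3 | h3
    · simp [h3] at hm
    · have : m = -1 := by omega
      simp [this] at hm
  rw [tsum_eq_sum (s := ({0, -1} : Finset ℤ)) (fun m hm => if_neg (hz m hm)),
    Finset.sum_pair (by norm_num)] at h
  rw [if_pos (by norm_num), if_pos (by norm_num)] at h
  have hcast : ((1 / 2 : ℝ) : ℂ) = 1 / 2 := by push_cast; rfl
  simp only [hcast] at h
  have e1 : (2 * Real.pi * Complex.I * (((0 : ℤ) : ℂ) + 1 / 2) : ℂ) = Real.pi * Complex.I := by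
    push_cast; ring
  have e2 : (2 * Real.pi * Complex.I * (((-1 : ℤ) : ℂ) + 1 / 2) : ℂ) = -(Real.pi * Complex.I) := by
    push_cast; ring
  rw [e1, e2, neg_mul _ q] at h
  refine h.congr fun y => ?_
  congr 2; ring

/-- Jacobi's derivative formula `ϑ₁' = π ϑ₂ ϑ₃ ϑ₄`. By the heat equation and the duplication
formula, the quotient of the two sides does not depend on `μ`; its value is found at `i ∞`. -/
theorem jacobi_derivative (hμ : 0 < μ.im) :
    -thetaD 1 (1 / 2) (1 / 2) 0 μ = Real.pi * (theta2 0 μ * theta3 0 μ * theta4 0 μ) := by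
  set κ : ℂ → ℂ := fun ν => -thetaD 1 (1 / 2) (1 / 2) 0 ν / (theta2 0 ν * theta3 0 ν * theta4 0 ν)
    with hκ
  have hne {ν : ℂ} (hν : 0 < ν.im) : theta2 0 ν * theta3 0 ν * theta4 0 ν ≠ 0 :=
    mul_ne_zero (mul_ne_zero (theta2_zero_ne_zero hν) (theta3_zero_ne_zero hν))
      (theta4_zero_ne_zero hν)
  have hder {ν : ℂ} (hν : 0 < ν.im) : HasDerivAt κ 0 ν := by
    have h1 := (hasDerivAt_thetaD_module 1 (1 / 2) (1 / 2) 0 hν).neg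
    have h2 := ((hasDerivAt_thetaD_module 0 (1 / 2) 0 0 hν).mul
      (hasDerivAt_thetaD_module 0 0 0 0 hν)).mul (hasDerivAt_thetaD_module 0 0 (1 / 2) 0 hν)
    have hne' := hne hν
    simp only [hκ, theta2_eq_thetaD, theta3_eq_thetaD, theta4_eq_thetaD] at hne' ⊢
    refine (h1.div h2 hne').congr_deriv ?_
    have h3 := third_derivative_identity hν
    simp only [theta2_eq_thetaD, theta3_eq_thetaD, theta4_eq_thetaD] at h3
    rw [div_eq_zero_iff]
    left
    simp only [Pi.mul_apply, Pi.neg_apply]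
    linear_combination h3 / (4 * Real.pi * Complex.I)
  have hconst {ν : ℂ} (hν : 0 < ν.im) : κ ν = κ μ :=
    (isOpen_lt continuous_const Complex.continuous_im).is_const_of_deriv_eq_zero
      (convex_halfSpace_im_gt 0).isPreconnected
      (fun x hx => (hder hx).differentiableAt.differentiableWithinAt)
      (fun x hx => (hder hx).deriv) hν hμ
  have hlim : Tendsto (fun y : ℝ => κ (y * Complex.I)) atTop (𝓝 Real.pi) := by
    have t1 := tendsto_thetaD_half_atTop 1 (1 / 2)
    have t2 := tendsto_thetaD_half_atTop 0 0
    have t3 := tendsto_thetaD_zero_atTop 0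
    have t4 := tendsto_thetaD_zero_atTop (1 / 2)
    have hexp : Complex.exp (Real.pi * Complex.I * (1 / 2)) = Complex.I := by
      rw [show (Real.pi * Complex.I * (1 / 2) : ℂ) = Real.pi / 2 * Complex.I by ring,
        Complex.exp_pi_div_two_mul_I]
    have hexp' : Complex.exp (-(Real.pi * Complex.I * (1 / 2))) = -Complex.I := by
      rw [Complex.exp_neg, hexp, Complex.inv_I]
    rw [hexp, hexp'] at t1
    have t := t1.neg.div ((t2.mul t3).mul t4) (by simp)
    have hval :
        -((Real.pi * Complex.I : ℂ) ^ 1 * Complex.I + (-(Real.pi * Complex.I)) ^ 1 * -Complex.I) /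
        (((Real.pi * Complex.I : ℂ) ^ 0 * Complex.exp (Real.pi * Complex.I * 0) +
          (-(Real.pi * Complex.I)) ^ 0 * Complex.exp (-(Real.pi * Complex.I * 0))) * 1 * 1) =
        Real.pi := by
      simp only [pow_one, pow_zero, mul_zero, neg_zero, Complex.exp_zero]
      linear_combination (-(Real.pi : ℂ)) * Complex.I_mul_I
    rw [hval] at t
    refine t.congr fun y => ?_
    have := Complex.exp_ne_zero (Real.pi * y / 4)
    simp only [hκ, theta2_eq_thetaD, theta3_eq_thetaD, theta4_eq_thetaD, Pi.div_apply]
    rw [← mul_neg, mul_assoc, mul_assoc, mul_div_mul_left _ _ this, mul_assoc]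
  have hval : κ μ = Real.pi := by
    refine tendsto_nhds_unique (tendsto_const_nhds.congr' ?_) hlim
    filter_upwards [eventually_gt_atTop 0] with y hy
    exact (hconst (by simpa using hy)).symm
  rw [← hval, hκ]
  exact (div_mul_cancel₀ _ (hne hμ)).symm

end

/-! ### The functions `w_a` and `Z_a` -/

section

variable {μ : ℂ}


/-- The first characteristic of the theta function in the numerator of `w_a`. -/
def charP (a : Fin 3) : ℂ := ![0, 0, 1 / 2] a
/-- The second characteristic of the theta function in the numerator of `w_a`. -/
def charQ (a : Fin 3) : ℂ := ![1 / 2, 0, 0] a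
/-- The sign of `w_a` under `z ↦ z + 1`. -/
def signOne (a : Fin 3) : ℂ := ![-1, -1, 1] a
/-- The sign of `w_a` under `z ↦ z + μ`. -/
def signModule (a : Fin 3) : ℂ := ![1, -1, -1] a

lemma thetaNum_eq_thetaD (a : Fin 3) (z μ : ℂ) :
    thetaNum a z μ = thetaD 0 (charP a) (charQ a) z μ := by
  fin_cases a
  · exact theta4_eq_thetaD z μ
  · exact theta3_eq_thetaD z μ
  · exact theta2_eq_thetaD z μ

lemma signOne_eq (a : Fin 3) : signOne a = 1 ∨ signOne a = -1 := by
  fin_cases a <;> simp [signOne]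
lemma signModule_eq (a : Fin 3) : signModule a = 1 ∨ signModule a = -1 := by
  fin_cases a <;> simp [signModule]
lemma signOne_or_signModule (a : Fin 3) : signOne a = -1 ∨ signModule a = -1 := by
  fin_cases a <;> simp [signOne, signModule]

lemma thetaNum_add_one (a : Fin 3) (z : ℂ) :
    thetaNum a (z + 1) μ = -signOne a * thetaNum a z μ := by
  fin_cases a
  · simpa [thetaNum, signOne] using theta4_add_one z μ
  · simpa [thetaNum, signOne] using theta3_add_one z μ
  · simpa [thetaNum, signOne] using theta2_add_one z μ

lemma thetaNum_add_module (a : Fin 3) (z : ℂ) :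
    thetaNum a (z + μ) μ = -signModule a * (quasiFactor z μ * thetaNum a z μ) := by
  fin_cases a
  · simpa [thetaNum, signModule] using theta4_add_module z μ
  · simpa [thetaNum, signModule] using theta3_add_module z μ
  · simpa [thetaNum, signModule] using theta2_add_module z μ

lemma thetaNum_neg (a : Fin 3) (z : ℂ) : thetaNum a (-z) μ = thetaNum a z μ := by
  fin_cases a
  · exact theta4_neg z μ
  · exact theta3_neg z μ
  · exact theta2_neg z μ

lemma w_neg (a : Fin 3) (z : ℂ) : w a (-z) μ = -w a z μ := by
  rw [w, w, thetaNum_neg, theta1_neg, div_neg]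

lemma w_add_one (a : Fin 3) (z : ℂ) : w a (z + 1) μ = signOne a * w a z μ := by
  rw [w, w, thetaNum_add_one, theta1_add_one, div_neg]; ring

lemma w_add_module (a : Fin 3) (z : ℂ) : w a (z + μ) μ = signModule a * w a z μ := by
  rw [w, w, thetaNum_add_module, theta1_add_module]
  have := quasiFactor_ne_zero z μ
  rw [show thetaConst a μ * (-signModule a * (quasiFactor z μ * thetaNum a z μ)) =
    -quasiFactor z μ * (signModule a * (thetaConst a μ * thetaNum a z μ)) by ring,
    mul_div_mul_left _ _ (neg_ne_zero.2 this), mul_div_assoc]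

lemma thetaConst_ne_zero (hμ : 0 < μ.im) (a : Fin 3) : thetaConst a μ ≠ 0 := by
  have h2 := theta2_zero_ne_zero hμ
  have h3 := theta3_zero_ne_zero hμ
  have h4 := theta4_zero_ne_zero hμ
  fin_cases a <;> simp [thetaConst, h2, h3, h4, Real.pi_ne_zero]

/-- The zeros of the theta functions in the numerators are half periods. -/
lemma thetaNum_ne_zero (hμ : 0 < μ.im) (a : Fin 3) {z : ℂ} (h : ¬ InLattice μ (2 * z)) :
    thetaNum a z μ ≠ 0 := by
  intro h0
  apply h
  have hd {x : ℂ} (hx : InLattice μ x) : InLattice μ (2 * x) := by rw [two_mul]; exact hx.add hx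
  fin_cases a
  · have := hd ((theta4_eq_zero_iff hμ).1 h0)
    have := this.add inLattice_module
    convert this using 1; ring
  · have := hd ((theta3_eq_zero_iff hμ).1 h0)
    have := (this.add inLattice_module).sub inLattice_one
    convert this using 1; ring
  · have := hd ((theta2_eq_zero_iff hμ).1 h0)
    have := this.sub inLattice_one
    convert this using 1; ring

lemma w_ne_zero (hμ : 0 < μ.im) (a : Fin 3) {z : ℂ} (h : ¬ InLattice μ (2 * z)) :
    w a z μ ≠ 0 := by
  have hz : ¬ InLattice μ z := fun hz => h (by rw [two_mul]; exact hz.add hz)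
  exact div_ne_zero (mul_ne_zero (thetaConst_ne_zero hμ a) (thetaNum_ne_zero hμ a h))
    (theta1_ne_zero hμ hz)

/-- Jacobi's formula says that all `w_a` have residue `1` at the origin. -/
lemma thetaConst_mul_thetaNum_zero (hμ : 0 < μ.im) (a : Fin 3) :
    thetaConst a μ * thetaNum a 0 μ = -thetaD 1 (1 / 2) (1 / 2) 0 μ := by
  rw [jacobi_derivative hμ]
  fin_cases a <;> simp [thetaConst, thetaNum] <;> ring

lemma hasDerivAt_thetaNum (a : Fin 3) (z : ℂ) (hμ : 0 < μ.im) :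
    HasDerivAt (fun u => thetaNum a u μ) (thetaD 1 (charP a) (charQ a) z μ) z := by
  simp only [thetaNum_eq_thetaD]; exact hasDerivAt_thetaD 0 _ _ z hμ

lemma deriv_thetaNum (a : Fin 3) (hμ : 0 < μ.im) :
    deriv (fun u => thetaNum a u μ) = fun z => thetaD 1 (charP a) (charQ a) z μ :=
  funext fun z => (hasDerivAt_thetaNum a z hμ).deriv

lemma thetaD_one_char_zero (hμ : 0 < μ.im) (a : Fin 3) :
    thetaD 1 (charP a) (charQ a) 0 μ = 0 :=
  deriv_zero_of_even (hasDerivAt_thetaNum a 0 hμ) fun z => thetaNum_neg a z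

/-- A quotient of an even entire function by an odd one with a simple zero at the origin is
`1 / z + O(z)`, after normalization. -/
lemma tendsto_div_sub_inv {f g : ℂ → ℂ} (hf : Differentiable ℂ f) (hg : Differentiable ℂ g)
    (hfe : ∀ z, f (-z) = f z) (hgo : ∀ z, g (-z) = -g z) {c : ℂ} (hc : c ≠ 0)
    (hg' : HasDerivAt g c 0) (hf0 : f 0 = c) :
    Tendsto (fun z => f z / g z - 1 / z) (𝓝[≠] 0) (𝓝 0) := by
  have hg0 : g 0 = 0 := by have := hgo 0; rw [neg_zero] at this; linear_combination this / 2
  set h : ℂ → ℂ := fun z => z * f z - g z with hh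
  have hd : Differentiable ℂ h := (differentiable_id.mul hf).sub hg
  have h0 : h 0 = 0 := by simp [hh, hg0]
  have hd0 : deriv h 0 = 0 := by
    have := (((hasDerivAt_id (0 : ℂ)).mul (hf 0).hasDerivAt).sub hg').deriv
    have h2 : h = id * f - g := by funext z; simp [hh]
    rw [h2, this, hf0]
    simp
  have hd1 : Differentiable ℂ (dslope h 0) := fun z => by
    have := (Complex.differentiableOn_dslope (s := Set.univ) (c := 0) (f := h) univ_mem).2
      hd.differentiableOn
    exact (this z trivial).differentiableAt univ_mem
  have h1 (z : ℂ) (hz : z ≠ 0) : dslope h 0 z = h z / z := by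
    rw [dslope_of_ne _ hz, slope_def_field, h0, sub_zero, sub_zero]
  have h10 : dslope h 0 0 = 0 := by rw [dslope_same, hd0]
  have hL := tendsto_div_of_hasDerivAt (hd1 0).hasDerivAt h10
  set L := deriv (dslope h 0) 0 with hLdef
  have hneg : Tendsto (fun z : ℂ => -z) (𝓝[≠] 0) (𝓝[≠] 0) := by
    refine tendsto_nhdsWithin_of_tendsto_nhds_of_eventually_within _ ?_ ?_
    · have : Tendsto (fun z : ℂ => -z) (𝓝 0) (𝓝 (-0)) := continuous_neg.tendsto 0
      rw [neg_zero] at this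
      exact this.mono_left nhdsWithin_le_nhds
    · filter_upwards [self_mem_nhdsWithin] with u hu
      simpa using hu
  -- the coefficient of `z²` in the odd function `z f(z) - g(z)` vanishes
  have hL0 : L = 0 := by
    have h3 : Tendsto (fun z => dslope h 0 z / (z - 0)) (𝓝[≠] 0) (𝓝 (-L)) := by
      refine (hL.comp hneg).neg.congr' ?_
      filter_upwards [self_mem_nhdsWithin] with z hz
      have hz' : z ≠ 0 := hz
      simp only [Function.comp]
      rw [h1 _ (neg_ne_zero.2 hz'), h1 _ hz']
      simp only [hh, hfe, hgo, sub_zero]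
      field_simp
      ring
    have := tendsto_nhds_unique hL h3
    linear_combination this / 2
  have h4 := hL.mul (tendsto_sub_div_of_hasDerivAt hg' hg0 hc)
  rw [hL0, zero_mul] at h4
  refine h4.congr' ?_
  have h5 : ∀ᶠ z in 𝓝[≠] (0 : ℂ), g z ≠ 0 := by
    have := hg'.eventually_ne (c := 0) hc
    exact this
  filter_upwards [self_mem_nhdsWithin, h5] with z hz hgz
  have hz' : z ≠ 0 := hz
  rw [h1 _ hz']
  simp only [hh, sub_zero]
  field_simp

lemma tendsto_w_sub_inv (hμ : 0 < μ.im) (a : Fin 3) :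
    Tendsto (fun z => w a z μ - 1 / z) (𝓝[≠] 0) (𝓝 0) :=
  tendsto_div_sub_inv (f := fun z => thetaConst a μ * thetaNum a z μ)
    (fun z => (hasDerivAt_thetaNum a z hμ).differentiableAt.const_mul _)
    (differentiable_theta1 hμ) (fun z => by rw [thetaNum_neg]) (fun z => theta1_neg z μ)
    (neg_ne_zero.2 (thetaD_one_zero_ne_zero hμ)) (hasDerivAt_theta1 0 hμ)
    (thetaConst_mul_thetaNum_zero hμ a)

lemma tendsto_mul_w (hμ : 0 < μ.im) (a : Fin 3) :
    Tendsto (fun z => z * w a z μ) (𝓝[≠] 0) (𝓝 1) := by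
  have h1 := tendsto_sub_div_of_hasDerivAt (hasDerivAt_theta1 0 hμ) (theta1_zero μ)
    (neg_ne_zero.2 (thetaD_one_zero_ne_zero hμ))
  have h2 : Tendsto (fun z => thetaConst a μ * thetaNum a z μ) (𝓝[≠] 0)
      (𝓝 (thetaConst a μ * thetaNum a 0 μ)) :=
    ((hasDerivAt_thetaNum a 0 hμ).continuousAt.tendsto.const_mul _).mono_left nhdsWithin_le_nhds
  have h3 := h2.mul h1
  rw [thetaConst_mul_thetaNum_zero hμ, mul_inv_cancel₀ (neg_ne_zero.2 (thetaD_one_zero_ne_zero hμ))]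
    at h3
  refine h3.congr fun z => ?_
  rw [w, sub_zero]; ring

lemma contDiffAt_theta1 (n : ℕ) (z : ℂ) (hμ : 0 < μ.im) :
    ContDiffAt ℂ n (fun x : ℂ × ℂ => theta1 x.1 x.2) (z, μ) := by
  simp only [theta1_eq_thetaD]; exact (contDiffAt_thetaD n 0 _ _ z hμ).neg

lemma contDiffAt_thetaNum (n : ℕ) (a : Fin 3) (z : ℂ) (hμ : 0 < μ.im) :
    ContDiffAt ℂ n (fun x : ℂ × ℂ => thetaNum a x.1 x.2) (z, μ) := by
  simp only [thetaNum_eq_thetaD]; exact contDiffAt_thetaD n 0 _ _ z hμ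

lemma contDiffAt_thetaConst (n : ℕ) (a : Fin 3) (hμ : 0 < μ.im) :
    ContDiffAt ℂ n (fun ν => thetaConst a ν) μ := by
  have h (a : Fin 3) : ContDiffAt ℂ n (fun ν => thetaNum a 0 ν) μ :=
    (contDiffAt_thetaNum n a 0 hμ).comp μ (contDiffAt_const.prodMk contDiffAt_id)
  have h4 := h 0
  have h3 := h 1
  have h2 := h 2
  simp only [thetaNum, Matrix.cons_val_zero, Matrix.cons_val_one, Matrix.cons_val] at h4 h3 h2
  fin_cases a
  · exact (contDiffAt_const.mul h2).mul h3
  · exact (contDiffAt_const.mul h2).mul h4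
  · exact (contDiffAt_const.mul h3).mul h4

lemma contDiffAt_thetaConst_snd (n : ℕ) (a : Fin 3) (z : ℂ) (hμ : 0 < μ.im) :
    ContDiffAt ℂ n (fun x : ℂ × ℂ => thetaConst a x.2) (z, μ) :=
  ContDiffAt.comp (g := fun ν => thetaConst a ν) (z, μ) (contDiffAt_thetaConst n a hμ)
    contDiffAt_snd

lemma contDiffAt_w (n : ℕ) (a : Fin 3) {z : ℂ} (hμ : 0 < μ.im) (hz : ¬ InLattice μ z) :
    ContDiffAt ℂ n (fun x : ℂ × ℂ => w a x.1 x.2) (z, μ) :=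
  ((contDiffAt_thetaConst_snd n a z hμ).mul (contDiffAt_thetaNum n a z hμ)).div
    (contDiffAt_theta1 n z hμ) (theta1_ne_zero hμ hz)

lemma isOpen_lattice_compl : IsOpen {x : ℂ × ℂ | 0 < x.2.im ∧ ¬ InLattice x.2 x.1} := by
  have h : {x : ℂ × ℂ | 0 < x.2.im ∧ ¬ InLattice x.2 x.1} =
      {x : ℂ × ℂ | 0 < x.2.im ∧ theta1 x.1 x.2 ≠ 0} := by
    ext x
    exact and_congr_right fun hx => by
      show ¬ InLattice x.2 x.1 ↔ ¬ theta1 x.1 x.2 = 0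
      rw [theta1_eq_zero_iff hx]
  rw [h, isOpen_iff_mem_nhds]
  rintro ⟨z, ν⟩ ⟨hν, hz⟩
  have h1 := (contDiffAt_theta1 0 z hν).continuousAt.eventually_ne hz
  have h2 : ∀ᶠ x : ℂ × ℂ in 𝓝 (z, ν), 0 < x.2.im :=
    (isOpen_lt continuous_const (Complex.continuous_im.comp continuous_snd)).mem_nhds hν
  exact h2.and h1

lemma Z_eq (a : Fin 3) {z : ℂ} (hμ : 0 < μ.im) (hz : ¬ InLattice μ z) :
    Z a z μ = thetaConst a μ / (2 * Real.pi * Complex.I) *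
      (thetaD 1 (charP a) (charQ a) z μ / theta1 z μ) := by
  rw [Z, if_neg (theta1_ne_zero hμ hz), deriv_thetaNum a hμ]

lemma Z_zero (a : Fin 3) (hμ : 0 < μ.im) :
    Z a 0 μ = thetaConst a μ / (2 * Real.pi * Complex.I) *
      (thetaD 2 (charP a) (charQ a) 0 μ / -thetaD 1 (1 / 2) (1 / 2) 0 μ) := by
  rw [Z, if_pos (theta1_zero μ), deriv_thetaNum a hμ, (hasDerivAt_thetaD 1 _ _ 0 hμ).deriv,
    (hasDerivAt_theta1 0 hμ).deriv]

lemma contDiffAt_Z (n : ℕ) (a : Fin 3) {z : ℂ} (hμ : 0 < μ.im) (hz : ¬ InLattice μ z) :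
    ContDiffAt ℂ n (fun x : ℂ × ℂ => Z a x.1 x.2) (z, μ) := by
  have h : ContDiffAt ℂ n (fun x : ℂ × ℂ => thetaConst a x.2 / (2 * Real.pi * Complex.I) *
      (thetaD 1 (charP a) (charQ a) x.1 x.2 / theta1 x.1 x.2)) (z, μ) :=
    ((contDiffAt_thetaConst_snd n a z hμ).div_const _).mul
      ((contDiffAt_thetaD n 1 _ _ z hμ).div (contDiffAt_theta1 n z hμ) (theta1_ne_zero hμ hz))
  refine h.congr_of_eventuallyEq ?_
  filter_upwards [isOpen_lattice_compl.mem_nhds (show (z, μ) ∈ {x : ℂ × ℂ | 0 < x.2.im ∧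
    ¬ InLattice x.2 x.1} from ⟨hμ, hz⟩)] with x hx
  exact Z_eq a hx.1 hx.2

lemma Z_add_one (a : Fin 3) {z : ℂ} (hμ : 0 < μ.im) (hz : ¬ InLattice μ z) :
    Z a (z + 1) μ = signOne a * Z a z μ := by
  have hz1 : ¬ InLattice μ (z + 1) := by rwa [inLattice_add_iff inLattice_one]
  have h : thetaD 1 (charP a) (charQ a) (z + 1) μ =
      -signOne a * thetaD 1 (charP a) (charQ a) z μ := by
    have h1 := HasDerivAt.comp_add_const z 1 (hasDerivAt_thetaNum a (z + 1) hμ)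
    simp only [thetaNum_add_one] at h1
    exact h1.unique ((hasDerivAt_thetaNum a z hμ).const_mul _)
  rw [Z_eq a hμ hz1, Z_eq a hμ hz, h, theta1_add_one, div_neg]; ring

lemma hasDerivAt_quasiFactor (z μ : ℂ) :
    HasDerivAt (fun u => quasiFactor u μ) (-(2 * Real.pi * Complex.I) * quasiFactor z μ) z := by
  have h := ((((hasDerivAt_id z).const_mul (2 * Real.pi * Complex.I)).const_sub
    (-Real.pi * Complex.I * μ))).cexp
  refine h.congr_deriv ?_
  simp only [quasiFactor, id]; ring

lemma Z_add_module (a : Fin 3) {z : ℂ} (hμ : 0 < μ.im) (hz : ¬ InLattice μ z) :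
    Z a (z + μ) μ = signModule a * (Z a z μ - w a z μ) := by
  have hz1 : ¬ InLattice μ (z + μ) := by rwa [inLattice_add_iff inLattice_module]
  have h : thetaD 1 (charP a) (charQ a) (z + μ) μ =
      -signModule a * (-(2 * Real.pi * Complex.I) * quasiFactor z μ * thetaNum a z μ +
        quasiFactor z μ * thetaD 1 (charP a) (charQ a) z μ) := by
    have h1 := HasDerivAt.comp_add_const z μ (hasDerivAt_thetaNum a (z + μ) hμ)
    simp only [thetaNum_add_module] at h1
    exact h1.unique (((hasDerivAt_quasiFactor z μ).mul (hasDerivAt_thetaNum a z hμ)).const_mul _)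
  have h2 := quasiFactor_ne_zero z μ
  have h3 := theta1_ne_zero hμ hz
  have h4 := Complex.two_pi_I_ne_zero
  rw [Z_eq a hμ hz1, Z_eq a hμ hz, h, theta1_add_module, w]
  have : (Real.pi : ℂ) ≠ 0 := by exact_mod_cast Real.pi_ne_zero
  have := Complex.I_ne_zero
  field_simp
  ring

/-- `Z_a` is holomorphic at the origin. -/
lemma eventually_differentiableAt_Z (a : Fin 3) (hμ : 0 < μ.im) :
    ∀ᶠ z in 𝓝 0, DifferentiableAt ℂ (fun u => Z a u μ) z := by
  set f : ℂ → ℂ := fun z => thetaD 1 (charP a) (charQ a) z μ with hf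
  set g : ℂ → ℂ := fun z => theta1 z μ with hg
  have hfd : Differentiable ℂ f := fun z => (hasDerivAt_thetaD 1 _ _ z hμ).differentiableAt
  have hgd : Differentiable ℂ g := differentiable_theta1 hμ
  have hds {h : ℂ → ℂ} (hd : Differentiable ℂ h) : Differentiable ℂ (dslope h 0) := fun z => by
    have := (Complex.differentiableOn_dslope (s := Set.univ) (c := 0) (f := h) univ_mem).2
      hd.differentiableOn
    exact (this z trivial).differentiableAt univ_mem
  have hg0 : dslope g 0 0 ≠ 0 := by
    rw [dslope_same, (hasDerivAt_theta1 0 hμ).deriv]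
    exact neg_ne_zero.2 (thetaD_one_zero_ne_zero hμ)
  have hne : ∀ᶠ z in 𝓝 0, dslope g 0 z ≠ 0 := (hds hgd).continuous.continuousAt.eventually_ne hg0
  have heq : (fun u => Z a u μ) =ᶠ[𝓝 0] fun u => thetaConst a μ / (2 * Real.pi * Complex.I) *
      (dslope f 0 u / dslope g 0 u) := by
    have h1 := eventually_not_inLattice hμ 0 0
    rw [eventually_nhdsWithin_iff] at h1
    filter_upwards [h1] with u hu
    by_cases hu0 : u = 0
    · subst hu0
      rw [Z_zero a hμ, dslope_same, dslope_same, (hasDerivAt_theta1 0 hμ).deriv,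
        (hasDerivAt_thetaD 1 _ _ 0 hμ).deriv]
    · have hu1 : ¬ InLattice μ u := by simpa using hu hu0
      rw [Z_eq a hμ hu1, dslope_of_ne _ hu0, dslope_of_ne _ hu0, slope_def_field, slope_def_field]
      simp only [hf, hg, thetaD_one_char_zero hμ, theta1_zero, sub_zero]
      rw [div_div_div_cancel_right₀ hu0]
  filter_upwards [heq.eventuallyEq_nhds, hne] with z hz hz'
  refine DifferentiableAt.congr_of_eventuallyEq ?_ hz
  exact (((hds hfd) z).div ((hds hgd) z) hz').const_mul _

/-- As the residue of `w_a` does not depend on `μ`, the derivative in `μ` has no pole. -/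
lemma tendsto_mul_fderiv_w (a : Fin 3) (hμ : 0 < μ.im) :
    Tendsto (fun z => z * fderiv ℂ (fun x : ℂ × ℂ => w a x.1 x.2) (z, μ) (0, 1)) (𝓝[≠] 0)
      (𝓝 0) := by
  set C' := deriv (fun ν => thetaConst a ν) μ with hC'
  have hC : HasDerivAt (fun ν => thetaConst a ν) C' μ :=
    ((contDiffAt_thetaConst 1 a hμ).differentiableAt (by simp)).hasDerivAt
  set n' : ℂ → ℂ := fun z => C' * thetaNum a z μ +
    thetaConst a μ * (thetaD 2 (charP a) (charQ a) z μ / (4 * Real.pi * Complex.I)) with hn'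
  set t' : ℂ → ℂ := fun z => -(thetaD 2 (1 / 2) (1 / 2) z μ / (4 * Real.pi * Complex.I)) with ht'
  have hnum (z : ℂ) : HasDerivAt (fun ν => thetaConst a ν * thetaNum a z ν) (n' z) μ := by
    simp only [hn', thetaNum_eq_thetaD]
    exact hC.mul (hasDerivAt_thetaD_module 0 _ _ z hμ)
  have hden (z : ℂ) : HasDerivAt (fun ν => theta1 z ν) (t' z) μ := by
    simp only [ht', theta1_eq_thetaD]
    exact (hasDerivAt_thetaD_module 0 _ _ z hμ).neg
  set N : ℂ → ℂ := fun z => n' z * theta1 z μ - thetaConst a μ * thetaNum a z μ * t' z with hN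
  have hw {z : ℂ} (hz : ¬ InLattice μ z) :
      fderiv ℂ (fun x : ℂ × ℂ => w a x.1 x.2) (z, μ) (0, 1) = N z / theta1 z μ ^ 2 := by
    have h1 := ((contDiffAt_w 1 a hμ hz).differentiableAt (by simp)).hasFDerivAt
    have h2 := h1.comp_hasDerivAt μ ((hasDerivAt_const μ z).prodMk (hasDerivAt_id μ))
    exact h2.unique ((hnum z).div (hden z) (theta1_ne_zero hμ hz))
  have hn0 : n' 0 = -(thetaD 3 (1 / 2) (1 / 2) 0 μ / (4 * Real.pi * Complex.I)) := by
    refine (hnum 0).unique ?_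
    refine (hasDerivAt_thetaD_module 1 (1 / 2) (1 / 2) 0 hμ).neg.congr_of_eventuallyEq ?_
    filter_upwards [(isOpen_lt continuous_const Complex.continuous_im).mem_nhds hμ] with ν hν
    exact thetaConst_mul_thetaNum_zero hν a
  have ht0 : t' 0 = 0 := by
    have : thetaD 2 (1 / 2) (1 / 2) 0 μ = 0 := by
      refine deriv_zero_of_even (hasDerivAt_thetaD 1 _ _ 0 hμ)
        (deriv_odd (fun z => hasDerivAt_thetaD 0 _ _ z hμ) fun z => ?_)
      have := theta1_neg z μ
      rw [theta1_eq_thetaD, theta1_eq_thetaD] at this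
      exact neg_injective this
    simp only [ht']
    rw [this]
    simp
  have hN0 : N 0 = 0 := by simp [hN, ht0, theta1_zero]
  have hdN : HasDerivAt N 0 0 := by
    have hdn : DifferentiableAt ℂ n' 0 :=
      ((hasDerivAt_thetaNum a 0 hμ).differentiableAt.const_mul _).add
        (((hasDerivAt_thetaD 2 _ _ 0 hμ).differentiableAt.div_const _).const_mul _)
    have hdt : HasDerivAt t' (-(thetaD 3 (1 / 2) (1 / 2) 0 μ / (4 * Real.pi * Complex.I))) 0 :=
      ((hasDerivAt_thetaD 2 _ _ 0 hμ).div_const _).neg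
    have h := (hdn.hasDerivAt.mul (hasDerivAt_theta1 0 hμ)).sub
      (((hasDerivAt_thetaNum a 0 hμ).const_mul (thetaConst a μ)).mul hdt)
    refine h.congr_deriv ?_
    rw [thetaConst_mul_thetaNum_zero hμ, hn0, ht0, theta1_zero]; ring
  have h1 := tendsto_sub_div_of_hasDerivAt (hasDerivAt_theta1 0 hμ) (theta1_zero μ)
    (neg_ne_zero.2 (thetaD_one_zero_ne_zero hμ))
  have h2 := (tendsto_div_of_hasDerivAt hdN hN0).mul (h1.mul h1)
  rw [zero_mul] at h2
  refine h2.congr' ?_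
  filter_upwards [self_mem_nhdsWithin, eventually_not_inLattice hμ 0 0] with z hz0 hz
  have hz0' : z ≠ 0 := hz0
  have hz' : ¬ InLattice μ z := by simpa using hz
  have h3 := theta1_ne_zero hμ hz'
  rw [hw hz', sub_zero]
  field_simp

end

/-! ### Algebra of `2 × 2` matrices -/

lemma mat2_ext {M M' : Mat2} (h00 : M 0 0 = M' 0 0) (h01 : M 0 1 = M' 0 1) (h10 : M 1 0 = M' 1 0)
    (h11 : M 1 1 = M' 1 1) : M = M' := by
  ext r c
  fin_cases r <;> fin_cases c <;> assumption

lemma twistSum_add_right (M : Mat2) (s s' : Fin 3 → ℂ) :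
    twistSum M (fun a => s a + s' a) = twistSum M s + twistSum M s' := by
  simp only [twistSum, mul_add, add_smul, Finset.sum_add_distrib]

lemma twistSum_smul_right (c : ℂ) (M : Mat2) (s : Fin 3 → ℂ) :
    twistSum M (fun a => c * s a) = c • twistSum M s := by
  simp only [twistSum, Finset.smul_sum, smul_smul]
  refine Finset.sum_congr rfl fun a _ => ?_
  congr 1; ring

lemma twistSum_zero_right (M : Mat2) : twistSum M (fun _ => 0) = 0 := by simp [twistSum]

lemma twistSum_one {M : Mat2} (hM : M.trace = 0) : twistSum M (fun _ => 1) = M := by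
  simpa [twistSum] using sum_coord_smul_pauli M hM

lemma trace_pauli (a : Fin 3) : (pauli a).trace = 0 := by
  fin_cases a <;> simp [pauli, Matrix.trace_fin_two]

lemma trace_twistSum (M : Mat2) (s : Fin 3 → ℂ) : (twistSum M s).trace = 0 := by
  simp [twistSum, Matrix.trace_sum, Matrix.trace_smul, trace_pauli]

lemma pauli_mul_self (a : Fin 3) : pauli a * pauli a = 1 := by
  fin_cases a
  · exact mat2_ext (by simp [pauli]) (by simp [pauli]) (by simp [pauli]) (by simp [pauli])
  · exact mat2_ext (by simp [pauli]) (by simp [pauli]) (by simp [pauli]) (by simp [pauli])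
  · exact mat2_ext (by simp [pauli]) (by simp [pauli]) (by simp [pauli]) (by simp [pauli])

lemma det_pauli (a : Fin 3) : (pauli a).det = -1 := by
  fin_cases a <;> simp [pauli, Matrix.det_fin_two]

lemma pauli_conj_two (a : Fin 3) : pauli 2 * pauli a * pauli 2 = signOne a • pauli a := by
  fin_cases a
  all_goals
    exact mat2_ext (by simp [pauli, signOne]) (by simp [pauli, signOne]) (by simp [pauli, signOne])
      (by simp [pauli, signOne])

lemma pauli_conj_zero (a : Fin 3) : pauli 0 * pauli a * pauli 0 = signModule a • pauli a := by
  fin_cases a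
  all_goals
    exact mat2_ext (by simp [pauli, signModule]) (by simp [pauli, signModule])
      (by simp [pauli, signModule]) (by simp [pauli, signModule])

lemma pauli_conj_sum {b : Fin 3} {ε : Fin 3 → ℂ}
    (hε : ∀ a, pauli b * pauli a * pauli b = ε a • pauli a) (x : Fin 3 → ℂ) :
    pauli b * (∑ a, x a • pauli a) * pauli b = ∑ a, (ε a * x a) • pauli a := by
  rw [Finset.mul_sum, Finset.sum_mul]
  refine Finset.sum_congr rfl fun a _ => ?_
  rw [Matrix.mul_smul, Matrix.smul_mul, hε, smul_smul, mul_comm]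

lemma twistSum_conj {b : Fin 3} {ε : Fin 3 → ℂ}
    (hε : ∀ a, pauli b * pauli a * pauli b = ε a • pauli a) (M : Mat2) (s : Fin 3 → ℂ) :
    twistSum M (fun a => ε a * s a) = pauli b * twistSum M s * pauli b := by
  rw [twistSum, twistSum, pauli_conj_sum hε]
  refine Finset.sum_congr rfl fun a _ => ?_
  congr 1; ring

/-- The components of a conjugated matrix are multiplied by signs. -/
lemma coord_conj {b : Fin 3} {ε : Fin 3 → ℂ}
    (hε : ∀ a, pauli b * pauli a * pauli b = ε a • pauli a) (M : Mat2) (a : Fin 3) :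
    coord (pauli b * M * pauli b) a = ε a * coord M a := by
  have h : pauli b * (pauli a * pauli b) = ε a • pauli a := by rw [← mul_assoc, hε]
  rw [coord, coord, ← mul_assoc, Matrix.trace_mul_comm, ← mul_assoc, ← mul_assoc,
    hε, Matrix.smul_mul, Matrix.trace_smul, smul_eq_mul, mul_div_assoc]

lemma eq_zero_of_coord {M : Mat2} (hM : M.trace = 0) (h : ∀ a, coord M a = 0) : M = 0 := by
  rw [← sum_coord_smul_pauli M hM]
  simp [h]

lemma mul_adjugate_self (H : Mat2) : H * H.adjugate = H.det • (1 : Mat2) := Matrix.mul_adjugate H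
lemma adjugate_mul_self (H : Mat2) : H.adjugate * H = H.det • (1 : Mat2) := Matrix.adjugate_mul H

lemma adjugate_add (M M' : Mat2) : (M + M').adjugate = M.adjugate + M'.adjugate := by
  simp only [Matrix.adjugate_fin_two]
  exact mat2_ext (by simp) (by simp [add_comm]) (by simp [add_comm]) (by simp)

lemma adjugate_smul' (c : ℂ) (M : Mat2) : (c • M).adjugate = c • M.adjugate := by
  simp only [Matrix.adjugate_fin_two]
  exact mat2_ext (by simp) (by simp) (by simp) (by simp)

lemma adjugate_of_trace_eq_zero {M : Mat2} (h : M.trace = 0) : M.adjugate = -M := by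
  rw [Matrix.trace_fin_two] at h
  simp only [Matrix.adjugate_fin_two]
  exact mat2_ext (by simp; linear_combination h) (by simp) (by simp) (by simp; linear_combination h)

lemma trace_mul_adjugate_self (H : Mat2) : (H * H.adjugate).trace = 2 * H.det := by
  rw [mul_adjugate_self, Matrix.trace_smul, Matrix.trace_one]; simp [mul_comm]

/-- The traceless part of a matrix. -/
def tracefree (M : Mat2) : Mat2 := M - (M.trace / 2) • (1 : Mat2)

lemma trace_tracefree (M : Mat2) : (tracefree M).trace = 0 := by
  simp [tracefree, Matrix.trace_sub, Matrix.trace_smul, Matrix.trace_one]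

lemma tracefree_add (M M' : Mat2) : tracefree (M + M') = tracefree M + tracefree M' := by
  simp only [tracefree, Matrix.trace_add, add_div, add_smul]; abel

lemma tracefree_smul (c : ℂ) (M : Mat2) : tracefree (c • M) = c • tracefree M := by
  simp only [tracefree, Matrix.trace_smul, smul_sub, smul_smul, smul_eq_mul, mul_div_assoc]

lemma tracefree_one_smul (c : ℂ) : tracefree (c • (1 : Mat2)) = 0 := by
  simp [tracefree, Matrix.trace_smul, Matrix.trace_one]

/-- The traceless part of `X H⁻¹`. If `X` is the derivative of a function with values in
`GL(2, ℂ)` through `H`, this is the logarithmic derivative of the function normalized to have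
determinant one. -/
def gauge (H X : Mat2) : Mat2 := H.det⁻¹ • tracefree (X * H.adjugate)

lemma gauge_add (H X Y : Mat2) : gauge H (X + Y) = gauge H X + gauge H Y := by
  simp only [gauge, add_mul, tracefree_add, smul_add]

lemma gauge_smul (H X : Mat2) (c : ℂ) : gauge H (c • X) = c • gauge H X := by
  simp only [gauge, Matrix.smul_mul, tracefree_smul, smul_comm c]

lemma gauge_self (H : Mat2) : gauge H H = 0 := by
  rw [gauge, mul_adjugate_self, tracefree_one_smul, smul_zero]

lemma trace_gauge (H X : Mat2) : (gauge H X).trace = 0 := by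
  rw [gauge, Matrix.trace_smul, trace_tracefree, smul_zero]

lemma gauge_mul_self {H : Mat2} (hH : H.det ≠ 0) (X : Mat2) :
    gauge H X * H = X - ((X * H.adjugate).trace / (2 * H.det)) • H := by
  rw [gauge, tracefree, smul_sub, sub_mul, Matrix.smul_mul, mul_assoc, adjugate_mul_self,
    Matrix.mul_smul, mul_one, smul_smul, inv_mul_cancel₀ hH, one_smul, smul_smul, Matrix.smul_mul,
    one_mul]
  congr 2
  field_simp

/-- For traceless `Ω`, the matrix `gauge H (H Ω)` is the conjugate `H Ω H⁻¹`. -/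
lemma gauge_mul_mul_self {H Ω : Mat2} (hH : H.det ≠ 0) (hΩ : Ω.trace = 0) :
    gauge H (H * Ω) * H = H * Ω := by
  have h : (H * Ω * H.adjugate).trace = 0 := by
    rw [Matrix.trace_mul_comm, ← mul_assoc, adjugate_mul_self, Matrix.smul_mul, one_mul,
      Matrix.trace_smul, hΩ, smul_zero]
  rw [gauge_mul_self hH, h, zero_div, zero_smul, sub_zero]

/-- Conjugation of both arguments by a Pauli matrix; a common scalar factor cancels. -/
lemma gauge_conj (b : Fin 3) {c : ℂ} (hc : c ≠ 0) (H X : Mat2) :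
    gauge (c • (pauli b * H * pauli b)) (c • (pauli b * X * pauli b)) =
      pauli b * gauge H X * pauli b := by
  have hadj : (pauli b).adjugate = -pauli b := adjugate_of_trace_eq_zero (trace_pauli b)
  have h1 : (pauli b * H * pauli b).adjugate = pauli b * H.adjugate * pauli b := by
    rw [Matrix.adjugate_mul_distrib, Matrix.adjugate_mul_distrib, hadj]
    simp [mul_assoc]
  have h2 : (c • (pauli b * H * pauli b)).det = c ^ 2 * H.det := by
    rw [Matrix.det_smul, Matrix.det_mul, Matrix.det_mul, det_pauli]; simp
  have h3 : pauli b * X * pauli b * (pauli b * H.adjugate * pauli b) =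
      pauli b * (X * H.adjugate) * pauli b := by
    calc _ = pauli b * X * (pauli b * pauli b) * H.adjugate * pauli b := by noncomm_ring
      _ = _ := by rw [pauli_mul_self]; noncomm_ring
  have h4 (M : Mat2) : tracefree (pauli b * M * pauli b) = pauli b * tracefree M * pauli b := by
    have : (pauli b * M * pauli b).trace = M.trace := by
      rw [Matrix.trace_mul_comm, ← mul_assoc, pauli_mul_self, one_mul]
    rw [tracefree, tracefree, this, mul_sub, sub_mul, Matrix.mul_smul, mul_one, Matrix.smul_mul,
      pauli_mul_self]
  rw [gauge, gauge, h2, adjugate_smul', h1, Matrix.smul_mul, Matrix.mul_smul, smul_smul, h3,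
    tracefree_smul, h4, smul_smul, Matrix.mul_smul, Matrix.smul_mul]
  congr 1
  field_simp

/-! ### Differentiation of matrix functions -/

section Calculus

variable {E : Type*} [NormedAddCommGroup E] [NormedSpace ℂ E]

/-- The matrix function `Φ` is (complex) differentiable at `x`, entry by entry, with directional
derivatives `D u`. -/
def HasMatDeriv (Φ : E → Mat2) (D : E → Mat2) (x : E) : Prop :=
  ∃ L : Fin 2 → Fin 2 → (E →L[ℂ] ℂ), (∀ r c, HasFDerivAt (fun y => Φ y r c) (L r c) x) ∧
    ∀ u, evalForms L u = D u

variable {Φ Φ' : E → Mat2} {D D' : E → Mat2} {x : E}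

lemma HasMatDeriv.congr_deriv (h : HasMatDeriv Φ D x) (h' : ∀ u, D u = D' u) :
    HasMatDeriv Φ D' x := by
  obtain ⟨L, hL, hD⟩ := h
  exact ⟨L, hL, fun u => (hD u).trans (h' u)⟩

lemma HasMatDeriv.congr_of_eventuallyEq (h : HasMatDeriv Φ D x) (h' : Φ' =ᶠ[𝓝 x] Φ) :
    HasMatDeriv Φ' D x := by
  obtain ⟨L, hL, hD⟩ := h
  exact ⟨L, fun r c => (hL r c).congr_of_eventuallyEq (h'.mono fun y hy => by simp only [hy]), hD⟩

lemma HasMatDeriv.unique (h : HasMatDeriv Φ D x) (h' : HasMatDeriv Φ D' x) (u : E) :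
    D u = D' u := by
  obtain ⟨L, hL, hD⟩ := h
  obtain ⟨L', hL', hD'⟩ := h'
  rw [← hD, ← hD']
  ext r c
  simp only [evalForms, Matrix.of_apply, (hL r c).unique (hL' r c)]

lemma HasMatDeriv.continuousAt (h : HasMatDeriv Φ D x) : ContinuousAt Φ x := by
  obtain ⟨L, hL, -⟩ := h
  exact continuousAt_pi.2 fun r => continuousAt_pi.2 fun c => (hL r c).continuousAt

lemma HasMatDeriv.map_add (h : HasMatDeriv Φ D x) (u v : E) : D (u + v) = D u + D v := by
  obtain ⟨L, -, hD⟩ := h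
  rw [← hD, ← hD, ← hD]
  ext r c
  simp [evalForms]

lemma HasMatDeriv.map_smul (h : HasMatDeriv Φ D x) (a : ℂ) (u : E) : D (a • u) = a • D u := by
  obtain ⟨L, -, hD⟩ := h
  rw [← hD, ← hD]
  ext r c
  simp [evalForms]

lemma hasMatDeriv_const (M : Mat2) (x : E) : HasMatDeriv (fun _ => M) (fun _ => 0) x :=
  ⟨fun _ _ => 0, fun r c => hasFDerivAt_const (M r c) x, fun u => by ext r c; simp [evalForms]⟩

lemma HasMatDeriv.add (h : HasMatDeriv Φ D x) (h' : HasMatDeriv Φ' D' x) :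
    HasMatDeriv (fun y => Φ y + Φ' y) (fun u => D u + D' u) x := by
  obtain ⟨L, hL, hD⟩ := h
  obtain ⟨L', hL', hD'⟩ := h'
  exact ⟨fun r c => L r c + L' r c, fun r c => (hL r c).add (hL' r c), fun u => by
    dsimp only; rw [← hD, ← hD']; ext r c; simp [evalForms]⟩

lemma HasMatDeriv.neg (h : HasMatDeriv Φ D x) :
    HasMatDeriv (fun y => -Φ y) (fun u => -D u) x := by
  obtain ⟨L, hL, hD⟩ := h
  exact ⟨fun r c => -L r c, fun r c => (hL r c).neg, fun u => by
    dsimp only; rw [← hD]; ext r c; simp [evalForms]⟩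

lemma HasMatDeriv.sub (h : HasMatDeriv Φ D x) (h' : HasMatDeriv Φ' D' x) :
    HasMatDeriv (fun y => Φ y - Φ' y) (fun u => D u - D' u) x := by
  simpa only [sub_eq_add_neg] using h.add h'.neg

lemma HasMatDeriv.sum {ι : Type*} (s : Finset ι) {Φ D : ι → E → Mat2}
    (h : ∀ i ∈ s, HasMatDeriv (Φ i) (D i) x) :
    HasMatDeriv (fun y => ∑ i ∈ s, Φ i y) (fun u => ∑ i ∈ s, D i u) x := by
  classical
  induction s using Finset.induction_on with
  | empty => simpa using hasMatDeriv_const (0 : Mat2) x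
  | insert i s hi ih =>
    simp only [Finset.sum_insert hi]
    exact (h i (Finset.mem_insert_self i s)).add
      (ih fun j hj => h j (Finset.mem_insert_of_mem hj))

lemma HasMatDeriv.mul (h : HasMatDeriv Φ D x) (h' : HasMatDeriv Φ' D' x) :
    HasMatDeriv (fun y => Φ y * Φ' y) (fun u => D u * Φ' x + Φ x * D' u) x := by
  obtain ⟨L, hL, hD⟩ := h
  obtain ⟨L', hL', hD'⟩ := h'
  refine ⟨fun r c => ∑ i, (Φ x r i • L' i c + Φ' x i c • L r i), fun r c => ?_, fun u => ?_⟩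
  · simp only [Matrix.mul_apply]
    exact HasFDerivAt.fun_sum fun i _ => (hL r i).mul (hL' i c)
  · dsimp only
    rw [← hD, ← hD']
    ext r c
    simp [evalForms, Matrix.mul_apply, Matrix.add_apply]
    ring

lemma HasMatDeriv.smul {f : E → ℂ} {f' : E →L[ℂ] ℂ} (hf : HasFDerivAt f f' x)
    (h : HasMatDeriv Φ D x) :
    HasMatDeriv (fun y => f y • Φ y) (fun u => f' u • Φ x + f x • D u) x := by
  obtain ⟨L, hL, hD⟩ := h
  refine ⟨fun r c => f x • L r c + Φ x r c • f', fun r c => hf.mul (hL r c), fun u => ?_⟩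
  dsimp only
  rw [← hD]
  ext r c
  simp [evalForms]
  ring

lemma HasMatDeriv.const_mul (M : Mat2) (h : HasMatDeriv Φ D x) :
    HasMatDeriv (fun y => M * Φ y) (fun u => M * D u) x :=
  ((hasMatDeriv_const M x).mul h).congr_deriv fun u => by simp

lemma HasMatDeriv.mul_const (h : HasMatDeriv Φ D x) (M : Mat2) :
    HasMatDeriv (fun y => Φ y * M) (fun u => D u * M) x :=
  (h.mul (hasMatDeriv_const M x)).congr_deriv fun u => by simp

lemma HasMatDeriv.const_smul (a : ℂ) (h : HasMatDeriv Φ D x) :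
    HasMatDeriv (fun y => a • Φ y) (fun u => a • D u) x :=
  (HasMatDeriv.smul (hasFDerivAt_const a x) h).congr_deriv fun u => by simp

lemma hasMatDeriv_smul_const {f : E → ℂ} {f' : E →L[ℂ] ℂ} (hf : HasFDerivAt f f' x) (M : Mat2) :
    HasMatDeriv (fun y => f y • M) (fun u => f' u • M) x :=
  (HasMatDeriv.smul hf (hasMatDeriv_const M x)).congr_deriv fun u => by simp

lemma HasMatDeriv.comp {E' : Type*} [NormedAddCommGroup E'] [NormedSpace ℂ E'] {g : E' → E}
    {g' : E' →L[ℂ] E} (y : E') (h : HasMatDeriv Φ D (g y)) (hg : HasFDerivAt g g' y) :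
    HasMatDeriv (fun z => Φ (g z)) (fun u => D (g' u)) y := by
  obtain ⟨L, hL, hD⟩ := h
  exact ⟨fun r c => (L r c).comp g', fun r c => HasFDerivAt.comp y (hL r c) hg,
    fun u => by dsimp only; rw [← hD]; rfl⟩

lemma HasMatDeriv.adjugate (h : HasMatDeriv Φ D x) :
    HasMatDeriv (fun y => (Φ y).adjugate) (fun u => (D u).adjugate) x := by
  obtain ⟨L, hL, hD⟩ := h
  refine ⟨![![L 1 1, -L 0 1], ![-L 1 0, L 0 0]], fun r c => ?_, fun u => ?_⟩
  · simp only [Matrix.adjugate_fin_two]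
    fin_cases r <;> fin_cases c
    · exact hL 1 1
    · exact (hL 0 1).neg
    · exact (hL 1 0).neg
    · exact hL 0 0
  · dsimp only
    rw [← hD]
    simp only [Matrix.adjugate_fin_two]
    exact mat2_ext (by simp [evalForms]) (by simp [evalForms]) (by simp [evalForms])
      (by simp [evalForms])

lemma HasMatDeriv.hasFDerivAt_trace (h : HasMatDeriv Φ D x) :
    ∃ L : E →L[ℂ] ℂ, HasFDerivAt (fun y => (Φ y).trace) L x ∧ ∀ u, L u = (D u).trace := by
  obtain ⟨L, hL, hD⟩ := h
  refine ⟨L 0 0 + L 1 1, ?_, fun u => ?_⟩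
  · simp only [Matrix.trace_fin_two]; exact (hL 0 0).add (hL 1 1)
  · rw [← hD]; simp [Matrix.trace_fin_two, evalForms]

lemma HasMatDeriv.hasFDerivAt_coord (h : HasMatDeriv Φ D x) (a : Fin 3) :
    ∃ L : E →L[ℂ] ℂ, HasFDerivAt (fun y => coord (Φ y) a) L x ∧ ∀ u, L u = coord (D u) a := by
  obtain ⟨L, hL, hD⟩ := (h.const_mul (pauli a)).hasFDerivAt_trace
  refine ⟨(2 : ℂ)⁻¹ • L, ?_, fun u => ?_⟩
  · simp only [coord, div_eq_inv_mul]; exact hL.const_mul _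
  · simp [coord, hD]; ring

/-- Jacobi's formula for the derivative of the determinant. -/
lemma HasMatDeriv.hasFDerivAt_det (h : HasMatDeriv Φ D x) :
    ∃ L : E →L[ℂ] ℂ, HasFDerivAt (fun y => (Φ y).det) L x ∧
      ∀ u, L u = (D u * (Φ x).adjugate).trace := by
  obtain ⟨L, hL, hD⟩ := (h.mul h.adjugate).hasFDerivAt_trace
  refine ⟨(2 : ℂ)⁻¹ • L, ?_, fun u => ?_⟩
  · have : (fun y => (Φ y).det) = fun y => (2 : ℂ)⁻¹ * (Φ y * (Φ y).adjugate).trace := by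
      funext y; rw [trace_mul_adjugate_self]; ring
    rw [this]
    exact hL.const_mul _
  · simp only [smul_apply, hD, smul_eq_mul]
    simp [Matrix.adjugate_fin_two, Matrix.trace_fin_two, Matrix.mul_apply]
    ring

lemma HasMatDeriv.twist {s : Fin 3 → E → ℂ} {s' : Fin 3 → (E →L[ℂ] ℂ)}
    (h : HasMatDeriv Φ D x) (hs : ∀ a, HasFDerivAt (s a) (s' a) x) :
    HasMatDeriv (fun y => twistSum (Φ y) fun a => s a y)
      (fun u => twistSum (D u) (fun a => s a x) + twistSum (Φ x) fun a => s' a u) x := by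
  choose L hL hD using h.hasFDerivAt_coord
  have h1 (a : Fin 3) : HasMatDeriv (fun y => (coord (Φ y) a * s a y) • pauli a)
      (fun u => (coord (Φ x) a • s' a + s a x • L a) u • pauli a) x :=
    hasMatDeriv_smul_const ((hL a).mul (hs a)) (pauli a)
  refine (HasMatDeriv.sum Finset.univ fun a _ => h1 a).congr_deriv fun u => ?_
  simp only [twistSum]
  rw [← Finset.sum_add_distrib]
  refine Finset.sum_congr rfl fun a _ => ?_
  rw [← add_smul]
  congr 1
  simp [hD]; ring

/-- The difference quotients in one variable converge. -/
lemma HasMatDeriv.tendsto_slope {Φ D : ℂ → Mat2} {z : ℂ} (h : HasMatDeriv Φ D z) :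
    Tendsto (fun u => (u - z)⁻¹ • (Φ u - Φ z)) (𝓝[≠] z) (𝓝 (D 1)) := by
  obtain ⟨L, hL, hD⟩ := h
  rw [← hD]
  refine tendsto_pi_nhds.2 fun r => tendsto_pi_nhds.2 fun c => ?_
  refine (hasDerivAt_iff_tendsto_slope.1 (hL r c).hasDerivAt).congr fun u => ?_
  simp [slope]

lemma HasMatDeriv.eq_of_zero {U : Set E} (hU : Convex ℝ U) (hUo : IsOpen U)
    (h : ∀ y ∈ U, HasMatDeriv Φ (fun _ => 0) y) {y y' : E} (hy : y ∈ U) (hy' : y' ∈ U) :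
    Φ y = Φ y' := by
  ext r c
  have hz (y : E) (hy : y ∈ U) : HasFDerivAt (fun y => Φ y r c) (0 : E →L[ℂ] ℂ) y := by
    obtain ⟨L, hL, hD⟩ := h y hy
    have : L r c = 0 := by
      ext u
      have := congrFun (congrFun (hD u) r) c
      simpa [evalForms] using this
    rw [← this]; exact hL r c
  exact hUo.is_const_of_fderiv_eq_zero (𝕜 := ℂ) hU.isPreconnected
    (fun y hy => (hz y hy).differentiableAt.differentiableWithinAt)
    (fun y hy => (hz y hy).fderiv) hy hy'

/-- Symmetry of the second derivative: a solution `Φ` of `dΦ = Ω Φ` with values in invertible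
matrices forces the curvature of `Ω` to vanish. -/
lemma zero_curvature {Ω : E → E → Mat2} {x u v : E} {Du Dv : E → Mat2} {M : Mat2}
    (hΦ : ∀ᶠ y in 𝓝 x, HasMatDeriv Φ (fun w => Ω y w * Φ y) y) (hM : Φ x * M = 1)
    (hu : HasMatDeriv (fun y => Ω y u) Du x) (hv : HasMatDeriv (fun y => Ω y v) Dv x) :
    Du v - Dv u = Ω x v * Ω x u - Ω x u * Ω x v := by
  -- restriction to the plane spanned by `u` and `v`
  set γ : ℂ × ℂ → E := fun s => x + (s.1 • u + s.2 • v) with hγ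
  set γ' : ℂ × ℂ →L[ℂ] E := (ContinuousLinearMap.fst ℂ ℂ ℂ).smulRight u +
    (ContinuousLinearMap.snd ℂ ℂ ℂ).smulRight v with hγ'
  have hγd (s : ℂ × ℂ) : HasFDerivAt γ γ' s :=
    (((hasFDerivAt_fst (𝕜 := ℂ) (p := s)).smul_const u).add
      ((hasFDerivAt_snd (𝕜 := ℂ) (p := s)).smul_const v)).const_add x
  have hγ0 : γ 0 = x := by simp [hγ]
  have hΦx := hΦ.self_of_nhds
  have hev : ∀ᶠ s in 𝓝 (0 : ℂ × ℂ), HasMatDeriv Φ (fun w => Ω (γ s) w * Φ (γ s)) (γ s) := by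
    have : Tendsto γ (𝓝 0) (𝓝 x) := by
      have := (hγd 0).continuousAt.tendsto
      rwa [hγ0] at this
    exact this.eventually hΦ
  have key : (Du v * Φ x + Ω x u * (Ω x v * Φ x)) = (Dv u * Φ x + Ω x v * (Ω x u * Φ x)) := by
    have hPu := hu.mul hΦx
    have hPv := hv.mul hΦx
    rw [← hγ0] at hPu hPv
    obtain ⟨Lu, hLu, hDu⟩ := hPu.comp 0 (hγd 0)
    obtain ⟨Lv, hLv, hDv⟩ := hPv.comp 0 (hγd 0)
    ext r c
    set f : ℂ × ℂ → ℂ := fun s => Φ (γ s) r c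
    set f' : ℂ × ℂ → (ℂ × ℂ →L[ℂ] ℂ) := fun s =>
      ((Ω (γ s) u * Φ (γ s)) r c) • ContinuousLinearMap.fst ℂ ℂ ℂ +
      ((Ω (γ s) v * Φ (γ s)) r c) • ContinuousLinearMap.snd ℂ ℂ ℂ with hf'
    have hf : ∀ᶠ s in 𝓝 (0 : ℂ × ℂ), HasFDerivAt f (f' s) s := by
      filter_upwards [hev] with s hs
      obtain ⟨L, hL, hD⟩ := hs.comp s (hγd s)
      refine (hL r c).congr_fderiv ?_
      ext
      · have := congrFun (congrFun (hD (1, 0)) r) c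
        simpa [evalForms, hγ', hf'] using this
      · have := congrFun (congrFun (hD (0, 1)) r) c
        simpa [evalForms, hγ', hf'] using this
    have hf'' : HasFDerivAt f' ((Lu r c).smulRight (ContinuousLinearMap.fst ℂ ℂ ℂ) +
        (Lv r c).smulRight (ContinuousLinearMap.snd ℂ ℂ ℂ)) 0 := by
      have h1 := (hLu r c).smul_const (ContinuousLinearMap.fst ℂ ℂ ℂ)
      have h2 := (hLv r c).smul_const (ContinuousLinearMap.snd ℂ ℂ ℂ)
      exact h1.add h2
    have hsymm := second_derivative_symmetric_of_eventually hf hf'' (0, 1) (1, 0)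
    have e1 := congrFun (congrFun (hDu (0, 1)) r) c
    have e2 := congrFun (congrFun (hDv (1, 0)) r) c
    simp [hγ'] at e1 e2 hsymm
    simp only [evalForms, Matrix.of_apply] at e1 e2
    rw [e1, e2] at hsymm
    simpa [hγ0] using hsymm
  have key2 := congrArg (· * M) key
  simp only [add_mul, mul_assoc, hM, mul_one] at key2
  rw [sub_eq_sub_iff_add_eq_add, key2]
  abel

end Calculus

/-! ### Square roots -/

/-- A nowhere vanishing continuous function on a simply connected space has a continuous square
root. -/
theorem exists_continuous_sqrt {Y : Type*} [TopologicalSpace Y] [SimplyConnectedSpace Y]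
    [LocallyPathConnectedSpace Y] {f : Y → ℂ} (hf : Continuous f) (h0 : ∀ y, f y ≠ 0) :
    ∃ s : Y → ℂ, Continuous s ∧ ∀ y, s y ^ 2 = f y := by
  obtain ⟨y₀⟩ : Nonempty Y := inferInstance
  obtain ⟨F, ⟨-, hF⟩, -⟩ := Complex.isCoveringMapOn_exp.existsUnique_continuousMap_lifts
    (⟨f, hf⟩ : C(Y, ℂ)) (a₀ := y₀) (e₀ := Complex.log (f y₀)) (Complex.exp_log (h0 y₀))
    (fun y => h0 y)
  refine ⟨fun y => Complex.exp (F y / 2), by fun_prop, fun y => ?_⟩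
  rw [← Complex.exp_nat_mul]
  have := congrFun hF y
  simp only [Function.comp, ContinuousMap.coe_mk] at this
  rw [← this]
  congr 1; push_cast; ring

/-- Two continuous functions on a connected space with the same square agree up to a sign. -/
lemma sign_of_sq_eq_sq {Y : Type*} [TopologicalSpace Y] [PreconnectedSpace Y] {s s' : Y → ℂ}
    (hs : Continuous s) (hs' : Continuous s') (h0 : ∀ y, s' y ≠ 0)
    (h : ∀ y, s y ^ 2 = s' y ^ 2) : (∀ y, s y = s' y) ∨ ∀ y, s y = -s' y := by
  have hsq := isPreconnected_univ.eq_or_eq_neg_of_sq_eq (f := s) (g := s') (𝕜 := ℂ)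
    hs.continuousOn hs'.continuousOn (fun y _ => h y) (fun {y} _ => h0 y)
  rcases hsq with h1 | h1
  · exact Or.inl fun y => h1 (Set.mem_univ y)
  · exact Or.inr fun y => h1 (Set.mem_univ y)

/-- A continuous square root of a differentiable function is differentiable. -/
lemma hasFDerivAt_of_sq_eq {E : Type*} [NormedAddCommGroup E] [NormedSpace ℂ E] {s f : E → ℂ}
    {f' : E →L[ℂ] ℂ} {x : E} (hs : ContinuousAt s x) (hsq : ∀ᶠ y in 𝓝 x, s y ^ 2 = f y)
    (hf : HasFDerivAt f f' x) (h0 : s x ≠ 0) : HasFDerivAt s ((2 * s x)⁻¹ • f') x := by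
  have hfx : s x ^ 2 = f x := hsq.self_of_nhds
  have hfx0 : f x ≠ 0 := by rw [← hfx]; exact pow_ne_zero 2 h0
  set h : E → ℂ := fun y => s x * Complex.exp (Complex.log (f y * (f x)⁻¹) * 2⁻¹) with hh
  have hd : HasFDerivAt h ((2 * s x)⁻¹ • f') x := by
    have h1 : HasFDerivAt (fun y => f y * (f x)⁻¹) ((f x)⁻¹ • f') x := hf.mul_const _
    have h2 := h1.clog (by simp [hfx0])
    refine ((h2.mul_const (2 : ℂ)⁻¹).cexp.const_mul (s x)).congr_fderiv ?_
    ext u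
    simp [← hfx]
    field_simp
    simp
  have hne : ∀ᶠ y in 𝓝 x, s y + h y ≠ 0 := by
    refine (hs.add hd.continuousAt).eventually_ne ?_
    change s x + h x ≠ 0
    simp only [hh, mul_inv_cancel₀ hfx0, Complex.log_one, zero_mul, Complex.exp_zero, mul_one]
    rw [← two_mul]
    exact mul_ne_zero two_ne_zero h0
  refine hd.congr_of_eventuallyEq ?_
  filter_upwards [hne, hsq, hf.continuousAt.eventually_ne hfx0] with y hy1 hy2 hy3
  have h3 : h y ^ 2 = f y := by
    simp only [hh]
    rw [mul_pow, ← Complex.exp_nat_mul, hfx]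
    rw [show ((2 : ℕ) : ℂ) * (Complex.log (f y * (f x)⁻¹) * 2⁻¹) = Complex.log (f y * (f x)⁻¹) by
      push_cast; ring, Complex.exp_log (mul_ne_zero hy3 (inv_ne_zero hfx0))]
    field_simp
  have h4 : (s y - h y) * (s y + h y) = 0 := by
    rw [← hy2] at h3
    linear_combination -h3
  exact sub_eq_zero.1 ((mul_eq_zero.1 h4).resolve_right hy1)

/-! ### Multivalued functions on the covering -/

section Cover

variable {N : ℕ} {D : Set (Param N)}

lemma isOpen_puncturedSpace (hDo : IsOpen D) (hD : D ⊆ configSpace N) :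
    IsOpen (puncturedSpace D) := by
  have h : puncturedSpace D = {q : Total N | q.2 ∈ D} ∩
      ⋂ j, (fun q : Total N => ((q.1 - q.2.1 j, q.2.2) : ℂ × ℂ)) ⁻¹'
        {x : ℂ × ℂ | 0 < x.2.im ∧ ¬ InLattice x.2 x.1} := by
    ext q
    simp only [puncturedSpace, Set.mem_inter_iff, Set.mem_iInter, Set.mem_preimage]
    exact and_congr_right fun hq => forall_congr' fun j =>
      ⟨fun h => ⟨(hD hq).1, h⟩, fun h => h.2⟩
  rw [h]
  refine (hDo.preimage continuous_snd).inter (isOpen_iInter_of_finite fun j => ?_)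
  exact isOpen_lattice_compl.preimage (by fun_prop)

variable {X : Type*} [TopologicalSpace X]

/-- The projection of the covering space to the space of all variables. -/
def proj (π : X → puncturedSpace D) (x : X) : Total N := (π x).1

lemma isLocalHomeomorph_proj (hDo : IsOpen D) (hD : D ⊆ configSpace N) {π : X → puncturedSpace D}
    (hπ : IsCoveringMap π) : IsLocalHomeomorph (proj π) :=
  (isOpen_puncturedSpace hDo hD).isOpenEmbedding_subtypeVal.isLocalHomeomorph.comp
    hπ.isLocalHomeomorph

lemma locallyPathConnectedSpace_of_isLocalHomeomorph {Y : Type*} [TopologicalSpace Y]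
    [LocallyPathConnectedSpace Y] {f : X → Y} (hf : IsLocalHomeomorph f) :
    LocallyPathConnectedSpace X := by
  choose φ hφ using hf
  let _ : ChartedSpace Y X :=
    { atlas := Set.range φ
      chartAt := φ
      mem_chart_source := fun x => (hφ x).1
      chart_mem_atlas := fun x => Set.mem_range_self x }
  exact ChartedSpace.locallyPathConnectedSpace Y X

/-- The multivalued function `Φ` is (complex) differentiable at `x`, with directional derivatives
`Δ u`. -/
def HasCoverMatDeriv (π : X → puncturedSpace D) (Φ : X → Mat2) (Δ : Total N → Mat2)
    (x : X) : Prop :=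
  ∃ L : Fin 2 → Fin 2 → (Total N →L[ℂ] ℂ), HasCoverDeriv π Φ L x ∧ ∀ u, evalForms L u = Δ u

/-- The derivative of a multivalued function is the derivative of its branches. -/
lemma hasCoverMatDeriv_iff {π : X → puncturedSpace D} (φ : OpenPartialHomeomorph X (Total N))
    (hφ : proj π = φ) {Φ : X → Mat2} {Δ : Total N → Mat2} {x : X} (hx : x ∈ φ.source) :
    HasCoverMatDeriv π Φ Δ x ↔ HasMatDeriv (fun q => Φ (φ.symm q)) Δ (proj π x) := by
  refine exists_congr fun L => and_congr_left fun _ =>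
    forall_congr' fun r => forall_congr' fun c => ?_
  rw [hasFDerivAt_iff_isLittleO, hφ, ← φ.map_nhds_eq hx, isLittleO_map]
  have hinv : ∀ y ∈ φ.source, φ.symm (π y).1 = y := fun y hy => by
    have := φ.left_inv hy
    rwa [← hφ] at this
  refine isLittleO_congr ?_ ?_
  · filter_upwards [φ.open_source.mem_nhds hx] with y hy
    simp only [Function.comp, ← hφ, proj, hinv y hy, hinv x hx]
  · filter_upwards with y
    simp only [Function.comp, ← hφ, proj]

variable {π : X → puncturedSpace D}

/-- Near every point of the covering, the projection has a local inverse. -/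
lemma exists_chart (hDo : IsOpen D) (hD : D ⊆ configSpace N) (hπ : IsCoveringMap π) (x : X) :
    ∃ φ : OpenPartialHomeomorph X (Total N), x ∈ φ.source ∧ proj π = φ :=
  isLocalHomeomorph_proj hDo hD hπ x

/-- A multivalued function with vanishing derivative is constant. -/
lemma eq_of_hasCoverMatDeriv_zero [PreconnectedSpace X] (hDo : IsOpen D) (hD : D ⊆ configSpace N)
    (hπ : IsCoveringMap π) {Φ : X → Mat2} (h : ∀ x, HasCoverMatDeriv π Φ (fun _ => 0) x) (x y : X) :
    Φ x = Φ y := by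
  have hloc : IsLocallyConstant Φ := by
    rw [IsLocallyConstant.iff_eventually_eq]
    intro x
    obtain ⟨φ, hx, hφ⟩ := exists_chart hDo hD hπ x
    obtain ⟨ε, hε, hb⟩ := Metric.isOpen_iff.1 φ.open_target (φ x) (φ.map_source hx)
    have hball : ∀ q ∈ Metric.ball (φ x) ε,
        HasMatDeriv (fun q => Φ (φ.symm q)) (fun _ => 0) q := fun q hq => by
      have h1 := (hasCoverMatDeriv_iff φ hφ (φ.map_target (hb hq))).1 (h (φ.symm q))
      rwa [hφ, φ.right_inv (hb hq)] at h1
    filter_upwards [φ.open_source.mem_nhds hx,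
      (φ.continuousAt hx).preimage_mem_nhds (Metric.ball_mem_nhds _ hε)] with y hy hy'
    have := HasMatDeriv.eq_of_zero (convex_ball _ _) Metric.isOpen_ball hball hy'
      (Metric.mem_ball_self hε)
    rwa [φ.left_inv hy, φ.left_inv hx] at this
  exact hloc.apply_eq_of_preconnectedSpace x y

/-! ### The connection form -/

lemma evalForms_add {V : Type*} [NormedAddCommGroup V] [NormedSpace ℂ V]
    (L : Fin 2 → Fin 2 → (V →L[ℂ] ℂ)) (u v : V) :
    evalForms L (u + v) = evalForms L u + evalForms L v := by
  ext r c; simp [evalForms]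

lemma evalForms_smul {V : Type*} [NormedAddCommGroup V] [NormedSpace ℂ V]
    (L : Fin 2 → Fin 2 → (V →L[ℂ] ℂ)) (a : ℂ) (v : V) :
    evalForms L (a • v) = a • evalForms L v := by
  ext r c; simp [evalForms]

lemma evalForms_sum {V ι : Type*} [NormedAddCommGroup V] [NormedSpace ℂ V]
    (L : Fin 2 → Fin 2 → (V →L[ℂ] ℂ)) (s : Finset ι) (f : ι → V) :
    evalForms L (∑ i ∈ s, f i) = ∑ i ∈ s, evalForms L (f i) := by
  ext r c; simp [evalForms, Matrix.sum_apply]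

lemma param_eq_sum (v : Param N) : v = ∑ i, v.1 i • dirPole i + v.2 • dirModule N := by
  refine Prod.ext ?_ ?_
  · ext j
    simp [dirPole, dirModule, Prod.fst_sum, Finset.sum_apply, Pi.single_apply]
  · simp [dirPole, dirModule, Prod.snd_sum]

lemma total_eq_sum (u : Total N) :
    u = u.1 • (1, 0) + ∑ i, u.2.1 i • (0, dirPole i) + u.2.2 • (0, dirModule N) := by
  refine Prod.ext ?_ ?_
  · simp [Prod.fst_sum]
  · simp only [Prod.snd_add, Prod.snd_sum, Prod.smul_mk, smul_zero, zero_add]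
    exact param_eq_sum u.2

/-- The matrix of the linear system at the point `q = (λ, p)` in the direction `u`: the system
says `dΦ(u) = conn A q u Φ`. -/
def conn (A : Fin N → Param N → Mat2) (q u : Total N) : Mat2 :=
  ∑ j, twistSum (A j q.2) fun a =>
    (u.1 - u.2.1 j) * w a (q.1 - q.2.1 j) q.2.2 + u.2.2 * Z a (q.1 - q.2.1 j) q.2.2

lemma conn_eq (A : Fin N → Param N → Mat2) (q u : Total N) :
    conn A q u = ∑ j, ((u.1 - u.2.1 j) • twistSum (A j q.2) (fun a => w a (q.1 - q.2.1 j) q.2.2) +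
      u.2.2 • twistSum (A j q.2) fun a => Z a (q.1 - q.2.1 j) q.2.2) := by
  refine Finset.sum_congr rfl fun j _ => ?_
  rw [twistSum_add_right, twistSum_smul_right, twistSum_smul_right]

lemma trace_conn (A : Fin N → Param N → Mat2) (q u : Total N) : (conn A q u).trace = 0 := by
  simp [conn, Matrix.trace_sum, trace_twistSum]

lemma conn_add (A : Fin N → Param N → Mat2) (q u v : Total N) :
    conn A q (u + v) = conn A q u + conn A q v := by
  simp only [conn_eq, ← Finset.sum_add_distrib]
  refine Finset.sum_congr rfl fun j _ => ?_
  simp only [Prod.fst_add, Prod.snd_add, Pi.add_apply]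
  module

lemma conn_smul (A : Fin N → Param N → Mat2) (q : Total N) (a : ℂ) (u : Total N) :
    conn A q (a • u) = a • conn A q u := by
  simp only [conn_eq, Finset.smul_sum]
  refine Finset.sum_congr rfl fun j _ => ?_
  simp only [Prod.smul_fst, Prod.smul_snd, Pi.smul_apply, smul_eq_mul]
  module

lemma conn_sum {ι : Type*} (A : Fin N → Param N → Mat2) (q : Total N) (s : Finset ι)
    (f : ι → Total N) : conn A q (∑ i ∈ s, f i) = ∑ i ∈ s, conn A q (f i) := by
  classical
  induction s using Finset.induction_on with
  | empty => simpa using conn_smul A q 0 0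
  | insert i s hi ih => rw [Finset.sum_insert hi, Finset.sum_insert hi, conn_add, ih]

lemma conn_lam (A : Fin N → Param N → Mat2) (q : Total N) :
    conn A q (1, 0) = ∑ j, twistSum (A j q.2) fun a => w a (q.1 - q.2.1 j) q.2.2 := by
  simp [conn]

lemma conn_dirPole (A : Fin N → Param N → Mat2) (q : Total N) (i : Fin N) :
    conn A q (0, dirPole i) = -twistSum (A i q.2) fun a => w a (q.1 - q.2.1 i) q.2.2 := by
  rw [conn_eq, Finset.sum_eq_single i]
  · simp [dirPole]
  · intro j _ hj
    simp [dirPole, hj]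
  · simp

lemma conn_dirModule (A : Fin N → Param N → Mat2) (q : Total N) :
    conn A q (0, dirModule N) = ∑ j, twistSum (A j q.2) fun a => Z a (q.1 - q.2.1 j) q.2.2 := by
  simp [conn, dirModule]

/-- The three equations of the linear system say that `dΦ = Ω Φ` for the form `Ω = conn A`. -/
theorem linearSystem_iff {A : Fin N → Param N → Mat2} {Φ : X → Mat2} :
    LinearSystem π A Φ ↔ ∀ x, (Φ x).det = 1 ∧
      HasCoverMatDeriv π Φ (fun u => conn A (proj π x) u * Φ x) x := by
  refine forall_congr' fun x => and_congr_right fun _ => exists_congr fun L =>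
    and_congr_right fun _ => ?_
  constructor
  · rintro ⟨h1, h2, h3⟩ u
    conv_lhs => rw [total_eq_sum u]
    conv_rhs => rw [total_eq_sum u]
    simp only [evalForms_add, evalForms_smul, evalForms_sum, conn_add, conn_smul, conn_sum, h1, h2,
      h3, conn_lam, conn_dirPole, conn_dirModule, add_mul, Finset.sum_mul, Matrix.smul_mul]
    rfl
  · intro h
    refine ⟨?_, fun j => ?_, ?_⟩
    · rw [h]; dsimp only; rw [conn_lam]; rfl
    · rw [h]; dsimp only; rw [conn_dirPole]; rfl
    · rw [h]; dsimp only; rw [conn_dirModule]; rfl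

lemma conn_self_dirPole (A : Fin N → Param N → Mat2) (p : Param N) {i j : Fin N} (hij : i ≠ j) :
    conn A (p.1 j, p) ((dirPole i : Param N).1 j, dirPole i) =
      -twistSum (A i p) fun a => w a (p.1 j - p.1 i) p.2 := by
  rw [show (dirPole i : Param N).1 j = 0 by simp [dirPole, hij.symm], conn_dirPole]

lemma conn_self_dirPole_self (A : Fin N → Param N → Mat2) (p : Param N) (j : Fin N) :
    conn A (p.1 j, p) ((dirPole j : Param N).1 j, dirPole j) =
      ∑ i ∈ Finset.univ.erase j, twistSum (A i p) fun a => w a (p.1 j - p.1 i) p.2 := by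
  rw [conn_eq, ← Finset.add_sum_erase _ _ (Finset.mem_univ j)]
  have h : ∀ i ∈ Finset.univ.erase j, (dirPole j : Param N).1 i = 0 := fun i hi => by
    simp [dirPole, Finset.ne_of_mem_erase hi]
  rw [Finset.sum_congr rfl fun i hi => by rw [h i hi]]
  simp [dirPole]

/-- The elliptic Schlesinger system says that `A_j` evolves by conjugation with the regular part
of the connection at the moving pole `λ_j`. -/
theorem schlesingerSystem_iff {A : Fin N → Param N → Mat2} :
    SchlesingerSystem D A ↔ ∀ p ∈ D, ∀ j, (A j p).trace = 0 ∧
      HasMatDeriv (A j) (fun v => ⁅conn A (p.1 j, p) (v.1 j, v), A j p⁆) p := by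
  refine forall_congr' fun p => forall_congr' fun _ => forall_congr' fun j =>
    and_congr_right fun _ => exists_congr fun L => and_congr_right fun _ => ?_
  have e2 : conn A (p.1 j, p) ((dirModule N).1 j, dirModule N) =
      ∑ i, twistSum (A i p) fun a => Z a (p.1 j - p.1 i) p.2 := by
    rw [show (dirModule N).1 j = 0 from rfl, conn_dirModule]
  have lie1 (s : Finset (Fin N)) (f : Fin N → Mat2) :
      -∑ i ∈ s, ⁅A j p, f i⁆ = ⁅∑ i ∈ s, f i, A j p⁆ := by
    simp only [Ring.lie_def, Finset.sum_mul, Finset.mul_sum, Finset.sum_sub_distrib, neg_sub]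
  have lie2 (f : Mat2) : ⁅-f, A j p⁆ = ⁅A j p, f⁆ := by
    simp only [Ring.lie_def]; noncomm_ring
  have lie3 (a : ℂ) (f : Mat2) : ⁅a • f, A j p⁆ = a • ⁅f, A j p⁆ := by
    simp only [Ring.lie_def, Matrix.smul_mul, Matrix.mul_smul, smul_sub]
  have lie4 (f f' : Mat2) : ⁅f + f', A j p⁆ = ⁅f, A j p⁆ + ⁅f', A j p⁆ := by
    simp only [Ring.lie_def]; noncomm_ring
  have lie5 (f : Fin N → Mat2) : ⁅∑ i, f i, A j p⁆ = ∑ i, ⁅f i, A j p⁆ := by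
    simp only [Ring.lie_def, Finset.sum_mul, Finset.mul_sum, Finset.sum_sub_distrib]
  constructor
  · rintro ⟨h1, h2, h3⟩ v
    have hb (i : Fin N) : evalForms L (dirPole i) =
        ⁅conn A (p.1 j, p) ((dirPole i : Param N).1 j, dirPole i), A j p⁆ := by
      by_cases hij : i = j
      · subst hij
        rw [h2, conn_self_dirPole_self, lie1]
      · rw [h1 i hij, conn_self_dirPole A p hij, lie2]
    have hv : ((v.1 j, v) : Total N) = ∑ i, v.1 i • ((dirPole i : Param N).1 j, dirPole i) +
        v.2 • ((dirModule N).1 j, dirModule N) := by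
      refine Prod.ext ?_ ?_
      · simp [dirPole, dirModule, Prod.fst_sum, Pi.single_apply]
      · simpa [Prod.snd_sum] using param_eq_sum v
    dsimp only
    rw [hv]
    conv_lhs => rw [param_eq_sum v]
    simp only [evalForms_add, evalForms_smul, evalForms_sum, conn_add, conn_smul, conn_sum, hb, h3,
      e2, lie1, lie3, lie4, lie5]
  · intro h
    refine ⟨fun i hij => ?_, ?_, ?_⟩
    · rw [h]; dsimp only; rw [conn_self_dirPole A p hij, lie2]
    · rw [h]; dsimp only; rw [conn_self_dirPole_self, lie1]
    · rw [h]; dsimp only; rw [e2, lie1]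

end Cover

/-! ### The eigenprojection and the coefficients `J` -/

lemma coord_sum_pauli (c : Fin 3 → ℂ) (a : Fin 3) : coord (∑ b, c b • pauli b) a = c a := by
  fin_cases a <;>
    simp [Fin.sum_univ_three, coord, pauli, Matrix.trace_fin_two]
  · ring
  · linear_combination (-c 1) * Complex.I_mul_I

lemma coord_add (M M' : Mat2) (a : Fin 3) : coord (M + M') a = coord M a + coord M' a := by
  simp [coord, mul_add, Matrix.trace_add, add_div]

lemma coord_smul (c : ℂ) (M : Mat2) (a : Fin 3) : coord (c • M) a = c * coord M a := by
  simp [coord, Matrix.trace_smul, mul_div_assoc]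

lemma coord_one (a : Fin 3) : coord 1 a = 0 := by
  simp [coord, trace_pauli]

/-- The projection onto the second column of `G` along the first one, that is
`1/2 - (1/2) G σ₃ G⁻¹`. -/
def eigenProj (G : Mat2) : Mat2 := G * !![0, 0; 0, 1] * G⁻¹

lemma inv_mul_of_det {G : Mat2} (hG : G.det ≠ 0) : G⁻¹ * G = 1 :=
  Matrix.nonsing_inv_mul G (isUnit_iff_ne_zero.2 hG)

lemma mul_inv_of_det {G : Mat2} (hG : G.det ≠ 0) : G * G⁻¹ = 1 :=
  Matrix.mul_nonsing_inv G (isUnit_iff_ne_zero.2 hG)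

lemma half_add_conj_pauli {G : Mat2} (hG : G.det ≠ 0) :
    (1 / 2 : ℂ) • (1 : Mat2) + -(1 / 2 : ℂ) • (G * pauli 2 * G⁻¹) = eigenProj G := by
  have h1 : (!![0, 0; 0, 1] : Mat2) = (1 / 2 : ℂ) • (1 : Mat2) + -(1 / 2 : ℂ) • pauli 2 := by
    refine mat2_ext ?_ ?_ ?_ ?_ <;> simp [pauli]; norm_num
  rw [eigenProj, h1, mul_add, add_mul]
  simp only [Matrix.mul_smul, Matrix.smul_mul, mul_one, mul_inv_of_det hG]

lemma trace_eigenProj {G : Mat2} (hG : G.det ≠ 0) : (eigenProj G).trace = 1 := by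
  rw [eigenProj, Matrix.trace_mul_comm, ← mul_assoc, inv_mul_of_det hG, one_mul]
  simp [Matrix.trace_fin_two]

lemma det_eigenProj (G : Mat2) : (eigenProj G).det = 0 := by
  simp [eigenProj, Matrix.det_mul, Matrix.det_fin_two]

lemma Diagonalizes.add_smul_one {G A : Mat2} {t : ℂ} (h : Diagonalizes G t A) :
    A + t • (1 : Mat2) = (2 * t) • (G * !![1, 0; 0, 0] * G⁻¹) := by
  obtain ⟨hG, rfl⟩ := h
  have hG' : G.det ≠ 0 := by rw [hG]; exact one_ne_zero
  have h1 : (2 * t) • (!![1, 0; 0, 0] : Mat2) = Matrix.diagonal ![t, -t] + t • (1 : Mat2) := by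
    refine mat2_ext ?_ ?_ ?_ ?_ <;> simp
    ring
  rw [← Matrix.smul_mul, ← Matrix.mul_smul, h1, mul_add, add_mul]
  simp only [Matrix.mul_smul, Matrix.smul_mul, mul_one, mul_inv_of_det hG']

lemma Diagonalizes.trace_eq_zero {G A : Mat2} {t : ℂ} (h : Diagonalizes G t A) : A.trace = 0 := by
  obtain ⟨hG, rfl⟩ := h
  have hG' : G.det ≠ 0 := by rw [hG]; exact one_ne_zero
  rw [Matrix.trace_mul_comm, ← mul_assoc, inv_mul_of_det hG', one_mul]
  simp

/-- The columns of `A_k + t_k` are multiples of the first column of `G_k`, which the projection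
kills. -/
lemma eigenProj_firstColumns_mul {Gk Gl A : Mat2} {t : ℂ} (h : Diagonalizes Gk t A)
    (hG : (firstColumns Gk Gl).det ≠ 0) :
    eigenProj (firstColumns Gk Gl) * (A + t • (1 : Mat2)) = 0 := by
  have h1 : Gk * !![1, 0; 0, 0] = firstColumns Gk Gl * !![1, 0; 0, 0] := by
    refine mat2_ext ?_ ?_ ?_ ?_ <;> simp [firstColumns, Matrix.mul_apply]
  have h2 : (!![0, 0; 0, 1] : Mat2) * !![1, 0; 0, 0] = 0 := by
    refine mat2_ext ?_ ?_ ?_ ?_ <;> simp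
  rw [h.add_smul_one, h1, eigenProj, Matrix.mul_smul, ← mul_assoc, ← mul_assoc,
    mul_assoc _ _ (firstColumns Gk Gl), inv_mul_of_det hG, mul_one, mul_assoc (firstColumns Gk Gl),
    h2]
  simp

lemma eigenProj_firstColumns_mul_right {Gk Gl A : Mat2} {t : ℂ} (h : Diagonalizes Gl t A)
    (hG : (firstColumns Gk Gl).det ≠ 0) :
    eigenProj (firstColumns Gk Gl) * (A + t • (1 : Mat2)) = A + t • (1 : Mat2) := by
  have h1 : Gl * !![1, 0; 0, 0] = firstColumns Gk Gl * !![0, 0; 1, 0] := by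
    refine mat2_ext ?_ ?_ ?_ ?_ <;> simp [firstColumns, Matrix.mul_apply]
  have h2 : (!![0, 0; 0, 1] : Mat2) * !![0, 0; 1, 0] = !![0, 0; 1, 0] := by
    refine mat2_ext ?_ ?_ ?_ ?_ <;> simp
  rw [h.add_smul_one, h1, eigenProj, Matrix.mul_smul, ← mul_assoc, ← mul_assoc,
    mul_assoc _ _ (firstColumns Gk Gl), inv_mul_of_det hG, mul_one, mul_assoc (firstColumns Gk Gl),
    h2]

lemma adjugate_mul_of_mul_eq_zero {P B : Mat2} (hP : P.trace = 1) (h : P * B = 0) :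
    B.adjugate * P = B.adjugate := by
  have h1 : B.adjugate * P.adjugate = 0 := by rw [← Matrix.adjugate_mul_distrib, h]; simp
  have h2 : P.adjugate = 1 - P := by
    rw [Matrix.trace_fin_two] at hP
    rw [Matrix.adjugate_fin_two]
    refine mat2_ext ?_ ?_ ?_ ?_ <;> simp <;> linear_combination hP
  rw [h2, mul_sub, mul_one, sub_eq_zero] at h1
  exact h1.symm

lemma mul_mul_of_det_eq_zero {P : Mat2} (hP : P.det = 0) (M : Mat2) :
    P * M * P = (P * M).trace • P := by
  rw [Matrix.det_fin_two] at hP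
  refine mat2_ext ?_ ?_ ?_ ?_ <;> simp [Matrix.mul_apply, Matrix.trace_fin_two]
  · linear_combination (-M 1 1) * hP
  · linear_combination (M 0 1) * hP
  · linear_combination (M 1 0) * hP
  · linear_combination (-M 0 0) * hP

/-- A projection of rank one is determined by two matrices whose columns span its kernel and its
image. This formula shows that it depends holomorphically on them. -/
lemma mul_mul_adjugate_eq_smul_proj {P B B' : Mat2} (hP : P.trace = 1) (hP' : P.det = 0)
    (h : P * B = 0) (h' : P * B' = B') (E : Mat2) :
    B' * E * B.adjugate = (B' * E * B.adjugate).trace • P := by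
  have h1 := adjugate_mul_of_mul_eq_zero hP h
  have h2 := mul_mul_of_det_eq_zero hP' (B' * E * B.adjugate)
  rw [← mul_assoc, ← mul_assoc, h', mul_assoc _ _ P, h1] at h2
  exact h2

lemma exists_trace_mul_mul_adjugate_ne_zero {P B B' : Mat2} (hP : P.trace = 1) (hP' : P.det = 0)
    (h : P * B = 0) (h' : P * B' = B') (hB : B.trace ≠ 0) (hB' : B'.trace ≠ 0) :
    ∃ E : Mat2, (B' * E * B.adjugate).trace ≠ 0 := by
  by_contra! h0
  have h1 := adjugate_mul_of_mul_eq_zero hP h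
  have h2 : B.adjugate * B' = 0 := by
    refine Matrix.ext_iff_trace_mul_left.2 fun E => ?_
    rw [mul_zero, Matrix.trace_zero, ← mul_assoc, Matrix.trace_mul_comm, ← mul_assoc, h0]
  have h3 : (B'.trace) • P = B' * P := by
    rw [← h', mul_mul_of_det_eq_zero hP']
  have h4 : B.adjugate = 0 := by
    have : B'.trace • B.adjugate = 0 := by
      rw [← h1, ← Matrix.mul_smul, h3, ← mul_assoc, h2, zero_mul]
    exact (smul_eq_zero.1 this).resolve_left hB'
  apply hB
  have := congrArg Matrix.trace h4
  rwa [Matrix.adjugate_fin_two, Matrix.trace_fin_two_of, add_comm, ← Matrix.trace_fin_two,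
    Matrix.trace_zero] at this

section

variable {N : ℕ} {D : Set (Param N)} {k l : Fin N} {p : Param N} {Gk Gl : Mat2}

lemma definesJ_iff {G : Mat2} (hG : G.det ≠ 0) {J : Fin 3 → ℂ} :
    DefinesJ k l G p J ↔ ∀ a, J a * w a ((p.1 k - p.1 l) / 2) p.2 = coord (eigenProj G) a := by
  have hc (a : Fin 3) : coord (eigenProj G) a = coord (-(1 / 2 : ℂ) • (G * pauli 2 * G⁻¹)) a := by
    rw [← half_add_conj_pauli hG, coord_add, coord_smul _ 1, coord_one, mul_zero, zero_add]
  constructor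
  · intro h a
    rw [hc, ← h, coord_sum_pauli]
  · intro h
    have ht : (-(1 / 2 : ℂ) • (G * pauli 2 * G⁻¹)).trace = 0 := by
      rw [Matrix.trace_smul, Matrix.trace_mul_comm, ← mul_assoc, inv_mul_of_det hG, one_mul,
        trace_pauli, smul_zero]
    rw [DefinesJ, ← sum_coord_smul_pauli _ ht]
    exact Finset.sum_congr rfl fun a _ => by rw [h, hc]

lemma not_inLattice_of_ne (hp : p ∈ configSpace N) (hkl : k ≠ l) :
    ¬ InLattice p.2 (2 * ((p.1 k - p.1 l) / 2)) := by
  rw [mul_div_cancel₀ _ (two_ne_zero' ℂ)]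
  exact hp.2 k l hkl

/-- The coefficients `J` exist and are unique. -/
theorem existsUnique_definesJ (hp : p ∈ configSpace N) (hkl : k ≠ l) {G : Mat2} (hG : G.det ≠ 0) :
    ∃! J : Fin 3 → ℂ, DefinesJ k l G p J := by
  have hw (a : Fin 3) := w_ne_zero hp.1 a (not_inLattice_of_ne hp hkl)
  refine ⟨fun a => coord (eigenProj G) a / w a ((p.1 k - p.1 l) / 2) p.2,
    (definesJ_iff hG).2 fun a => div_mul_cancel₀ _ (hw a), fun J' hJ' => ?_⟩
  funext a
  rw [eq_div_iff (hw a), (definesJ_iff hG).1 hJ']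

end

/-! ### The dressing matrix -/

section

section

variable {E : Type*} [NormedAddCommGroup E] [NormedSpace ℂ E]

/-- The directional derivatives of a matrix function. -/
def matDeriv (Φ : E → Mat2) (x u : E) : Mat2 :=
  Matrix.of fun r c => fderiv ℂ (fun y => Φ y r c) x u

lemma HasMatDeriv.matDeriv_eq {Φ D : E → Mat2} {x : E} (h : HasMatDeriv Φ D x) (u : E) :
    matDeriv Φ x u = D u := by
  obtain ⟨L, hL, hD⟩ := h
  rw [← hD]
  ext r c
  simp only [matDeriv, evalForms, Matrix.of_apply, (hL r c).fderiv]

lemma HasMatDeriv.matDeriv {Φ D : E → Mat2} {x : E} (h : HasMatDeriv Φ D x) :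
    HasMatDeriv Φ (matDeriv Φ x) x :=
  h.congr_deriv fun u => (h.matDeriv_eq u).symm

lemma HasMatDeriv.comp_prodMk {Φ D : ℂ × E → Mat2} {z : ℂ} {p : E} (h : HasMatDeriv Φ D (z, p)) :
    HasMatDeriv (fun y => Φ (y, p)) (fun y => D (y, 0)) z :=
  HasMatDeriv.comp (g := fun y => (y, p)) z h (hasFDerivAt_prodMk_left z p)

end

/-- What is used about the matrix `H(λ, p) = ϑ₁(λ - (λ_k + λ_l)/2) f(λ)`, an entire function
of `λ`: it depends holomorphically on all variables (the next two fields concern those second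
derivatives that occur), it is quasi-periodic up to conjugation with Pauli matrices, its determinant
vanishes exactly on the classes of `λ_k` and `λ_l`, to first order, and `H(λ_j)` kills the
eigenvectors of `A_j` with the eigenvalue `t_j`, for `j = k, l`. -/
structure IsDressing {N : ℕ} (D : Set (Param N)) (A : Fin N → Param N → Mat2) (t : Fin N → ℂ)
    (k l : Fin N) (H : Total N → Mat2) : Prop where
  hasMatDeriv : ∀ p ∈ D, ∀ z, HasMatDeriv H (matDeriv H (z, p)) (z, p)
  hasMatDeriv_lam : ∀ p ∈ D, ∀ z, HasMatDeriv (fun q => matDeriv H q (1, 0))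
    (matDeriv (fun q => matDeriv H q (1, 0)) (z, p)) (z, p)
  exists_hasMatDeriv_fiber : ∀ p ∈ D, ∀ u z, ∃ X, HasMatDeriv (fun y => matDeriv H (y, p) u) X z
  add_one : ∀ p z, H (z + 1, p) = (-1 : ℂ) • (pauli 2 * H (z, p) * pauli 2)
  add_module : ∀ p z, H (z + p.2, p) =
    (-quasiFactor (z - (p.1 k + p.1 l) / 2) p.2) • (pauli 0 * H (z, p) * pauli 0)
  det_eq : ∀ p ∈ D, ∃ K : ℂ, K ≠ 0 ∧
    ∀ z, (H (z, p)).det = K * (theta1 (z - p.1 k) p.2 * theta1 (z - p.1 l) p.2)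
  mul_add_smul : ∀ p ∈ D, ∀ j, (j = k ∨ j = l) → H (p.1 j, p) * (A j p + t j • (1 : Mat2)) = 0

variable {N : ℕ} {D : Set (Param N)} {A : Fin N → Param N → Mat2} {t : Fin N → ℂ} {k l : Fin N}
  {G : Fin N → Param N → Mat2} {J : Param N → Fin 3 → ℂ}

/-- The linear map `(λ, p) ↦ (λ - (λ_k + λ_l)/2, μ)`. -/
def centerMap (k l : Fin N) : Total N →L[ℂ] ℂ × ℂ :=
  (ContinuousLinearMap.fst ℂ ℂ (Param N) -
    (1 / 2 : ℂ) • (((ContinuousLinearMap.proj k : (Fin N → ℂ) →L[ℂ] ℂ) +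
      (ContinuousLinearMap.proj l : (Fin N → ℂ) →L[ℂ] ℂ)).comp
        ((ContinuousLinearMap.fst ℂ (Fin N → ℂ) ℂ).comp
          (ContinuousLinearMap.snd ℂ ℂ (Param N))))).prod
  ((ContinuousLinearMap.snd ℂ (Fin N → ℂ) ℂ).comp (ContinuousLinearMap.snd ℂ ℂ (Param N)))

lemma centerMap_apply (k l : Fin N) (q : Total N) :
    centerMap k l q = (q.1 - (q.2.1 k + q.2.1 l) / 2, q.2.2) := by
  simp only [centerMap, ContinuousLinearMap.prod_apply, sub_apply, smul_apply,
    ContinuousLinearMap.comp_apply, add_apply, ContinuousLinearMap.proj_apply,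
    ContinuousLinearMap.coe_fst', ContinuousLinearMap.coe_snd', smul_eq_mul]
  congr 1
  ring

/-- The `n`-th derivative with respect to `λ` of the matrix
`ϑ₁(λ - (λ_k + λ_l)/2) f(λ)`, which is an entire function of `λ`. -/
def dressMat (n : ℕ) (k l : Fin N) (J : Param N → Fin 3 → ℂ) (q : Total N) : Mat2 :=
  (-(1 / 2) * thetaD n (1 / 2) (1 / 2) (centerMap k l q).1 (centerMap k l q).2) • (1 : Mat2) +
    ∑ a, (J q.2 a * thetaConst a q.2.2 *
      thetaD n (charP a) (charQ a) (centerMap k l q).1 (centerMap k l q).2) • pauli a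

lemma hasFDerivAt_mul_thetaD (k l : Fin N) (n : ℕ) (a b : ℂ) {h : Param N → ℂ} {p : Param N}
    (hp : 0 < p.2.im) (hh : DifferentiableAt ℂ h p) (z : ℂ) :
    ∃ L : Total N →L[ℂ] ℂ,
      HasFDerivAt
        (fun q : Total N => h q.2 * thetaD n a b (centerMap k l q).1 (centerMap k l q).2) L
        (z, p) ∧
      ∀ u, L u = h p * (thetaD (n + 1) a b (centerMap k l (z, p)).1 p.2 * (centerMap k l u).1 +
          thetaD (n + 2) a b (centerMap k l (z, p)).1 p.2 / (4 * Real.pi * Complex.I) *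
            (centerMap k l u).2) +
        thetaD n a b (centerMap k l (z, p)).1 p.2 * fderiv ℂ h p u.2 := by
  have h1 : HasFDerivAt (fun q : Total N => h q.2)
      ((fderiv ℂ h p).comp (ContinuousLinearMap.snd ℂ ℂ (Param N))) (z, p) :=
    HasFDerivAt.comp (z, p) (g := h) hh.hasFDerivAt hasFDerivAt_snd
  have hc : (centerMap k l (z, p)).2 = p.2 := by rw [centerMap_apply]
  have h2 := HasFDerivAt.comp (z, p) (f := centerMap k l)
    (hasFDerivAt_thetaD n a b (centerMap k l (z, p)).1 (μ := (centerMap k l (z, p)).2)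
        (by rwa [hc]))
    (centerMap k l).hasFDerivAt
  refine ⟨_, h1.mul h2, fun u => ?_⟩
  simp [hc]
  ring

lemma differentiableAt_mul_thetaConst {p : Param N} (hp : 0 < p.2.im)
    (hJ : ∀ a, DifferentiableAt ℂ (fun p => J p a) p) (a : Fin 3) :
    DifferentiableAt ℂ (fun p : Param N => J p a * thetaConst a p.2) p :=
  (hJ a).mul (((contDiffAt_thetaConst 1 a hp).differentiableAt (by simp)).comp p
    differentiableAt_snd)

lemma hasMatDeriv_dressMat (n : ℕ) {p : Param N} (hp : 0 < p.2.im)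
    (hJ : ∀ a, DifferentiableAt ℂ (fun p => J p a) p) (z : ℂ) :
    HasMatDeriv (dressMat n k l J) (matDeriv (dressMat n k l J) (z, p)) (z, p) ∧
      matDeriv (dressMat n k l J) (z, p) (1, 0) = dressMat (n + 1) k l J (z, p) := by
  obtain ⟨L, hL, hL'⟩ := hasFDerivAt_mul_thetaD k l n (1 / 2) (1 / 2)
    (h := fun _ => -(1 / 2)) hp (differentiableAt_const _) z
  choose L' hL1 hL2 using fun a : Fin 3 =>
    hasFDerivAt_mul_thetaD k l n (charP a) (charQ a) hp (differentiableAt_mul_thetaConst hp hJ a) z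
  have h := (hasMatDeriv_smul_const hL (1 : Mat2)).add
    (HasMatDeriv.sum Finset.univ fun a _ => hasMatDeriv_smul_const (hL1 a) (pauli a))
  have h' : HasMatDeriv (dressMat n k l J) _ (z, p) := h
  refine ⟨h'.matDeriv, ?_⟩
  have hu : centerMap k l ((1, 0) : Total N) = (1, 0) := by rw [centerMap_apply]; simp
  have hc : (centerMap k l (z, p)).2 = p.2 := by rw [centerMap_apply]
  rw [h'.matDeriv_eq]
  simp [hL', hL2, dressMat, hu, hc]

lemma exists_hasMatDeriv_matDeriv_dressMat (n : ℕ) {p : Param N} (hp : 0 < p.2.im)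
    (hJ : ∀ a, DifferentiableAt ℂ (fun p => J p a) p) (u : Total N) (z : ℂ) :
    ∃ X, HasMatDeriv (fun y => matDeriv (dressMat n k l J) (y, p) u) X z := by
  set φ : (Param N → ℂ) → ℂ → ℂ → ℂ → ℂ := fun h a b y =>
    h p * (thetaD (n + 1) a b (centerMap k l (y, p)).1 p.2 * (centerMap k l u).1 +
          thetaD (n + 2) a b (centerMap k l (y, p)).1 p.2 / (4 * Real.pi * Complex.I) *
            (centerMap k l u).2) +
        thetaD n a b (centerMap k l (y, p)).1 p.2 * fderiv ℂ h p u.2 with hφ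
  have hφd (h : Param N → ℂ) (a b : ℂ) : HasFDerivAt (φ h a b) (fderiv ℂ (φ h a b) z) z := by
    have ht (m : ℕ) :
        DifferentiableAt ℂ (fun y => thetaD m a b (centerMap k l (y, p)).1 p.2) z := by
      simp only [centerMap_apply]
      exact ((hasDerivAt_thetaD m a b _ hp).comp_sub_const z _).differentiableAt
    exact ((((ht _).mul_const _).add (((ht _).div_const _).mul_const _)).const_mul _ |>.add
      ((ht n).mul_const _)).hasFDerivAt
  have h1 := (hasMatDeriv_smul_const (hφd (fun _ => -(1 / 2)) (1 / 2) (1 / 2)) (1 : Mat2)).add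
    (HasMatDeriv.sum Finset.univ fun a _ => hasMatDeriv_smul_const
      (hφd (fun p : Param N => J p a * thetaConst a p.2) (charP a) (charQ a)) (pauli a))
  refine ⟨_, h1.congr_of_eventuallyEq (Eventually.of_forall fun y => ?_)⟩
  obtain ⟨L, hL, hL'⟩ := hasFDerivAt_mul_thetaD k l n (1 / 2) (1 / 2)
    (h := fun _ => -(1 / 2)) hp (differentiableAt_const _) y
  choose L' hL1 hL2 using fun a : Fin 3 =>
    hasFDerivAt_mul_thetaD k l n (charP a) (charQ a) hp (differentiableAt_mul_thetaConst hp hJ a) y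
  have h' : HasMatDeriv (dressMat n k l J) _ (y, p) := (hasMatDeriv_smul_const hL (1 : Mat2)).add
    (HasMatDeriv.sum Finset.univ fun a _ => hasMatDeriv_smul_const (hL1 a) (pauli a))
  dsimp only
  rw [h'.matDeriv_eq]
  simp only [hL', hL2, hφ]

lemma dressMat_zero (k l : Fin N) (J : Param N → Fin 3 → ℂ) (z : ℂ) (p : Param N) :
    dressMat 0 k l J (z, p) =
      (1 / 2 * theta1 (z - (p.1 k + p.1 l) / 2) p.2) • (1 : Mat2) +
        ∑ a, (J p a * thetaConst a p.2 * thetaNum a (z - (p.1 k + p.1 l) / 2) p.2) • pauli a := by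
  simp only [dressMat, centerMap_apply, thetaNum_eq_thetaD, theta1_eq_thetaD]
  congr 2
  ring

lemma dressMat_eq_smul_dressing {z : ℂ} {p : Param N} (hp : 0 < p.2.im)
    (hz : ¬ InLattice p.2 (z - (p.1 k + p.1 l) / 2)) :
    dressMat 0 k l J (z, p) =
      theta1 (z - (p.1 k + p.1 l) / 2) p.2 • dressing k l p (J p) z := by
  have h0 := theta1_ne_zero hp hz
  rw [dressMat_zero, dressing, smul_add, smul_smul, Finset.smul_sum]
  congr 1
  · rw [mul_comm]
  · refine Finset.sum_congr rfl fun a _ => ?_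
    rw [smul_smul, w]
    congr 1
    generalize theta1 (z - (p.1 k + p.1 l) / 2) p.2 = x at h0
    field_simp

lemma dressMat_add_one (z : ℂ) (p : Param N) :
    dressMat 0 k l J (z + 1, p) = (-1 : ℂ) • (pauli 2 * dressMat 0 k l J (z, p) * pauli 2) := by
  rw [dressMat_zero, dressMat_zero, mul_add, add_mul, pauli_conj_sum pauli_conj_two,
    show z + 1 - (p.1 k + p.1 l) / 2 = z - (p.1 k + p.1 l) / 2 + 1 by ring, theta1_add_one,
    Matrix.mul_smul, mul_one, Matrix.smul_mul, pauli_mul_self, smul_add, smul_smul, Finset.smul_sum]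
  congr 2
  · ring
  · funext a
    rw [thetaNum_add_one, smul_smul]
    congr 1
    ring

lemma dressMat_add_module (z : ℂ) (p : Param N) :
    dressMat 0 k l J (z + p.2, p) =
      (-quasiFactor (z - (p.1 k + p.1 l) / 2) p.2) •
        (pauli 0 * dressMat 0 k l J (z, p) * pauli 0) := by
  rw [dressMat_zero, dressMat_zero, mul_add, add_mul, pauli_conj_sum pauli_conj_zero,
    show z + p.2 - (p.1 k + p.1 l) / 2 = z - (p.1 k + p.1 l) / 2 + p.2 by ring, theta1_add_module,
    Matrix.mul_smul, mul_one, Matrix.smul_mul, pauli_mul_self, smul_add, smul_smul, Finset.smul_sum]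
  congr 2
  · ring
  · funext a
    rw [thetaNum_add_module, smul_smul]
    congr 1
    ring

lemma det_pauli_conj (b : Fin 3) (c : ℂ) (M : Mat2) :
    (c • (pauli b * M * pauli b)).det = c ^ 2 * M.det := by
  rw [Matrix.det_smul, Matrix.det_mul, Matrix.det_mul, det_pauli]
  simp

lemma quasiFactor_sq (z a b μ : ℂ) :
    quasiFactor (z - (a + b) / 2) μ ^ 2 = quasiFactor (z - a) μ * quasiFactor (z - b) μ := by
  rw [quasiFactor, quasiFactor, quasiFactor, ← Complex.exp_add, ← Complex.exp_nat_mul]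
  congr 1
  push_cast
  ring

lemma dressMat_apply_left {p : Param N} (hp : p ∈ configSpace N) (hkl : k ≠ l) {G : Mat2}
    (hG : G.det ≠ 0) (hJ : DefinesJ k l G p (J p)) :
    dressMat 0 k l J (p.1 k, p) = theta1 ((p.1 k - p.1 l) / 2) p.2 • eigenProj G := by
  have e : p.1 k - (p.1 k + p.1 l) / 2 = (p.1 k - p.1 l) / 2 := by ring
  have h : ¬ InLattice p.2 ((p.1 k - p.1 l) / 2) := fun h =>
    not_inLattice_of_ne hp hkl (by rw [two_mul]; exact h.add h)
  rw [dressMat_eq_smul_dressing hp.1 (by rwa [e]), dressing, e, hJ, half_add_conj_pauli hG]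

lemma dressMat_apply_right {p : Param N} (hp : p ∈ configSpace N) (hkl : k ≠ l) {G : Mat2}
    (hG : G.det ≠ 0) (hJ : DefinesJ k l G p (J p)) :
    dressMat 0 k l J (p.1 l, p) = theta1 (-((p.1 k - p.1 l) / 2)) p.2 • (1 - eigenProj G) := by
  have e : p.1 l - (p.1 k + p.1 l) / 2 = -((p.1 k - p.1 l) / 2) := by ring
  have h : ¬ InLattice p.2 ((p.1 k - p.1 l) / 2) := fun h =>
    not_inLattice_of_ne hp hkl (by rw [two_mul]; exact h.add h)
  rw [dressMat_eq_smul_dressing hp.1 (by rwa [e, inLattice_neg_iff]), dressing, e,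
    ← half_add_conj_pauli hG, ← hJ]
  congr 1
  simp only [w_neg, mul_neg, neg_smul, Finset.sum_neg_distrib]
  module

/-- The determinant of the dressing matrix has the quasi-periods of `ϑ₁(λ - λ_k) ϑ₁(λ - λ_l)`, and
the quotient has no poles, so that it is constant by Liouville's theorem. -/
theorem exists_det_dressMat {p : Param N} (hp : p ∈ configSpace N) (hkl : k ≠ l)
    (hJd : ∀ a, DifferentiableAt ℂ (fun p => J p a) p)
    (hk : (dressMat 0 k l J (p.1 k, p)).det = 0) (hl : (dressMat 0 k l J (p.1 l, p)).det = 0)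
    (hne : ∃ z : ℂ, ¬ InLattice p.2 (z - (p.1 k + p.1 l) / 2) ∧
      (dressing k l p (J p) z).det ≠ 0) :
    ∃ K : ℂ, K ≠ 0 ∧ ∀ z, (dressMat 0 k l J (z, p)).det =
      K * (theta1 (z - p.1 k) p.2 * theta1 (z - p.1 l) p.2) := by
  have hμ := hp.1
  set f : ℂ → ℂ := fun z => (dressMat 0 k l J (z, p)).det with hf
  set s : Fin 2 → ℂ := ![p.1 k, p.1 l] with hs
  set θ : ℂ → ℂ := fun z => theta1 (z - p.1 k) p.2 * theta1 (z - p.1 l) p.2 with hθ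
  have hfd : Differentiable ℂ f := fun z => by
    obtain ⟨L, hL, -⟩ :=
      (hasMatDeriv_dressMat (k := k) (l := l) 0 hμ hJd z).1.comp_prodMk.hasFDerivAt_det
    exact hL.differentiableAt
  have hθ1 (a : ℂ) : Differentiable ℂ fun z => theta1 (z - a) p.2 :=
    (differentiable_theta1 hμ).comp (differentiable_id.sub_const a)
  have hθd : Differentiable ℂ θ := (hθ1 _).mul (hθ1 _)
  have hnz (z : ℂ) (hz : ∀ j, ¬ InLattice p.2 (z - s j)) : θ z ≠ 0 :=
    mul_ne_zero (theta1_ne_zero hμ (hz 0)) (theta1_ne_zero hμ (hz 1))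
  have hlim (a b : ℂ) (hab : ¬ InLattice p.2 (a - b)) (ha : f a = 0) :
      Tendsto (fun z => (z - a) * (f z / (theta1 (z - a) p.2 * theta1 (z - b) p.2))) (𝓝[≠] a)
        (𝓝 0) := by
    have h1 : HasDerivAt (fun z => theta1 (z - a) p.2) (-thetaD 1 (1 / 2) (1 / 2) 0 p.2) a := by
      have := hasDerivAt_theta1 (a - a) hμ
      rw [sub_self] at this
      exact HasDerivAt.comp_sub_const a a (by rwa [sub_self])
    have h2 := tendsto_sub_div_of_hasDerivAt h1 (by simp [theta1_zero])
      (neg_ne_zero.2 (thetaD_one_zero_ne_zero hμ))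
    have h3 : Tendsto (fun z => f z / theta1 (z - b) p.2) (𝓝[≠] a) (𝓝 0) := by
      have h4 : ContinuousAt (fun z => f z / theta1 (z - b) p.2) a :=
        (hfd a).continuousAt.div (hθ1 b a).continuousAt (theta1_ne_zero hμ hab)
      have h5 := h4.tendsto
      rw [ha, zero_div] at h5
      exact h5.mono_left nhdsWithin_le_nhds
    have h6 := h2.mul h3
    rw [mul_zero] at h6
    refine h6.congr fun z => ?_
    rw [div_mul_div_comm, mul_div_assoc]
  obtain ⟨K, hK⟩ := exists_const_of_periodic_up_to_sign hμ s (fun z => f z / θ z)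
    (fun z hz => (hfd z).div (hθd z) (hnz z hz))
    (fun j => by
      fin_cases j
      · exact hlim _ _ (hp.2 k l hkl) hk
      · refine (hlim _ _ (hp.2 l k hkl.symm) hl).congr fun z => ?_
        simp only [hθ, mul_comm]
        rfl)
    (ε := 1) (ε' := 1) (Or.inl rfl) (Or.inl rfl)
    (fun z _ => by
      simp only [hf, hθ, dressMat_add_one, det_pauli_conj]
      rw [show z + 1 - p.1 k = z - p.1 k + 1 by ring, show z + 1 - p.1 l = z - p.1 l + 1 by ring,
        theta1_add_one, theta1_add_one]
      ring)
    (fun z _ => by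
      simp only [hf, hθ, dressMat_add_module, det_pauli_conj]
      rw [show z + p.2 - p.1 k = z - p.1 k + p.2 by ring,
        show z + p.2 - p.1 l = z - p.1 l + p.2 by ring,
        theta1_add_module, theta1_add_module, neg_sq, quasiFactor_sq, one_mul,
        show -quasiFactor (z - p.1 k) p.2 * theta1 (z - p.1 k) p.2 *
          (-quasiFactor (z - p.1 l) p.2 * theta1 (z - p.1 l) p.2) =
          (quasiFactor (z - p.1 k) p.2 * quasiFactor (z - p.1 l) p.2) *
          (theta1 (z - p.1 k) p.2 * theta1 (z - p.1 l) p.2) by ring]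
      exact mul_div_mul_left _ _ (mul_ne_zero (quasiFactor_ne_zero _ _) (quasiFactor_ne_zero _ _)))
  have hEq (z : ℂ) : f z = K * θ z := by
    -- both sides are continuous and agree off a discrete set
    have hev : ∀ᶠ u in 𝓝[≠] z, f u = K * θ u := by
      have : ∀ᶠ u in 𝓝[≠] z, ∀ j, ¬ InLattice p.2 (u - s j) :=
        eventually_all.2 fun j => eventually_not_inLattice hμ z (s j)
      filter_upwards [this] with u hu
      rw [← hK u hu, div_mul_cancel₀ _ (hnz u hu)]
    exact tendsto_nhds_unique_of_eventuallyEq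
      ((hfd z).continuousAt.tendsto.mono_left nhdsWithin_le_nhds)
      ((continuousAt_const.mul (hθd z).continuousAt).tendsto.mono_left nhdsWithin_le_nhds) hev
  refine ⟨K, ?_, hEq⟩
  rintro rfl
  obtain ⟨z, hz, hz'⟩ := hne
  have h1 := hEq z
  simp only [hf, zero_mul, dressMat_eq_smul_dressing hμ hz, Matrix.det_smul] at h1
  rcases mul_eq_zero.1 h1 with h2 | h2
  · exact theta1_ne_zero hμ hz (pow_eq_zero_iff (by simp) |>.1 h2)
  · exact hz' h2

/-- The coefficients `J` are holomorphic functions of the parameters. Nothing is known about the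
regularity of the matrices `G_j`, but the projection that defines `J` can be recovered from the
holomorphic matrices `A_k + t_k` and `A_l + t_l`. -/
theorem differentiableAt_of_definesJ (hDo : IsOpen D) (hD : D ⊆ configSpace N)
    (hA : SchlesingerSystem D A) (ht : ∀ j, t j ≠ 0)
    (hG : ∀ p ∈ D, ∀ j, Diagonalizes (G j p) (t j) (A j p)) (hkl : k ≠ l)
    (hdet : ∀ p ∈ D, (firstColumns (G k p) (G l p)).det ≠ 0)
    (hJ : ∀ p ∈ D, DefinesJ k l (firstColumns (G k p) (G l p)) p (J p)) {p : Param N} (hp : p ∈ D)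
    (a : Fin 3) : DifferentiableAt ℂ (fun p => J p a) p := by
  set B : Fin N → Param N → Mat2 := fun j p => A j p + t j • (1 : Mat2) with hB
  set P : Param N → Mat2 := fun p => eigenProj (firstColumns (G k p) (G l p)) with hP
  have htr (j : Fin N) : (B j p).trace ≠ 0 := by
    simp only [hB, Matrix.trace_add, (hG p hp j).trace_eq_zero, Matrix.trace_smul,
      Matrix.trace_one]
    simpa using ht j
  obtain ⟨E, hE⟩ := exists_trace_mul_mul_adjugate_ne_zero (P := P p)
    (trace_eigenProj (hdet p hp)) (det_eigenProj _)
    (eigenProj_firstColumns_mul (hG p hp k) (hdet p hp))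
    (eigenProj_firstColumns_mul_right (hG p hp l) (hdet p hp)) (htr k) (htr l)
  have hBd (j : Fin N) : HasMatDeriv (B j) _ p :=
    ((schlesingerSystem_iff.1 hA p hp j).2).add (hasMatDeriv_const _ p)
  have hX := ((hBd l).mul_const E).mul (hBd k).adjugate
  obtain ⟨Lt, hLt, -⟩ := hX.hasFDerivAt_trace
  obtain ⟨La, hLa, -⟩ := hX.hasFDerivAt_coord a
  have hw0 : ∀ q ∈ D, w a ((q.1 k - q.1 l) / 2) q.2 ≠ 0 := fun q hq =>
    w_ne_zero (hD hq).1 a (not_inLattice_of_ne (hD hq) hkl)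
  have hw : DifferentiableAt ℂ (fun q : Param N => w a ((q.1 k - q.1 l) / 2) q.2) p := by
    have h1 : ¬ InLattice p.2 ((p.1 k - p.1 l) / 2) := fun h =>
      not_inLattice_of_ne (hD hp) hkl (by rw [two_mul]; exact h.add h)
    have h2 := (contDiffAt_w 1 a (hD hp).1 h1).differentiableAt (by simp)
    have h3 : DifferentiableAt ℂ (fun q : Param N => ((q.1 k - q.1 l) / 2, q.2)) p := by fun_prop
    exact DifferentiableAt.comp p (f := fun q : Param N => ((q.1 k - q.1 l) / 2, q.2)) h2 h3
  have key : DifferentiableAt ℂ (fun q => coord (B l q * E * (B k q).adjugate) a /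
      (B l q * E * (B k q).adjugate).trace / w a ((q.1 k - q.1 l) / 2) q.2) p := by
    have h1 := hLa.differentiableAt
    have h2 := hLt.differentiableAt
    simp only [div_eq_mul_inv]
    exact (h1.fun_mul (h2.fun_inv hE)).fun_mul (hw.fun_inv (hw0 p hp))
  refine key.congr_of_eventuallyEq ?_
  filter_upwards [hDo.mem_nhds hp, hLt.continuousAt.eventually_ne hE] with q hq hq'
  have h1 := mul_mul_adjugate_eq_smul_proj (P := P q) (trace_eigenProj (hdet q hq))
    (det_eigenProj _) (eigenProj_firstColumns_mul (hG q hq k) (hdet q hq))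
    (eigenProj_firstColumns_mul_right (hG q hq l) (hdet q hq)) E
  have h2 := (definesJ_iff (hdet q hq)).1 (hJ q hq) a
  change J q a = coord (B l q * E * (B k q).adjugate) a / (B l q * E * (B k q).adjugate).trace /
    w a ((q.1 k - q.1 l) / 2) q.2
  rw [eq_div_iff (hw0 q hq), h2, eq_div_iff hq', mul_comm]
  conv_rhs => rw [h1]
  rw [coord_smul]

/-- The matrix `ϑ₁(λ - (λ_k + λ_l)/2) f(λ)` has all the properties of a dressing matrix: by the
choice of `J` it is a multiple of the projection `eigenProj G` at `λ_k`, and of the complementary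
projection at `λ_l`. -/
theorem isDressing_dressMat (hDo : IsOpen D) (hD : D ⊆ configSpace N)
    (hA : SchlesingerSystem D A) (ht : ∀ j, t j ≠ 0)
    (hG : ∀ p ∈ D, ∀ j, Diagonalizes (G j p) (t j) (A j p)) (hkl : k ≠ l)
    (hdet : ∀ p ∈ D, (firstColumns (G k p) (G l p)).det ≠ 0)
    (hJ : ∀ p ∈ D, DefinesJ k l (firstColumns (G k p) (G l p)) p (J p))
    (hne : ∀ p ∈ D, ∃ z : ℂ, ¬ InLattice p.2 (z - (p.1 k + p.1 l) / 2) ∧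
        (dressing k l p (J p) z).det ≠ 0) :
    IsDressing D A t k l (dressMat 0 k l J) := by
  have hJd {p : Param N} (hp : p ∈ D) (a : Fin 3) : DifferentiableAt ℂ (fun p => J p a) p :=
    differentiableAt_of_definesJ hDo hD hA ht hG hkl hdet hJ hp a
  have hmul : ∀ p ∈ D, ∀ j, (j = k ∨ j = l) →
      dressMat 0 k l J (p.1 j, p) * (A j p + t j • (1 : Mat2)) = 0 := by
    rintro p hp j (rfl | rfl)
    · rw [dressMat_apply_left (hD hp) hkl (hdet p hp) (hJ p hp), Matrix.smul_mul,
        eigenProj_firstColumns_mul (hG p hp _) (hdet p hp), smul_zero]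
    · rw [dressMat_apply_right (hD hp) hkl (hdet p hp) (hJ p hp), Matrix.smul_mul, sub_mul, one_mul,
        eigenProj_firstColumns_mul_right (hG p hp _) (hdet p hp), sub_self, smul_zero]
  refine ⟨fun p hp z => (hasMatDeriv_dressMat 0 (hD hp).1 (hJd hp) z).1, fun p hp z => ?_,
    fun p hp u z => exists_hasMatDeriv_matDeriv_dressMat 0 (hD hp).1 (hJd hp) u z,
    fun p z => dressMat_add_one z p, fun p z => dressMat_add_module z p, fun p hp => ?_, hmul⟩
  · refine HasMatDeriv.matDeriv (HasMatDeriv.congr_of_eventuallyEq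
      (hasMatDeriv_dressMat (k := k) (l := l) 1 (hD hp).1 (hJd hp) z).1 ?_)
    have : ∀ᶠ q : Total N in 𝓝 (z, p), q.2 ∈ D :=
      continuousAt_snd.eventually (hDo.mem_nhds hp)
    filter_upwards [this] with q hq
    exact (hasMatDeriv_dressMat 0 (hD hq).1 (hJd hq) q.1).2
  · refine exists_det_dressMat (hD hp) hkl (hJd hp) ?_ ?_ (hne p hp)
    · rw [dressMat_apply_left (hD hp) hkl (hdet p hp) (hJ p hp), Matrix.det_smul, det_eigenProj,
        mul_zero]
    · have h1 : (1 - eigenProj (firstColumns (G k p) (G l p))).det = 0 := by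
        have h2 := det_eigenProj (firstColumns (G k p) (G l p))
        have h3 := trace_eigenProj (hdet p hp)
        rw [Matrix.trace_fin_two] at h3
        rw [Matrix.det_fin_two] at h2 ⊢
        simp
        linear_combination h2 - h3
      rw [dressMat_apply_right (hD hp) hkl (hdet p hp) (hJ p hp), Matrix.det_smul, h1, mul_zero]

end

/-! ### The connection near its poles and its quasi-periods -/

lemma tendsto_twistSum {α : Type*} {l : Filter α} (M : Mat2) {s : Fin 3 → α → ℂ} {s₀ : Fin 3 → ℂ}
    (h : ∀ a, Tendsto (s a) l (𝓝 (s₀ a))) :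
    Tendsto (fun x => twistSum M fun a => s a x) l (𝓝 (twistSum M s₀)) :=
  tendsto_finsetSum _ fun a _ => ((h a).const_mul (coord M a)).smul_const (pauli a)

lemma HasMatDeriv.twist_const {s : Fin 3 → ℂ → ℂ} {z : ℂ} (M : Mat2)
    (hs : ∀ a, DifferentiableAt ℂ (s a) z) :
    ∃ X, HasMatDeriv (fun y => twistSum M fun a => s a y) X z :=
  ⟨_, (hasMatDeriv_const M z).twist fun a => (hs a).hasFDerivAt⟩

lemma exists_hasMatDeriv_sum {E ι : Type*} [NormedAddCommGroup E] [NormedSpace ℂ E] (s : Finset ι)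
    {Φ : ι → E → Mat2} {x : E} (h : ∀ i ∈ s, ∃ X, HasMatDeriv (Φ i) X x) :
    ∃ X, HasMatDeriv (fun y => ∑ i ∈ s, Φ i y) X x := by
  choose! X hX using h
  exact ⟨_, HasMatDeriv.sum s hX⟩

lemma differentiableAt_w {μ z : ℂ} (hμ : 0 < μ.im) (a : Fin 3) (hz : ¬ InLattice μ z) :
    DifferentiableAt ℂ (fun u => w a u μ) z :=
  DifferentiableAt.comp z (g := fun x : ℂ × ℂ => w a x.1 x.2) (f := fun u => (u, μ))
    ((contDiffAt_w 1 a hμ hz).differentiableAt (by simp))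
    (differentiableAt_id.prodMk (differentiableAt_const μ))

lemma differentiableAt_Z {μ z : ℂ} (hμ : 0 < μ.im) (a : Fin 3) (hz : ¬ InLattice μ z) :
    DifferentiableAt ℂ (fun u => Z a u μ) z :=
  DifferentiableAt.comp z (g := fun x : ℂ × ℂ => Z a x.1 x.2) (f := fun u => (u, μ))
    ((contDiffAt_Z 1 a hμ hz).differentiableAt (by simp))
    (differentiableAt_id.prodMk (differentiableAt_const μ))

lemma differentiableAt_comp_sub {f : ℂ → ℂ} {z c : ℂ} (h : DifferentiableAt ℂ f (z - c)) :
    DifferentiableAt ℂ (fun y => f (y - c)) z :=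
  DifferentiableAt.comp z (g := f) (f := fun y => y - c) h (differentiableAt_id.sub_const c)

lemma w_zero (a : Fin 3) (μ : ℂ) : w a 0 μ = 0 := by rw [w, theta1_zero, div_zero]

section

variable {N : ℕ} {D : Set (Param N)} {A : Fin N → Param N → Mat2} {p : Param N}

lemma exists_hasMatDeriv_conn (hp : p ∈ configSpace N) (u : Total N) {z : ℂ}
    (hz : ∀ j, ¬ InLattice p.2 (z - p.1 j)) :
    ∃ X, HasMatDeriv (fun y => conn A (y, p) u) X z := by
  have h (j : Fin N) : ∃ X, HasMatDeriv (fun y => twistSum (A j p) fun a =>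
      (u.1 - u.2.1 j) * w a (y - p.1 j) p.2 + u.2.2 * Z a (y - p.1 j) p.2) X z := by
    refine HasMatDeriv.twist_const _ fun a => DifferentiableAt.fun_add ?_ ?_
    · exact (differentiableAt_comp_sub (differentiableAt_w hp.1 a (hz j))).const_mul _
    · exact (differentiableAt_comp_sub (differentiableAt_Z hp.1 a (hz j))).const_mul _
  exact exists_hasMatDeriv_sum Finset.univ fun j _ => h j

lemma eventually_not_inLattice_of_ne (hp : p ∈ configSpace N) (j : Fin N) :
    ∀ᶠ z in 𝓝 (p.1 j), ∀ i, i ≠ j → ¬ InLattice p.2 (z - p.1 i) :=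
  eventually_all.2 fun i => by
    by_cases h : i = j
    · simp [h]
    · filter_upwards [eventually_not_inLattice_nhds hp.1 (hp.2 j i (Ne.symm h))] with z hz _
      exact hz

lemma eventually_not_inLattice_punctured (hp : p ∈ configSpace N) (z : ℂ) :
    ∀ᶠ u in 𝓝[≠] z, ∀ i, ¬ InLattice p.2 (u - p.1 i) :=
  eventually_all.2 fun i => eventually_not_inLattice hp.1 z (p.1 i)

/-- Along a direction in which `λ` moves together with `λ_j`, the connection is regular at
`λ = λ_j`. -/
lemma eventually_exists_hasMatDeriv_conn (hp : p ∈ configSpace N) (j : Fin N) (v : Param N) :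
    ∀ᶠ z in 𝓝 (p.1 j), ∃ X, HasMatDeriv (fun y => conn A (y, p) (v.1 j, v)) X z := by
  have hZ : ∀ᶠ z in 𝓝 (p.1 j), ∀ a, DifferentiableAt ℂ (fun u => Z a u p.2) (z - p.1 j) :=
    eventually_all.2 fun a => by
      have h : Tendsto (fun z => z - p.1 j) (𝓝 (p.1 j)) (𝓝 0) :=
        tendsto_sub_nhds_zero_iff.2 tendsto_id
      exact h.eventually (eventually_differentiableAt_Z a hp.1)
  filter_upwards [hZ, eventually_not_inLattice_of_ne hp j] with z hz hz'
  have h (i : Fin N) : ∃ X, HasMatDeriv (fun y => twistSum (A i p) fun a =>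
      (v.1 j - v.1 i) * w a (y - p.1 i) p.2 + v.2 * Z a (y - p.1 i) p.2) X z := by
    refine HasMatDeriv.twist_const _ fun a => DifferentiableAt.fun_add ?_ ?_
    · by_cases h : i = j
      · simp only [h, sub_self, zero_mul]
        exact differentiableAt_const _
      · exact (differentiableAt_comp_sub (differentiableAt_w hp.1 a (hz' i h))).const_mul _
    · by_cases h : i = j
      · rw [h]
        exact (differentiableAt_comp_sub (hz a)).const_mul _
      · exact (differentiableAt_comp_sub (differentiableAt_Z hp.1 a (hz' i h))).const_mul _
  exact exists_hasMatDeriv_sum Finset.univ fun i _ => h i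

lemma tendsto_conn_dir (hp : p ∈ configSpace N) (j : Fin N) (v : Param N) :
    Tendsto (fun z => conn A (z, p) (v.1 j, v)) (𝓝[≠] (p.1 j))
      (𝓝 (conn A (p.1 j, p) (v.1 j, v))) := by
  obtain ⟨X, hX⟩ := (eventually_exists_hasMatDeriv_conn (A := A) hp j v).self_of_nhds
  exact hX.continuousAt.tendsto.mono_left nhdsWithin_le_nhds

/-- The expansion of the connection at a pole. -/
lemma tendsto_conn_lam_sub (hp : p ∈ configSpace N) {j : Fin N} (hA : (A j p).trace = 0) :
    Tendsto (fun z => conn A (z, p) (1, 0) - (z - p.1 j)⁻¹ • A j p) (𝓝[≠] (p.1 j))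
      (𝓝 (conn A (p.1 j, p) (1, 0))) := by
  have h1 : ∀ z, conn A (z, p) (1, 0) - (z - p.1 j)⁻¹ • A j p =
      ∑ i, twistSum (A i p) fun a =>
        w a (z - p.1 i) p.2 - if i = j then (z - p.1 j)⁻¹ else 0 := by
    intro z
    have h2 : (z - p.1 j)⁻¹ • A j p =
        ∑ i, twistSum (A i p) fun _ => if i = j then (z - p.1 j)⁻¹ else 0 := by
      rw [Finset.sum_eq_single j]
      · simp only [if_true]
        conv_lhs => rw [← twistSum_one hA]
        rw [← twistSum_smul_right]
        simp
      · intro i _ hi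
        simp only [if_neg hi, twistSum_zero_right]
      · simp
    rw [h2, conn_lam, ← Finset.sum_sub_distrib]
    refine Finset.sum_congr rfl fun i _ => ?_
    rw [sub_eq_iff_eq_add, ← twistSum_add_right]
    simp
  simp only [h1]
  rw [conn_lam]
  refine tendsto_finsetSum _ fun i _ => tendsto_twistSum _ fun a => ?_
  by_cases hij : i = j
  · subst hij
    simp only [if_true, sub_self, w_zero]
    have := (tendsto_w_sub_inv hp.1 a).comp (f := fun z => z - p.1 i) (x := 𝓝[≠] (p.1 i))
      (tendsto_nhdsWithin_iff.2 ⟨tendsto_sub_nhdsNE _, by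
        filter_upwards [self_mem_nhdsWithin] with z hz using sub_ne_zero.2 hz⟩)
    simpa [Function.comp_def] using this
  · simp only [if_neg hij, sub_zero]
    exact (differentiableAt_comp_sub (differentiableAt_w hp.1 a
      (hp.2 j i (Ne.symm hij)))).continuousAt.tendsto.mono_left nhdsWithin_le_nhds

lemma total_eq_add_smul (j : Fin N) (u : Total N) :
    u = (u.2.1 j, u.2) + (u.1 - u.2.1 j) • ((1, 0) : Total N) := by
  refine Prod.ext ?_ ?_ <;> simp

lemma tendsto_smul_conn_lam (hp : p ∈ configSpace N) {j : Fin N} (hA : (A j p).trace = 0) :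
    Tendsto (fun z => (z - p.1 j) • conn A (z, p) (1, 0)) (𝓝[≠] (p.1 j)) (𝓝 (A j p)) := by
  have h := ((tendsto_sub_nhdsNE (p.1 j)).smul (tendsto_conn_lam_sub hp hA)).add_const (A j p)
  rw [zero_smul, zero_add] at h
  refine h.congr' ?_
  filter_upwards [self_mem_nhdsWithin] with z hz
  rw [smul_sub, smul_inv_smul₀ (sub_ne_zero.2 hz), sub_add_cancel]

lemma tendsto_smul_conn (hp : p ∈ configSpace N) {j : Fin N} (hA : (A j p).trace = 0)
    (u : Total N) :
    Tendsto (fun z => (z - p.1 j) • conn A (z, p) u) (𝓝[≠] (p.1 j))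
      (𝓝 ((u.1 - u.2.1 j) • A j p)) := by
  have h := ((tendsto_sub_nhdsNE (p.1 j)).smul (tendsto_conn_dir (A := A) hp j u.2)).add
    ((tendsto_smul_conn_lam hp hA).const_smul (u.1 - u.2.1 j))
  rw [zero_smul, zero_add] at h
  refine h.congr fun z => ?_
  conv_rhs => rw [total_eq_add_smul j u, conn_add, conn_smul]
  rw [smul_add, smul_comm]

lemma conn_add_one (hp : p ∈ configSpace N) (u : Total N) {z : ℂ}
    (hz : ∀ j, ¬ InLattice p.2 (z - p.1 j)) :
    conn A (z + 1, p) u = pauli 2 * conn A (z, p) u * pauli 2 := by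
  simp only [conn, Finset.mul_sum, Finset.sum_mul]
  refine Finset.sum_congr rfl fun j _ => ?_
  rw [← twistSum_conj pauli_conj_two]
  congr 1
  funext a
  rw [show z + 1 - p.1 j = z - p.1 j + 1 by ring, w_add_one, Z_add_one a hp.1 (hz j)]
  ring

/-- Translation by the variable period `μ`: the direction has to be translated as well. -/
lemma conn_add_module (hp : p ∈ configSpace N) (u : Total N) {z : ℂ}
    (hz : ∀ j, ¬ InLattice p.2 (z - p.1 j)) :
    conn A (z + p.2, p) (u.1 + u.2.2, u.2) = pauli 0 * conn A (z, p) u * pauli 0 := by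
  simp only [conn, Finset.mul_sum, Finset.sum_mul]
  refine Finset.sum_congr rfl fun j _ => ?_
  rw [← twistSum_conj pauli_conj_zero]
  congr 1
  funext a
  rw [show z + p.2 - p.1 j = z - p.1 j + p.2 by ring, w_add_module, Z_add_module a hp.1 (hz j)]
  ring

end

/-! ### The transformed connection -/

lemma tendsto_tracefree {α : Type*} {l : Filter α} {M : α → Mat2} {M₀ : Mat2}
    (h : Tendsto M l (𝓝 M₀)) : Tendsto (fun x => tracefree (M x)) l (𝓝 (tracefree M₀)) := by
  have hc : Continuous tracefree := by unfold tracefree; fun_prop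
  exact (hc.tendsto M₀).comp h

lemma tendsto_adjugate {α : Type*} {l : Filter α} {M : α → Mat2} {M₀ : Mat2}
    (h : Tendsto M l (𝓝 M₀)) : Tendsto (fun x => (M x).adjugate) l (𝓝 M₀.adjugate) := by
  have hc : Continuous (Matrix.adjugate : Mat2 → Mat2) := by fun_prop
  exact (hc.tendsto M₀).comp h

lemma tendsto_det {α : Type*} {l : Filter α} {M : α → Mat2} {M₀ : Mat2}
    (h : Tendsto M l (𝓝 M₀)) : Tendsto (fun x => (M x).det) l (𝓝 M₀.det) := by
  have hc : Continuous (Matrix.det : Mat2 → ℂ) := by fun_prop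
  exact (hc.tendsto M₀).comp h

lemma tendsto_coord {α : Type*} {l : Filter α} {M : α → Mat2} {M₀ : Mat2}
    (h : Tendsto M l (𝓝 M₀)) (a : Fin 3) : Tendsto (fun x => coord (M x) a) l (𝓝 (coord M₀ a)) := by
  have hc : Continuous fun M : Mat2 => coord M a := by unfold coord; fun_prop
  exact (hc.tendsto M₀).comp h

lemma tendsto_gauge {α : Type*} {l : Filter α} {H X : α → Mat2} {H₀ X₀ : Mat2}
    (hH : Tendsto H l (𝓝 H₀)) (hX : Tendsto X l (𝓝 X₀)) (h0 : H₀.det ≠ 0) :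
    Tendsto (fun x => gauge (H x) (X x)) l (𝓝 (gauge H₀ X₀)) :=
  ((tendsto_det hH).inv₀ h0).smul (tendsto_tracefree (hX.mul (tendsto_adjugate hH)))

lemma coord_tracefree (M : Mat2) (a : Fin 3) : coord (tracefree M) a = coord M a := by
  rw [tracefree, sub_eq_add_neg, ← neg_smul, coord_add, coord_smul, coord_one, mul_zero, add_zero]

lemma coord_gauge (H X : Mat2) (a : Fin 3) :
    coord (gauge H X) a = H.det⁻¹ * coord (X * H.adjugate) a := by
  rw [gauge, coord_smul, coord_tracefree]

section

variable {N : ℕ} {D : Set (Param N)} {A : Fin N → Param N → Mat2} {t : Fin N → ℂ} {k l : Fin N}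
  {H : Total N → Mat2} {p : Param N}

/-- The connection of the linear system satisfied by `FΨ`, where `F = H / √(det H)`. -/
def newConn (H : Total N → Mat2) (A : Fin N → Param N → Mat2) (q u : Total N) : Mat2 :=
  gauge (H q) (matDeriv H q u + H q * conn A q u)

/-- The residues of the transformed connection. At `λ_k` and `λ_l`, where `det H` has a simple zero
with the derivative `tr(H' adj H)`, they are obtained from the expansion of `H` and of the
connection up to order one in `λ - λ_j`; here `H' A_j adj H = t_j H' adj H`. Outside the set of
parameters on which `H` is a dressing matrix the value is irrelevant. -/
def newRes (H : Total N → Mat2) (A : Fin N → Param N → Mat2) (t : Fin N → ℂ) (k l j : Fin N)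
    (p : Param N) : Mat2 :=
  if j = k ∨ j = l then
    (matDeriv H (p.1 j, p) (1, 0) * (H (p.1 j, p)).adjugate).trace⁻¹ •
      tracefree (((1 + 2 * t j) • matDeriv H (p.1 j, p) (1, 0) +
        H (p.1 j, p) * conn A (p.1 j, p) (1, 0)) * (H (p.1 j, p)).adjugate)
  else gauge (H (p.1 j, p)) (H (p.1 j, p) * A j p)

lemma trace_newRes (H : Total N → Mat2) (A : Fin N → Param N → Mat2) (t : Fin N → ℂ) (k l j : Fin N)
    (p : Param N) : (newRes H A t k l j p).trace = 0 := by
  unfold newRes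
  split_ifs
  · rw [Matrix.trace_smul, trace_tracefree, smul_zero]
  · exact trace_gauge _ _

lemma trace_newConn (H : Total N → Mat2) (A : Fin N → Param N → Mat2) (q u : Total N) :
    (newConn H A q u).trace = 0 := trace_gauge _ _

namespace IsDressing

variable (h : IsDressing D A t k l H)

include h

lemma matDeriv_add (hp : p ∈ D) (z : ℂ) (u v : Total N) :
    matDeriv H (z, p) (u + v) = matDeriv H (z, p) u + matDeriv H (z, p) v :=
  (h.hasMatDeriv p hp z).map_add u v

lemma matDeriv_smul (hp : p ∈ D) (z a : ℂ) (u : Total N) :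
    matDeriv H (z, p) (a • u) = a • matDeriv H (z, p) u :=
  (h.hasMatDeriv p hp z).map_smul a u

lemma newConn_add (hp : p ∈ D) (z : ℂ) (u v : Total N) :
    newConn H A (z, p) (u + v) = newConn H A (z, p) u + newConn H A (z, p) v := by
  rw [newConn, newConn, newConn, h.matDeriv_add hp, conn_add, ← gauge_add, mul_add]
  congr 1
  abel

lemma newConn_smul (hp : p ∈ D) (z a : ℂ) (u : Total N) :
    newConn H A (z, p) (a • u) = a • newConn H A (z, p) u := by
  rw [newConn, newConn, h.matDeriv_smul hp, conn_smul, ← gauge_smul, Matrix.mul_smul, smul_add]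

lemma hasMatDeriv_fiber (hp : p ∈ D) (z : ℂ) :
    HasMatDeriv (fun y => H (y, p)) (fun y => matDeriv H (z, p) (y, 0)) z :=
  (h.hasMatDeriv p hp z).comp_prodMk

lemma tendsto_fiber (hp : p ∈ D) (z : ℂ) :
    Tendsto (fun y => H (y, p)) (𝓝[≠] z) (𝓝 (H (z, p))) :=
  (h.hasMatDeriv_fiber hp z).continuousAt.tendsto.mono_left nhdsWithin_le_nhds

lemma tendsto_matDeriv (hp : p ∈ D) (z : ℂ) (u : Total N) :
    Tendsto (fun y => matDeriv H (y, p) u) (𝓝[≠] z) (𝓝 (matDeriv H (z, p) u)) := by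
  obtain ⟨X, hX⟩ := h.exists_hasMatDeriv_fiber p hp u z
  exact hX.continuousAt.tendsto.mono_left nhdsWithin_le_nhds

lemma det_ne_zero (hD : D ⊆ configSpace N) (hp : p ∈ D) {z : ℂ}
    (hk : ¬ InLattice p.2 (z - p.1 k)) (hl : ¬ InLattice p.2 (z - p.1 l)) :
    (H (z, p)).det ≠ 0 := by
  obtain ⟨K, hK, hdet⟩ := h.det_eq p hp
  rw [hdet]
  exact mul_ne_zero hK
    (mul_ne_zero (theta1_ne_zero (hD hp).1 hk) (theta1_ne_zero (hD hp).1 hl))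

lemma matDeriv_add_one (hp : p ∈ D) (z : ℂ) (u : Total N) :
    matDeriv H (z + 1, p) u = (-1 : ℂ) • (pauli 2 * matDeriv H (z, p) u * pauli 2) := by
  have hg : HasFDerivAt (fun q : Total N => q + (1, 0)) (ContinuousLinearMap.id ℂ (Total N))
      (z, p) :=
    (hasFDerivAt_id _).add_const _
  have e : ((z, p) : Total N) + (1, 0) = (z + 1, p) := by simp
  have h1 := HasMatDeriv.comp (g := fun q : Total N => q + (1, 0)) (z, p)
    (by rw [e]; exact h.hasMatDeriv p hp (z + 1)) hg
  have h2 := (((h.hasMatDeriv p hp z).const_mul (pauli 2)).mul_const (pauli 2)).const_smul (-1)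
  refine h1.unique (h2.congr_of_eventuallyEq (Eventually.of_forall fun q => ?_)) u
  have := h.add_one q.2 q.1
  dsimp only
  rw [show q + (1, 0) = (q.1 + 1, q.2) by ext <;> simp]
  exact this

lemma newConn_add_one (hD : D ⊆ configSpace N) (hp : p ∈ D) (u : Total N) {z : ℂ}
    (hz : ∀ j, ¬ InLattice p.2 (z - p.1 j)) :
    newConn H A (z + 1, p) u = pauli 2 * newConn H A (z, p) u * pauli 2 := by
  rw [newConn, newConn, ← gauge_conj 2 (c := -1) (by simp), h.matDeriv_add_one hp,
    conn_add_one (hD hp) u hz, h.add_one]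
  congr 1
  rw [mul_add, add_mul, smul_add, Matrix.smul_mul]
  congr 2
  simp only [mul_assoc]
  rw [← mul_assoc (pauli 2) (pauli 2), pauli_mul_self, one_mul]

lemma exists_matDeriv_add_module (hp : p ∈ D) (z : ℂ) :
    ∃ m : Total N → ℂ, ∀ u : Total N, matDeriv H (z + p.2, p) (u.1 + u.2.2, u.2) =
      m u • (pauli 0 * H (z, p) * pauli 0) +
        (-quasiFactor (z - (p.1 k + p.1 l) / 2) p.2) •
          (pauli 0 * matDeriv H (z, p) u * pauli 0) := by
  set g' : Total N →L[ℂ] Total N := (ContinuousLinearMap.fst ℂ ℂ (Param N) +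
    (ContinuousLinearMap.snd ℂ (Fin N → ℂ) ℂ).comp (ContinuousLinearMap.snd ℂ ℂ (Param N))).prod
      (ContinuousLinearMap.snd ℂ ℂ (Param N)) with hg'
  have hg (u : Total N) : g' u = (u.1 + u.2.2, u.2) := rfl
  have h1 := HasMatDeriv.comp (g := g') (z, p)
    (by rw [hg]; exact h.hasMatDeriv p hp (z + p.2)) g'.hasFDerivAt
  have hq : DifferentiableAt ℂ (fun q : Total N =>
      -quasiFactor (q.1 - (q.2.1 k + q.2.1 l) / 2) q.2.2) (z, p) := by
    unfold quasiFactor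
    fun_prop
  have h2 := HasMatDeriv.smul hq.hasFDerivAt
    (((h.hasMatDeriv p hp z).const_mul (pauli 0)).mul_const (pauli 0))
  exact ⟨_, h1.unique (h2.congr_of_eventuallyEq (Eventually.of_forall fun q =>
    h.add_module q.2 q.1))⟩

lemma newConn_add_module (hD : D ⊆ configSpace N) (hp : p ∈ D) (u : Total N) {z : ℂ}
    (hz : ∀ j, ¬ InLattice p.2 (z - p.1 j)) :
    newConn H A (z + p.2, p) (u.1 + u.2.2, u.2) =
      pauli 0 * newConn H A (z, p) u * pauli 0 := by
  obtain ⟨m, hm⟩ := h.exists_matDeriv_add_module hp z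
  have hc := neg_ne_zero.2 (quasiFactor_ne_zero (z - (p.1 k + p.1 l) / 2) p.2)
  set c := -quasiFactor (z - (p.1 k + p.1 l) / 2) p.2 with hc'
  rw [newConn, newConn, ← gauge_conj 0 hc, hm, conn_add_module (hD hp) u hz, h.add_module, ← hc']
  -- the derivative of the scalar factor only contributes a multiple of `H`
  have e : m u • (pauli 0 * H (z, p) * pauli 0) + c • (pauli 0 * matDeriv H (z, p) u * pauli 0) +
        c • (pauli 0 * H (z, p) * pauli 0) * (pauli 0 * conn A (z, p) u * pauli 0) =
      (m u / c) • (c • (pauli 0 * H (z, p) * pauli 0)) +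
        c • (pauli 0 * (matDeriv H (z, p) u + H (z, p) * conn A (z, p) u) * pauli 0) := by
    rw [smul_smul, div_mul_cancel₀ _ hc, mul_add, add_mul, smul_add, Matrix.smul_mul, add_assoc]
    congr 3
    simp only [mul_assoc]
    rw [← mul_assoc (pauli 0) (pauli 0), pauli_mul_self, one_mul]
  rw [e, gauge_add, gauge_smul, gauge_self, smul_zero, zero_add]

/-- The derivative of `det H` at one of its zeros `λ_k`, `λ_l` does not vanish. -/
lemma trace_matDeriv_mul_adjugate_ne_zero (hD : D ⊆ configSpace N) (hkl : k ≠ l) (hp : p ∈ D)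
    {j : Fin N} (hj : j = k ∨ j = l) :
    (matDeriv H (p.1 j, p) (1, 0) * (H (p.1 j, p)).adjugate).trace ≠ 0 := by
  obtain ⟨K, hK, hdet⟩ := h.det_eq p hp
  have hμ := (hD hp).1
  obtain ⟨L, hL, hL'⟩ := (h.hasMatDeriv_fiber hp (p.1 j)).hasFDerivAt_det
  have hθ (i : Fin N) : HasDerivAt (fun z => theta1 (z - p.1 i) p.2)
      (-thetaD 1 (1 / 2) (1 / 2) (p.1 j - p.1 i) p.2) (p.1 j) :=
    (hasDerivAt_theta1 _ hμ).comp_sub_const (p.1 j) (p.1 i)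
  have h1 : HasDerivAt (fun z => (H (z, p)).det) _ (p.1 j) :=
    (((hθ k).mul (hθ l)).const_mul K).congr_of_eventuallyEq (Eventually.of_forall hdet)
  have h2 := hL.hasDerivAt.unique h1
  rw [hL'] at h2
  rw [h2]
  refine mul_ne_zero hK ?_
  have hd := neg_ne_zero.2 (thetaD_one_zero_ne_zero hμ)
  rcases hj with rfl | rfl
  · simp only [sub_self, theta1_zero, zero_mul, add_zero]
    exact mul_ne_zero hd (theta1_ne_zero hμ ((hD hp).2 _ _ hkl))
  · simp only [sub_self, theta1_zero, mul_zero, zero_add]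
    exact mul_ne_zero (theta1_ne_zero hμ ((hD hp).2 _ _ hkl.symm)) hd

lemma det_eq_zero (hp : p ∈ D) {j : Fin N} (hj : j = k ∨ j = l) : (H (p.1 j, p)).det = 0 := by
  obtain ⟨K, -, hdet⟩ := h.det_eq p hp
  rw [hdet]
  rcases hj with rfl | rfl <;> simp [theta1_zero]

/-- The adjugate of the relation `H(λ_j) (A_j + t_j) = 0`. -/
lemma mul_adjugate_eq (hp : p ∈ D) (htr : ∀ j, (A j p).trace = 0) {j : Fin N}
    (hj : j = k ∨ j = l) :
    A j p * (H (p.1 j, p)).adjugate = t j • (H (p.1 j, p)).adjugate := by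
  have h1 := congrArg Matrix.adjugate (h.mul_add_smul p hp j hj)
  rw [Matrix.adjugate_mul_distrib, adjugate_add, adjugate_smul', adjugate_of_trace_eq_zero (htr j),
    Matrix.adjugate_one, add_mul, Matrix.smul_mul, one_mul, neg_mul] at h1
  have h2 : (0 : Mat2).adjugate = 0 := by simp
  rw [h2, neg_add_eq_zero] at h1
  exact h1

/-- Differentiation of `H(λ_j) (A_j + t_j) = 0`, where `A_j` satisfies the Schlesinger system: in
the directions along which `λ` moves together with `λ_j`, the numerator of the transformed
connection vanishes at `λ_j`, so that there is no pole. -/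
lemma matDeriv_add_mul_adjugate_eq_zero (hDo : IsOpen D) (hS : SchlesingerSystem D A)
    (ht : ∀ j, t j ≠ 0) (hp : p ∈ D) {j : Fin N} (hj : j = k ∨ j = l) (v : Param N) :
    (matDeriv H (p.1 j, p) (v.1 j, v) + H (p.1 j, p) * conn A (p.1 j, p) (v.1 j, v)) *
      (H (p.1 j, p)).adjugate = 0 := by
  have hS' := schlesingerSystem_iff.1 hS p hp
  set g' : Param N →L[ℂ] Total N := (((ContinuousLinearMap.proj j : (Fin N → ℂ) →L[ℂ] ℂ)).comp
    (ContinuousLinearMap.fst ℂ (Fin N → ℂ) ℂ)).prod (ContinuousLinearMap.id ℂ (Param N)) with hg'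
  have hg (u : Param N) : g' u = (u.1 j, u) := rfl
  have h1 := HasMatDeriv.comp (g := g') p (by rw [hg]; exact h.hasMatDeriv p hp (p.1 j))
    g'.hasFDerivAt
  have h2 := h1.mul ((hS' j).2.add (hasMatDeriv_const (t j • (1 : Mat2)) p))
  have h3 := h2.unique ((hasMatDeriv_const 0 p).congr_of_eventuallyEq
    (by filter_upwards [hDo.mem_nhds hp] with q hq using h.mul_add_smul q hq j hj)) v
  simp only [hg, add_zero] at h3
  have h4 := h.mul_add_smul p hp j hj
  have h5 := h.mul_adjugate_eq hp (fun j => (hS' j).1) hj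
  set E := conn A (p.1 j, p) (v.1 j, v)
  set X := matDeriv H (p.1 j, p) (v.1 j, v)
  set H0 := H (p.1 j, p)
  have h6 : (X + H0 * E) * (A j p + t j • (1 : Mat2)) = 0 := by
    rw [mul_add, Matrix.mul_smul, mul_one, add_eq_zero_iff_eq_neg] at h4
    have h7 : H0 * A j p * E = -(t j • H0) * E := by rw [h4]
    rw [Ring.lie_def] at h3
    rw [← h3]
    simp only [add_mul, mul_add, mul_sub, Matrix.mul_smul, mul_one, ← mul_assoc, h7, neg_mul,
      Matrix.smul_mul]
    abel
  have h7 : (2 * t j) • ((X + H0 * E) * H0.adjugate) = 0 := by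
    have := congrArg (· * H0.adjugate) h6
    simp only [zero_mul, mul_assoc, add_mul, h5, Matrix.smul_mul, one_mul] at this
    rw [← this]
    simp only [add_mul, Matrix.mul_smul, mul_add, mul_assoc]
    module
  exact (smul_eq_zero.1 h7).resolve_left (mul_ne_zero two_ne_zero (ht j))

lemma tendsto_smul_newConn_of_ne (hD : D ⊆ configSpace N) (hp : p ∈ D)
    (htr : ∀ j, (A j p).trace = 0) {j : Fin N} (hj : ¬ (j = k ∨ j = l)) (u : Total N) :
    Tendsto (fun z => (z - p.1 j) • newConn H A (z, p) u) (𝓝[≠] (p.1 j))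
      (𝓝 ((u.1 - u.2.1 j) • newRes H A t k l j p)) := by
  rw [not_or] at hj
  have hd := h.det_ne_zero hD hp ((hD hp).2 j k hj.1) ((hD hp).2 j l hj.2)
  have h1 := tendsto_gauge (h.tendsto_fiber hp (p.1 j))
    (((tendsto_sub_nhdsNE (p.1 j)).smul (h.tendsto_matDeriv hp (p.1 j) u)).add
      ((h.tendsto_fiber hp (p.1 j)).mul (tendsto_smul_conn (hD hp) (htr j) u))) hd
  rw [newRes, if_neg (not_or.2 hj), ← gauge_smul, ← Matrix.mul_smul]
  rw [zero_smul, zero_add] at h1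
  refine h1.congr fun z => ?_
  rw [newConn, ← gauge_smul, smul_add, Matrix.mul_smul]

lemma tendsto_sub_div_det (hD : D ⊆ configSpace N) (hkl : k ≠ l) (hp : p ∈ D) {j : Fin N}
    (hj : j = k ∨ j = l) :
    Tendsto (fun z => (z - p.1 j) / (H (z, p)).det) (𝓝[≠] (p.1 j))
      (𝓝 (matDeriv H (p.1 j, p) (1, 0) * (H (p.1 j, p)).adjugate).trace⁻¹) := by
  obtain ⟨L, hL, hL'⟩ := (h.hasMatDeriv_fiber hp (p.1 j)).hasFDerivAt_det
  have h0 := h.trace_matDeriv_mul_adjugate_ne_zero hD hkl hp hj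
  have h1 := hL.hasDerivAt
  rw [hL'] at h1
  exact tendsto_sub_div_of_hasDerivAt h1 (h.det_eq_zero hp hj) h0

/-- At a zero of `det H` the transformed connection has a pole of order one only, since the terms of
order two cancel by `H(λ_j) (A_j + t_j) = 0`. -/
lemma tendsto_smul_newConn_lam (hD : D ⊆ configSpace N) (hkl : k ≠ l) (hp : p ∈ D)
    (htr : ∀ j, (A j p).trace = 0) {j : Fin N} (hj : j = k ∨ j = l) :
    Tendsto (fun z => (z - p.1 j) • newConn H A (z, p) (1, 0)) (𝓝[≠] (p.1 j))
      (𝓝 (newRes H A t k l j p)) := by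
  have hH := h.tendsto_fiber hp (p.1 j)
  have hslope := (h.hasMatDeriv_fiber hp (p.1 j)).tendsto_slope
  have hR := tendsto_conn_lam_sub (A := A) (hD hp) (htr j)
  have hX := h.tendsto_matDeriv hp (p.1 j) (1, 0)
  have h1 := (h.tendsto_sub_div_det hD hkl hp hj).smul (tendsto_tracefree
    (((hX.add (hslope.mul_const (A j p + t j • (1 : Mat2)))).add (hH.mul hR)).mul
      (tendsto_adjugate hH)))
  have e : newRes H A t k l j p =
      (matDeriv H (p.1 j, p) (1, 0) * (H (p.1 j, p)).adjugate).trace⁻¹ • tracefree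
      ((matDeriv H (p.1 j, p) (1, 0) +
        matDeriv H (p.1 j, p) (1, 0) * (A j p + t j • (1 : Mat2)) +
        H (p.1 j, p) * conn A (p.1 j, p) (1, 0)) * (H (p.1 j, p)).adjugate) := by
    rw [newRes, if_pos hj]
    congr 2
    simp only [add_mul, mul_add, mul_assoc, h.mul_adjugate_eq hp htr hj, Matrix.mul_smul,
      Matrix.smul_mul, mul_one]
    module
  rw [e]
  refine h1.congr' ?_
  filter_upwards [self_mem_nhdsWithin] with z hz
  have hz' : z - p.1 j ≠ 0 := sub_ne_zero.2 hz
  -- adding a multiple of `H` does not change the result, and makes the argument of order one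
  have e1 : (z - p.1 j) • newConn H A (z, p) (1, 0) =
      gauge (H (z, p)) ((z - p.1 j) • matDeriv H (z, p) (1, 0) +
        H (z, p) * ((z - p.1 j) • conn A (z, p) (1, 0)) + t j • H (z, p)) := by
    rw [gauge_add, gauge_smul _ (H (z, p)), gauge_self, smul_zero, add_zero, newConn,
      ← gauge_smul, smul_add, Matrix.mul_smul]
  have e2 : (z - p.1 j) • matDeriv H (z, p) (1, 0) +
        H (z, p) * ((z - p.1 j) • conn A (z, p) (1, 0)) + t j • H (z, p) =
      (z - p.1 j) • (matDeriv H (z, p) (1, 0) +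
        (z - p.1 j)⁻¹ • (H (z, p) - H (p.1 j, p)) * (A j p + t j • (1 : Mat2)) +
        H (z, p) * (conn A (z, p) (1, 0) - (z - p.1 j)⁻¹ • A j p)) := by
    rw [Matrix.smul_mul, sub_mul, h.mul_add_smul p hp j hj, sub_zero, mul_sub, mul_add]
    simp only [smul_add, smul_sub, smul_smul, Matrix.mul_smul, mul_one, mul_inv_cancel₀ hz',
      one_smul]
    rw [← mul_assoc, mul_inv_cancel₀ hz', one_mul]
    abel
  rw [e1, e2, gauge_smul, gauge, smul_smul, div_eq_mul_inv]

lemma tendsto_smul_newConn_dir (hDo : IsOpen D) (hD : D ⊆ configSpace N)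
    (hS : SchlesingerSystem D A) (ht : ∀ j, t j ≠ 0) (hkl : k ≠ l) (hp : p ∈ D) {j : Fin N}
    (hj : j = k ∨ j = l) (v : Param N) :
    Tendsto (fun z => (z - p.1 j) • newConn H A (z, p) (v.1 j, v)) (𝓝[≠] (p.1 j)) (𝓝 0) := by
  have hH := h.tendsto_fiber hp (p.1 j)
  have h1 := (h.tendsto_sub_div_det hD hkl hp hj).smul (tendsto_tracefree
    (((h.tendsto_matDeriv hp (p.1 j) (v.1 j, v)).add
      (hH.mul (tendsto_conn_dir (A := A) (hD hp) j v))).mul (tendsto_adjugate hH)))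
  rw [h.matDeriv_add_mul_adjugate_eq_zero hDo hS ht hp hj v] at h1
  have h2 : tracefree 0 = 0 := by simp [tracefree]
  rw [h2, smul_zero] at h1
  refine h1.congr fun z => ?_
  rw [newConn, gauge, smul_smul, div_eq_mul_inv]

lemma tendsto_smul_newConn (hDo : IsOpen D) (hD : D ⊆ configSpace N)
    (hS : SchlesingerSystem D A) (ht : ∀ j, t j ≠ 0) (hkl : k ≠ l) (hp : p ∈ D) (j : Fin N)
    (u : Total N) :
    Tendsto (fun z => (z - p.1 j) • newConn H A (z, p) u) (𝓝[≠] (p.1 j))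
      (𝓝 ((u.1 - u.2.1 j) • newRes H A t k l j p)) := by
  have htr : ∀ j, (A j p).trace = 0 := fun j => (hS p hp j).1
  by_cases hj : j = k ∨ j = l
  · have h1 := (h.tendsto_smul_newConn_dir hDo hD hS ht hkl hp hj u.2).add
      ((h.tendsto_smul_newConn_lam hD hkl hp htr hj).const_smul (u.1 - u.2.1 j))
    rw [zero_add] at h1
    refine h1.congr fun z => ?_
    conv_rhs => rw [total_eq_add_smul j u, h.newConn_add hp, h.newConn_smul hp]
    rw [smul_add, smul_comm]
  · exact h.tendsto_smul_newConn_of_ne hD hp htr hj u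

lemma differentiableAt_coord_newConn (hD : D ⊆ configSpace N) (hp : p ∈ D) (u : Total N) (a : Fin 3)
    {z : ℂ} (hz : ∀ j, ¬ InLattice p.2 (z - p.1 j)) :
    DifferentiableAt ℂ (fun y => coord (newConn H A (y, p) u) a) z := by
  obtain ⟨X, hX⟩ := h.exists_hasMatDeriv_fiber p hp u z
  obtain ⟨Y, hY⟩ := exists_hasMatDeriv_conn (A := A) (hD hp) u hz
  have hH := h.hasMatDeriv_fiber hp z
  obtain ⟨L, hL, -⟩ := ((hX.add (hH.mul hY)).mul hH.adjugate).hasFDerivAt_coord a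
  obtain ⟨L', hL', -⟩ := hH.hasFDerivAt_det
  simp only [newConn, coord_gauge]
  exact (hL'.differentiableAt.fun_inv (h.det_ne_zero hD hp (hz k) (hz l))).fun_mul
    hL.differentiableAt

/-- A Liouville argument: the difference of the transformed connection and the connection with the
residues `newRes` is an elliptic function without poles, which changes its sign along one of the
periods. -/
lemma newConn_eq_conn_of_module (hDo : IsOpen D) (hD : D ⊆ configSpace N)
    (hS : SchlesingerSystem D A) (ht : ∀ j, t j ≠ 0) (hkl : k ≠ l) (hp : p ∈ D) (u : Total N)
    (hmod : ∀ z, (∀ j, ¬ InLattice p.2 (z - p.1 j)) →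
      newConn H A (z + p.2, p) u - conn (newRes H A t k l) (z + p.2, p) u =
        pauli 0 * (newConn H A (z, p) u - conn (newRes H A t k l) (z, p) u) * pauli 0) {z : ℂ}
    (hz : ∀ j, ¬ InLattice p.2 (z - p.1 j)) :
    newConn H A (z, p) u = conn (newRes H A t k l) (z, p) u := by
  rw [← sub_eq_zero]
  set Δ : ℂ → Mat2 := fun y => newConn H A (y, p) u - conn (newRes H A t k l) (y, p) u with hΔ
  refine eq_zero_of_coord (by rw [Matrix.trace_sub, trace_newConn, trace_conn, sub_zero])
    fun a => ?_
  have hsub (M M' : Mat2) : coord (M - M') a = coord M a - coord M' a := by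
    simp [coord, mul_sub, Matrix.trace_sub, sub_div]
  refine eq_zero_of_periodic_up_to_sign (hD hp).1 p.1 (fun y => coord (Δ y) a) (fun z hz => ?_)
    (fun j => ?_) (signOne_eq a) (signModule_eq a) (signOne_or_signModule a) (fun z hz => ?_)
    (fun z hz => ?_) z hz
  · obtain ⟨Y, hY⟩ := exists_hasMatDeriv_conn (A := newRes H A t k l) (hD hp) u hz
    obtain ⟨L, hL, -⟩ := hY.hasFDerivAt_coord a
    simp only [hΔ, hsub]
    exact (h.differentiableAt_coord_newConn hD hp u a hz).fun_sub hL.differentiableAt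
  · have h1 := (h.tendsto_smul_newConn hDo hD hS ht hkl hp j u).sub
      (tendsto_smul_conn (A := newRes H A t k l) (hD hp) (j := j) (trace_newRes _ _ _ _ _ _ _) u)
    rw [sub_self] at h1
    have h2 := tendsto_coord h1 a
    have h3 : coord 0 a = 0 := by simp [coord]
    rw [h3] at h2
    refine h2.congr fun z => ?_
    rw [← smul_sub, coord_smul]
  · simp only [hΔ]
    rw [h.newConn_add_one hD hp u hz, conn_add_one (hD hp) u hz, ← sub_mul, ← mul_sub,
      coord_conj pauli_conj_two]
  · simp only [hΔ]
    rw [hmod z hz, coord_conj pauli_conj_zero]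

/-- The transformed connection is again a connection with simple poles of the same form. Translation
by `μ` changes a direction by a multiple of `∂/∂λ`, which is why this direction comes first. -/
theorem newConn_eq_conn (hDo : IsOpen D) (hD : D ⊆ configSpace N)
    (hS : SchlesingerSystem D A) (ht : ∀ j, t j ≠ 0) (hkl : k ≠ l) (hp : p ∈ D) (u : Total N)
        {z : ℂ}
    (hz : ∀ j, ¬ InLattice p.2 (z - p.1 j)) :
    newConn H A (z, p) u = conn (newRes H A t k l) (z, p) u := by
  have hlam : ∀ z, (∀ j, ¬ InLattice p.2 (z - p.1 j)) →
      newConn H A (z, p) (1, 0) = conn (newRes H A t k l) (z, p) (1, 0) := fun z hz => by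
    refine h.newConn_eq_conn_of_module hDo hD hS ht hkl hp (1, 0) (fun z hz => ?_) hz
    have h1 := h.newConn_add_module hD hp (1, 0) hz
    have h2 := conn_add_module (A := newRes H A t k l) (hD hp) (1, 0) hz
    simp only [Prod.snd_zero, add_zero] at h1 h2
    rw [h1, h2, ← sub_mul, ← mul_sub]
  refine h.newConn_eq_conn_of_module hDo hD hS ht hkl hp u (fun z hz => ?_) hz
  have hz' : ∀ j, ¬ InLattice p.2 (z + p.2 - p.1 j) := fun j => by
    rw [inLattice_add_module_sub]; exact hz j
  have e : ((u.1 + u.2.2, u.2) : Total N) = u + u.2.2 • (1, 0) := by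
    refine Prod.ext ?_ ?_ <;> simp
  have h1 := h.newConn_add_module hD hp u hz
  have h2 := conn_add_module (A := newRes H A t k l) (hD hp) u hz
  rw [e, h.newConn_add hp, h.newConn_smul hp, hlam _ hz'] at h1
  rw [e, conn_add, conn_smul] at h2
  rw [mul_sub, sub_mul, ← h1, ← h2]
  abel

end IsDressing

end

/-! ### Zero curvature implies the Schlesinger system -/

section

variable {N : ℕ} {D : Set (Param N)} {A dA : Fin N → Param N → Mat2} {p : Param N}

/-- The linear map `(λ, p) ↦ (λ - λ_i, μ)`. -/
def poleMap (i : Fin N) : Total N →L[ℂ] ℂ × ℂ :=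
  (ContinuousLinearMap.fst ℂ ℂ (Param N) -
    (ContinuousLinearMap.proj i : (Fin N → ℂ) →L[ℂ] ℂ).comp
        ((ContinuousLinearMap.fst ℂ (Fin N → ℂ) ℂ).comp
          (ContinuousLinearMap.snd ℂ ℂ (Param N)))).prod
  ((ContinuousLinearMap.snd ℂ (Fin N → ℂ) ℂ).comp (ContinuousLinearMap.snd ℂ ℂ (Param N)))

lemma hasFDerivAt_w_poleMap (hp : p ∈ configSpace N) (i : Fin N) (a : Fin 3) {z : ℂ}
    (hz : ¬ InLattice p.2 (z - p.1 i)) :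
    HasFDerivAt (fun q : Total N => w a (q.1 - q.2.1 i) q.2.2)
      ((fderiv ℂ (fun x : ℂ × ℂ => w a x.1 x.2) (z - p.1 i, p.2)).comp (poleMap i)) (z, p) :=
  HasFDerivAt.comp (z, p) (g := fun x : ℂ × ℂ => w a x.1 x.2) (f := poleMap i)
    (((contDiffAt_w 1 a hp.1 hz).differentiableAt (by simp)).hasFDerivAt) (poleMap i).hasFDerivAt

lemma hasFDerivAt_Z_poleMap (hp : p ∈ configSpace N) (i : Fin N) (a : Fin 3) {z : ℂ}
    (hz : ¬ InLattice p.2 (z - p.1 i)) :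
    HasFDerivAt (fun q : Total N => Z a (q.1 - q.2.1 i) q.2.2)
      ((fderiv ℂ (fun x : ℂ × ℂ => Z a x.1 x.2) (z - p.1 i, p.2)).comp (poleMap i)) (z, p) :=
  HasFDerivAt.comp (z, p) (g := fun x : ℂ × ℂ => Z a x.1 x.2) (f := poleMap i)
    (((contDiffAt_Z 1 a hp.1 hz).differentiableAt (by simp)).hasFDerivAt) (poleMap i).hasFDerivAt

lemma HasMatDeriv.comp_snd {Φ X : Param N → Mat2} (h : HasMatDeriv Φ X p) (z : ℂ) :
    HasMatDeriv (fun q : Total N => Φ q.2) (fun u => X u.2) (z, p) :=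
  HasMatDeriv.comp (g := fun q : Total N => q.2) (z, p) h hasFDerivAt_snd

lemma hasMatDeriv_conn_lam (hp : p ∈ configSpace N) (hA : ∀ i, HasMatDeriv (A i) (dA i) p) {z : ℂ}
    (hz : ∀ j, ¬ InLattice p.2 (z - p.1 j)) :
    HasMatDeriv (fun q => conn A q (1, 0))
      (fun u => ∑ i, (twistSum (dA i u.2) (fun a => w a (z - p.1 i) p.2) +
        twistSum (A i p) fun a =>
          fderiv ℂ (fun x : ℂ × ℂ => w a x.1 x.2) (z - p.1 i, p.2) (u.1 - u.2.1 i, u.2.2)))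
      (z, p) := by
  have h1 (i : Fin N) := ((hA i).comp_snd z).twist fun a => hasFDerivAt_w_poleMap hp i a (hz i)
  have h2 := HasMatDeriv.sum Finset.univ fun i _ => h1 i
  exact h2.congr_of_eventuallyEq (Eventually.of_forall fun q => conn_lam A q)

lemma exists_hasMatDeriv_conn_total (hp : p ∈ configSpace N)
    (hA : ∀ i, HasMatDeriv (A i) (dA i) p) (u : Total N) {z : ℂ}
    (hz : ∀ j, ¬ InLattice p.2 (z - p.1 j)) :
    ∃ X, HasMatDeriv (fun q => conn A q u) X (z, p) := by
  have h1 (i : Fin N) := ((hA i).comp_snd z).twist fun a =>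
    ((hasFDerivAt_w_poleMap hp i a (hz i)).const_mul (u.1 - u.2.1 i)).add
      ((hasFDerivAt_Z_poleMap hp i a (hz i)).const_mul u.2.2)
  exact ⟨_, HasMatDeriv.sum Finset.univ fun i _ => h1 i⟩

lemma trace_eq_zero_of_hasMatDeriv {E : Type*} [NormedAddCommGroup E] [NormedSpace ℂ E]
    {Φ X : E → Mat2} {x : E} (h : HasMatDeriv Φ X x) (h0 : ∀ y, (Φ y).trace = 0) (u : E) :
    (X u).trace = 0 := by
  obtain ⟨L, hL, hL'⟩ := h.hasFDerivAt_trace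
  simp only [h0] at hL
  rw [← hL', hL.unique (hasFDerivAt_const 0 x)]
  rfl

lemma tendsto_sub_nhdsNE_nhdsNE (a : ℂ) : Tendsto (fun z => z - a) (𝓝[≠] a) (𝓝[≠] 0) :=
  tendsto_nhdsWithin_iff.2 ⟨tendsto_sub_nhdsNE a, by
    filter_upwards [self_mem_nhdsWithin] with z hz using sub_ne_zero.2 hz⟩

/-- The leading coefficient of the derivative of the connection at the moving pole `λ_j`. -/
lemma tendsto_smul_deriv_conn_lam (hp : p ∈ configSpace N) {j : Fin N} {v : Param N}
    (htr : (dA j v).trace = 0) :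
    Tendsto (fun z => (z - p.1 j) • ∑ i, (twistSum (dA i v) (fun a => w a (z - p.1 i) p.2) +
        twistSum (A i p) fun a =>
          fderiv ℂ (fun x : ℂ × ℂ => w a x.1 x.2) (z - p.1 i, p.2) (v.1 j - v.1 i, v.2)))
      (𝓝[≠] (p.1 j)) (𝓝 (dA j v)) := by
  have hsum : dA j v = ∑ i, if i = j then dA j v else 0 := by simp
  rw [hsum]
  simp only [Finset.smul_sum]
  refine tendsto_finsetSum _ fun i _ => ?_
  by_cases hij : i = j
  · subst hij
    simp only [if_true, smul_add, ← twistSum_smul_right, sub_self]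
    have h1 : Tendsto (fun z => twistSum (dA i v) fun a => (z - p.1 i) * w a (z - p.1 i) p.2)
        (𝓝[≠] (p.1 i)) (𝓝 (twistSum (dA i v) fun _ => 1)) :=
      tendsto_twistSum _ fun a => (tendsto_mul_w hp.1 a).comp (tendsto_sub_nhdsNE_nhdsNE (p.1 i))
    have h2 : Tendsto (fun z => twistSum (A i p) fun a => (z - p.1 i) *
        fderiv ℂ (fun x : ℂ × ℂ => w a x.1 x.2) (z - p.1 i, p.2) (0, v.2))
        (𝓝[≠] (p.1 i)) (𝓝 (twistSum (A i p) fun _ => v.2 * 0)) :=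
      tendsto_twistSum _ fun a => by
        refine (((tendsto_mul_fderiv_w a hp.1).comp
          (tendsto_sub_nhdsNE_nhdsNE (p.1 i))).const_mul v.2).congr fun z => ?_
        have e : ((0, v.2) : ℂ × ℂ) = v.2 • (0, 1) := by simp
        rw [e, map_smul, smul_eq_mul]
        simp only [Function.comp]
        ring
    rw [twistSum_one htr] at h1
    simp only [mul_zero, twistSum_zero_right] at h2
    simpa using h1.add h2
  · simp only [if_neg hij]
    have hl : ¬ InLattice p.2 (p.1 j - p.1 i) := hp.2 j i (Ne.symm hij)
    have h1 : Tendsto (fun z => twistSum (dA i v) fun a => w a (z - p.1 i) p.2) (𝓝[≠] (p.1 j))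
        (𝓝 (twistSum (dA i v) fun a => w a (p.1 j - p.1 i) p.2)) :=
      tendsto_twistSum _ fun a => (differentiableAt_comp_sub (differentiableAt_w hp.1 a
        hl)).continuousAt.tendsto.mono_left nhdsWithin_le_nhds
    have h2 : Tendsto (fun z => twistSum (A i p) fun a =>
        fderiv ℂ (fun x : ℂ × ℂ => w a x.1 x.2) (z - p.1 i, p.2) (v.1 j - v.1 i, v.2))
        (𝓝[≠] (p.1 j)) (𝓝 (twistSum (A i p) fun a =>
        fderiv ℂ (fun x : ℂ × ℂ => w a x.1 x.2) (p.1 j - p.1 i, p.2) (v.1 j - v.1 i, v.2))) :=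
      tendsto_twistSum _ fun a => by
        have hc : ContinuousAt (fderiv ℂ fun x : ℂ × ℂ => w a x.1 x.2) (p.1 j - p.1 i, p.2) :=
          ((contDiffAt_w 2 a hp.1 hl).fderiv_right (m := 1) (by norm_num)).continuousAt
        have hs : ContinuousAt (fun z : ℂ => ((z - p.1 i, p.2) : ℂ × ℂ)) (p.1 j) := by fun_prop
        have h3 : ContinuousAt (fun z : ℂ =>
            fderiv ℂ (fun x : ℂ × ℂ => w a x.1 x.2) (z - p.1 i, p.2)) (p.1 j) :=
          ContinuousAt.comp (g := fderiv ℂ fun x : ℂ × ℂ => w a x.1 x.2) hc hs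
        exact (h3.clm_apply continuousAt_const).tendsto.mono_left nhdsWithin_le_nhds
    simpa using (tendsto_sub_nhdsNE (p.1 j)).smul (h1.add h2)

/-- A function that is differentiable near a point has a bounded derivative there. -/
lemma tendsto_smul_of_hasMatDeriv {Φ : ℂ → Mat2} {a : ℂ} {Y : ℂ → Mat2}
    (h : ∀ᶠ z in 𝓝 a, ∃ X, HasMatDeriv Φ X z)
    (hY : ∀ᶠ z in 𝓝[≠] a, ∀ X, HasMatDeriv Φ X z → X 1 = Y z) :
    Tendsto (fun z => (z - a) • Y z) (𝓝[≠] a) (𝓝 0) := by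
  refine tendsto_pi_nhds.2 fun r => tendsto_pi_nhds.2 fun c => ?_
  have hd : ∀ᶠ z in 𝓝 a, DifferentiableAt ℂ (fun y => Φ y r c) z := by
    filter_upwards [h] with z ⟨X, L, hL, _⟩ using (hL r c).differentiableAt
  have hc : ContinuousAt (deriv fun y => Φ y r c) a :=
    (Complex.analyticAt_iff_eventually_differentiableAt.2 hd).deriv.continuousAt
  have h1 := (tendsto_sub_nhdsNE a).mul (hc.tendsto.mono_left nhdsWithin_le_nhds)
  rw [zero_mul] at h1
  refine h1.congr' ?_
  filter_upwards [hY, nhdsWithin_le_nhds h] with z hz hz'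
  obtain ⟨X, hX⟩ := hz'
  rw [Matrix.smul_apply, ← hz X hX, smul_eq_mul]
  obtain ⟨L, hL, hL'⟩ := hX
  rw [(hL r c).hasDerivAt.deriv, ← hL']
  rfl

/-- If the curvature of the connection vanishes, then the residues satisfy the Schlesinger
system: compare the residues at `λ_j` in the curvature equation. -/
theorem hasMatDeriv_of_zero_curvature (hp : p ∈ configSpace N)
    (hA : ∀ i, HasMatDeriv (A i) (dA i) p) (htr : ∀ i q, (A i q).trace = 0)
    (hcurv : ∀ z, (∀ j, ¬ InLattice p.2 (z - p.1 j)) → ∀ (v : Total N) (X Y : Total N → Mat2),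
      HasMatDeriv (fun q => conn A q (1, 0)) X (z, p) → HasMatDeriv (fun q => conn A q v) Y (z, p) →
      X v - Y (1, 0) = conn A (z, p) v * conn A (z, p) (1, 0) -
        conn A (z, p) (1, 0) * conn A (z, p) v) (j : Fin N) :
    HasMatDeriv (A j) (fun v => ⁅conn A (p.1 j, p) (v.1 j, v), A j p⁆) p := by
  refine (hA j).congr_deriv fun v => ?_
  have hdtr : (dA j v).trace = 0 := trace_eq_zero_of_hasMatDeriv (hA j) (htr j) v
  choose! Y hY using fun z (hz : ∀ j, ¬ InLattice p.2 (z - p.1 j)) =>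
    exists_hasMatDeriv_conn_total hp hA (v.1 j, v) hz
  have hlat := eventually_not_inLattice_punctured hp (p.1 j)
  have h1 := tendsto_smul_deriv_conn_lam (A := A) hp hdtr
  have h2 : Tendsto (fun z => (z - p.1 j) • Y z (1, 0)) (𝓝[≠] (p.1 j)) (𝓝 0) := by
    refine tendsto_smul_of_hasMatDeriv (eventually_exists_hasMatDeriv_conn (A := A) hp j v) ?_
    filter_upwards [hlat] with z hz X hX
    exact hX.unique (hY z hz).comp_prodMk 1
  have hE := tendsto_conn_dir (A := A) hp j v
  have hR := tendsto_smul_conn_lam hp (htr j p)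
  have h3 := (hE.mul hR).sub (hR.mul hE)
  have h4 := h1.sub h2
  rw [sub_zero] at h4
  rw [Ring.lie_def]
  refine tendsto_nhds_unique_of_eventuallyEq h4 h3 ?_
  filter_upwards [hlat] with z hz
  rw [← smul_sub, hcurv z hz (v.1 j, v) _ _ (hasMatDeriv_conn_lam hp hA hz) (hY z hz)]
  simp only [Matrix.mul_smul, Matrix.smul_mul, smul_sub]

end

/-! ### Differentiability of the transformed residues -/

section

variable {N : ℕ} {D : Set (Param N)} {A : Fin N → Param N → Mat2} {t : Fin N → ℂ} {k l : Fin N}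
  {H : Total N → Mat2} {p : Param N}

lemma exists_hasMatDeriv_inv_smul_tracefree {E : Type*} [NormedAddCommGroup E] [NormedSpace ℂ E]
    {f : E → ℂ} {Φ X : E → Mat2} {x : E} (hf : DifferentiableAt ℂ f x) (h0 : f x ≠ 0)
    (h : HasMatDeriv Φ X x) : ∃ Y, HasMatDeriv (fun y => (f y)⁻¹ • tracefree (Φ y)) Y x := by
  obtain ⟨L, hL, -⟩ := h.hasFDerivAt_trace
  have h1 := h.sub (hasMatDeriv_smul_const (hL.mul_const (2 : ℂ)⁻¹) (1 : Mat2))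
  exact ⟨_, HasMatDeriv.smul (hf.fun_inv h0).hasFDerivAt h1⟩

/-- The embedding `p ↦ (λ_j, p)`. -/
def atPole (j : Fin N) : Param N →L[ℂ] Total N :=
  ((ContinuousLinearMap.proj j : (Fin N → ℂ) →L[ℂ] ℂ).comp
    (ContinuousLinearMap.fst ℂ (Fin N → ℂ) ℂ)).prod (ContinuousLinearMap.id ℂ (Param N))

lemma exists_hasMatDeriv_conn_atPole (hp : p ∈ configSpace N)
    (hA : ∀ i, ∃ X, HasMatDeriv (A i) X p) (j : Fin N) :
    ∃ X, HasMatDeriv (fun p => conn A (p.1 j, p) (1, 0)) X p := by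
  choose dA hdA using hA
  have h1 (i : Fin N) : ∃ X, HasMatDeriv
      (fun p : Param N => twistSum (A i p) fun a => w a (p.1 j - p.1 i) p.2) X p := by
    by_cases hij : i = j
    · subst hij
      simp only [sub_self, w_zero, twistSum_zero_right]
      exact ⟨_, hasMatDeriv_const 0 p⟩
    · have hl : ¬ InLattice p.2 (p.1 j - p.1 i) := hp.2 j i (Ne.symm hij)
      exact ⟨_, (hdA i).twist fun a => HasFDerivAt.comp p (f := atPole j)
        (hasFDerivAt_w_poleMap hp i a hl) (atPole j).hasFDerivAt⟩
  obtain ⟨X, hX⟩ := exists_hasMatDeriv_sum Finset.univ fun i _ => h1 i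
  exact ⟨X, hX.congr_of_eventuallyEq (Eventually.of_forall fun q => conn_lam A (q.1 j, q))⟩

/-- The transformed residues are differentiable functions of the parameters. -/
lemma IsDressing.exists_hasMatDeriv_newRes (h : IsDressing D A t k l H) (hD : D ⊆ configSpace N)
    (hkl : k ≠ l) (hp : p ∈ D) (hA : ∀ i, ∃ X, HasMatDeriv (A i) X p) (j : Fin N) :
    ∃ X, HasMatDeriv (newRes H A t k l j) X p := by
  have hH := HasMatDeriv.comp (g := atPole j) p (h.hasMatDeriv p hp (p.1 j)) (atPole j).hasFDerivAt
  by_cases hj : j = k ∨ j = l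
  · have hH1 := HasMatDeriv.comp (g := atPole j) p (h.hasMatDeriv_lam p hp (p.1 j))
      (atPole j).hasFDerivAt
    obtain ⟨Y, hY⟩ := exists_hasMatDeriv_conn_atPole (hD hp) hA j
    obtain ⟨L, hL, -⟩ := (hH1.mul hH.adjugate).hasFDerivAt_trace
    obtain ⟨X, hX⟩ := exists_hasMatDeriv_inv_smul_tracefree hL.differentiableAt
      (h.trace_matDeriv_mul_adjugate_ne_zero hD hkl hp hj)
      (((hH1.const_smul (1 + 2 * t j)).add (hH.mul hY)).mul hH.adjugate)
    exact ⟨X, hX.congr_of_eventuallyEq (Eventually.of_forall fun q => if_pos hj)⟩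
  · obtain ⟨dA, hdA⟩ := hA j
    obtain ⟨L, hL, -⟩ := hH.hasFDerivAt_det
    have hj' := not_or.1 hj
    obtain ⟨X, hX⟩ := exists_hasMatDeriv_inv_smul_tracefree hL.differentiableAt
      (h.det_ne_zero hD hp ((hD hp).2 j k hj'.1) ((hD hp).2 j l hj'.2))
      ((hH.mul hdA).mul hH.adjugate)
    exact ⟨X, hX.congr_of_eventuallyEq (Eventually.of_forall fun q => if_neg hj)⟩

end

/-! ### Eigenvalues and residues -/

lemma exists_sq_eq (x : ℂ) : ∃ c : ℂ, c ^ 2 = x := IsAlgClosed.exists_pow_nat_eq x zero_lt_two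

lemma exists_diagonalizes_of_mul_eq {M G : Mat2} {s : ℂ} (hG : G.det ≠ 0)
    (h : M * G = G * Matrix.diagonal ![s, -s]) : ∃ G', Diagonalizes G' s M := by
  obtain ⟨c, hc⟩ := exists_sq_eq G.det⁻¹
  have hdet : (c • G).det = 1 := by
    rw [Matrix.det_smul, Fintype.card_fin, hc, inv_mul_cancel₀ hG]
  refine ⟨c • G, hdet, ?_⟩
  have h1 : M * (c • G) = (c • G) * Matrix.diagonal ![s, -s] := by
    rw [Matrix.mul_smul, h, Matrix.smul_mul]
  rw [← h1, mul_assoc, mul_inv_of_det (by rw [hdet]; exact one_ne_zero), mul_one]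

/-- At the other poles the new residue is the conjugate of the old one by `H(λ_j)`. -/
lemma exists_diagonalizes_gauge {G A H : Mat2} {s : ℂ} (h : Diagonalizes G s A) (hH : H.det ≠ 0) :
    ∃ G', Diagonalizes G' s (gauge H (H * A)) := by
  have hG : G.det ≠ 0 := by rw [h.1]; exact one_ne_zero
  refine exists_diagonalizes_of_mul_eq (G := H * G) ?_ ?_
  · rw [Matrix.det_mul]; exact mul_ne_zero hH hG
  · rw [← mul_assoc, gauge_mul_mul_self hH h.trace_eq_zero, mul_assoc, mul_assoc]
    congr 1
    conv_lhs => rw [h.2]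
    rw [mul_assoc, inv_mul_of_det hG, mul_one]

/-- A traceless matrix with an eigenvalue `s ≠ 0` is diagonalizable. -/
lemma exists_diagonalizes_of_det {M : Mat2} {s : ℂ} (hs : s ≠ 0) (htr : M.trace = 0)
    (hdet : M.det = -s ^ 2) : ∃ G, Diagonalizes G s M := by
  obtain ⟨a, b, c, d, rfl⟩ : ∃ a b c d, M = !![a, b; c, d] := ⟨_, _, _, _, Matrix.eta_fin_two M⟩
  rw [Matrix.trace_fin_two_of] at htr
  rw [Matrix.det_fin_two_of] at hdet
  obtain rfl : d = -a := by linear_combination htr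
  by_cases hb : b = 0
  · subst hb
    by_cases hc : c = 0
    · subst hc
      have : (a - s) * (a + s) = 0 := by linear_combination -hdet
      rcases mul_eq_zero.1 this with h | h
      · obtain rfl : a = s := by linear_combination h
        exact exists_diagonalizes_of_mul_eq (G := 1) (by simp)
          (mat2_ext (by simp) (by simp) (by simp) (by simp))
      · obtain rfl : a = -s := by linear_combination h
        exact exists_diagonalizes_of_mul_eq (G := !![0, -1; 1, 0]) (by simp)
          (mat2_ext (by simp) (by simp) (by simp) (by simp))
    · refine exists_diagonalizes_of_mul_eq (G := !![a + s, a - s; c, c]) ?_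
        (mat2_ext ?_ ?_ ?_ ?_)
      · rw [Matrix.det_fin_two_of, show (a + s) * c - (a - s) * c = 2 * s * c by ring]
        exact mul_ne_zero (mul_ne_zero two_ne_zero hs) hc
      all_goals simp [Matrix.mul_apply, Matrix.diagonal]
      · linear_combination -hdet
      · linear_combination -hdet
      · ring
      · ring
  · refine exists_diagonalizes_of_mul_eq (G := !![b, b; s - a, -s - a]) ?_ (mat2_ext ?_ ?_ ?_ ?_)
    · rw [Matrix.det_fin_two_of, show b * (-s - a) - b * (s - a) = -(2 * s * b) by ring]
      exact neg_ne_zero.2 (mul_ne_zero (mul_ne_zero two_ne_zero hs) hb)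
    all_goals simp [Matrix.mul_apply, Matrix.diagonal]
    · ring
    · ring
    · linear_combination -hdet
    · linear_combination -hdet

section

variable {N : ℕ} {D : Set (Param N)} {A : Fin N → Param N → Mat2} {t : Fin N → ℂ} {k l : Fin N}
  {H : Total N → Mat2} {p : Param N}

/-- The columns of `H(λ_j)` are eigenvectors of the new residue at `λ_j`, `j = k, l`. -/
lemma IsDressing.newRes_mul (h : IsDressing D A t k l H) (hD : D ⊆ configSpace N)
    (hkl : k ≠ l) (hp : p ∈ D) {j : Fin N} (hj : j = k ∨ j = l) :
    newRes H A t k l j p * H (p.1 j, p) = -(t j + 1 / 2) • H (p.1 j, p) := by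
  have hδ := h.trace_matDeriv_mul_adjugate_ne_zero hD hkl hp hj
  have h0 := h.det_eq_zero hp hj
  rw [newRes, if_pos hj]
  set H0 := H (p.1 j, p)
  set H1 := matDeriv H (p.1 j, p) (1, 0)
  have h1 : H0.adjugate * H0 = 0 := by rw [adjugate_mul_self, h0, zero_smul]
  have h2 : (((1 + 2 * t j) • H1 + H0 * conn A (p.1 j, p) (1, 0)) * H0.adjugate).trace =
      (1 + 2 * t j) * (H1 * H0.adjugate).trace := by
    rw [add_mul, Matrix.trace_add, Matrix.smul_mul, Matrix.trace_smul,
        Matrix.trace_mul_comm (H0 * _),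
      ← mul_assoc, h1, zero_mul, Matrix.trace_zero, add_zero, smul_eq_mul]
  rw [tracefree, h2, Matrix.smul_mul, sub_mul, mul_assoc, h1, mul_zero, zero_sub, Matrix.smul_mul,
    one_mul, smul_neg, smul_smul, neg_smul]
  congr 2
  field_simp
  ring

lemma IsDressing.exists_diagonalizes_newRes (h : IsDressing D A t k l H) (hD : D ⊆ configSpace N)
    (hkl : k ≠ l) (ht : ∀ j, t j + 1 / 2 ≠ 0) (hp : p ∈ D) {j : Fin N} {G : Mat2}
    (hG : Diagonalizes G (t j) (A j p)) :
    ∃ G', Diagonalizes G' (if j = k ∨ j = l then t j + 1 / 2 else t j)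
      (newRes H A t k l j p) := by
  by_cases hj : j = k ∨ j = l
  · rw [if_pos hj]
    have htr := trace_newRes H A t k l j p
    refine exists_diagonalizes_of_det (ht j) htr ?_
    have h1 := h.newRes_mul hD hkl hp hj
    have hH : H (p.1 j, p) ≠ 0 := fun h0 =>
      h.trace_matDeriv_mul_adjugate_ne_zero hD hkl hp hj (by rw [h0]; simp)
    set M := newRes H A t k l j p
    set s := t j + 1 / 2
    have h2 : (M + s • (1 : Mat2)) * H (p.1 j, p) = 0 := by
      rw [add_mul, h1, Matrix.smul_mul, one_mul, neg_smul, neg_add_cancel]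
    have h3 : (M + s • (1 : Mat2)).det = 0 := by
      have h4 : (M + s • (1 : Mat2)).det • H (p.1 j, p) = 0 := by
        have := adjugate_mul_self (M + s • (1 : Mat2))
        have h5 := congrArg (· * H (p.1 j, p)) this
        simpa [mul_assoc, h2] using h5.symm
      exact (smul_eq_zero.1 h4).resolve_right hH
    rw [Matrix.trace_fin_two] at htr
    rw [Matrix.det_fin_two] at h3 ⊢
    simp at h3
    linear_combination h3 - s * htr
  · rw [if_neg hj, newRes, if_neg hj]
    have hj' := not_or.1 hj
    exact exists_diagonalizes_gauge hG
      (h.det_ne_zero hD hp ((hD hp).2 j k hj'.1) ((hD hp).2 j l hj'.2))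

/-- The residue of a function with at most a simple pole. -/
lemma residue_of_tendsto {f : ℂ → ℂ} {a R b : ℂ}
    (hf : ∀ᶠ z in 𝓝[≠] a, DifferentiableAt ℂ f z)
    (hlim : Tendsto (fun z => f z - (z - a)⁻¹ * R) (𝓝[≠] a) (𝓝 b)) :
    MeromorphicAt f a ∧
      ∀ᶠ ρ : ℝ in 𝓝[>] 0, (2 * Real.pi * Complex.I)⁻¹ * (∮ u in C(a, ρ), f u) = R := by
  set g : ℂ → ℂ := Function.update (fun z => f z - (z - a)⁻¹ * R) a b with hg
  have hgne : ∀ z, z ≠ a → g z = f z - (z - a)⁻¹ * R := fun z hz => Function.update_of_ne hz _ _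
  have hgd : ∀ᶠ z in 𝓝[≠] a, DifferentiableAt ℂ g z := by
    filter_upwards [hf, self_mem_nhdsWithin] with z hz hza
    have h1 : DifferentiableAt ℂ (fun z => f z - (z - a)⁻¹ * R) z :=
      hz.fun_sub (((differentiableAt_id.sub_const a).fun_inv (sub_ne_zero.2 hza)).mul_const R)
    refine h1.congr_of_eventuallyEq ?_
    filter_upwards [isOpen_ne.mem_nhds hza] with y hy using hgne y hy
  have hga : AnalyticAt ℂ g a :=
    Complex.analyticAt_of_differentiable_on_punctured_nhds_of_continuousAt hgd
      (continuousAt_update_same.2 hlim)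
  constructor
  · have h1 : MeromorphicAt (fun z => g z + (z - a)⁻¹ * R) a :=
      hga.meromorphicAt.add (((MeromorphicAt.id a).sub (MeromorphicAt.const a a)).inv.mul
        (MeromorphicAt.const R a))
    refine h1.congr ?_
    filter_upwards [self_mem_nhdsWithin] with z hz
    rw [hgne z hz]
    ring
  · obtain ⟨ε, hε, hb⟩ := Metric.eventually_nhds_iff_ball.1 hga.eventually_analyticAt
    filter_upwards [Ioo_mem_nhdsGT hε] with ρ hρ
    have hgc : DifferentiableOn ℂ g (Metric.closedBall a ρ) := fun z hz =>
      (hb z (Metric.closedBall_subset_ball hρ.2 hz)).differentiableAt.differentiableWithinAt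
    have h0 : (∮ u in C(a, ρ), g u) = 0 :=
      (hgc.diffContOnCl_ball subset_rfl).circleIntegral_eq_zero hρ.1.le
    have h1 : (∮ u in C(a, ρ), f u) = ∮ u in C(a, ρ), (g u + (u - a)⁻¹ * R) := by
      refine circleIntegral.integral_congr hρ.1.le fun u hu => ?_
      have : u ≠ a := by rintro rfl; simp at hu; exact hρ.1.ne hu
      rw [hgne u this]
      ring
    have hi1 : CircleIntegrable g a ρ :=
      ContinuousOn.circleIntegrable hρ.1.le
        (hgc.continuousOn.mono Metric.sphere_subset_closedBall)
    have hi2 : CircleIntegrable (fun u => (u - a)⁻¹ * R) a ρ := by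
      refine ContinuousOn.circleIntegrable hρ.1.le ?_
      refine ((continuousOn_id.sub continuousOn_const).inv₀ fun u hu => ?_).mul continuousOn_const
      have : u ≠ a := by rintro rfl; simp at hu; exact hρ.1.ne hu
      exact sub_ne_zero.2 this
    have h2 : (∮ u in C(a, ρ), (u - a)⁻¹ * R) = (2 * Real.pi * Complex.I) * R := by
      have := circleIntegral.integral_smul_const (fun u => (u - a)⁻¹) R a ρ
      simp only [smul_eq_mul] at this
      rw [this, circleIntegral.integral_sub_center_inv a hρ.1.ne']
    rw [h1, circleIntegral.integral_add hi1 hi2, h0, h2, zero_add, ← mul_assoc,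
      inv_mul_cancel₀ Complex.two_pi_I_ne_zero, one_mul]

lemma hasResidue_conn (hp : p ∈ configSpace N) {j : Fin N} (hA : (A j p).trace = 0) :
    HasResidue (fun z => conn A (z, p) (1, 0)) (p.1 j) (A j p) := fun r c => by
  refine residue_of_tendsto (b := conn A (p.1 j, p) (1, 0) r c) ?_ ?_
  · filter_upwards [eventually_not_inLattice_punctured hp (p.1 j)] with z hz
    obtain ⟨X, L, hL, -⟩ := exists_hasMatDeriv_conn (A := A) hp (1, 0) hz
    exact (hL r c).differentiableAt
  · exact ((tendsto_pi_nhds.1 ((tendsto_pi_nhds.1 (tendsto_conn_lam_sub hp hA)) r)) c)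

end

/-! ### The transformed solution -/

section

variable {N : ℕ} {D : Set (Param N)} {X : Type*} {π : X → puncturedSpace D}
  {A : Fin N → Param N → Mat2} {t : Fin N → ℂ} {k l : Fin N} {H : Total N → Mat2}

lemma par_mem (π : X → puncturedSpace D) (x : X) : (proj π x).2 ∈ D := (π x).2.1

lemma not_inLattice_proj (π : X → puncturedSpace D) (x : X) (j : Fin N) :
    ¬ InLattice (proj π x).2.2 ((proj π x).1 - (proj π x).2.1 j) := (π x).2.2 j

lemma IsDressing.det_proj_ne_zero (h : IsDressing D A t k l H) (hD : D ⊆ configSpace N)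
    (π : X → puncturedSpace D) (x : X) : (H (proj π x)).det ≠ 0 :=
  h.det_ne_zero hD (par_mem π x) (not_inLattice_proj π x k) (not_inLattice_proj π x l)

lemma IsDressing.sqrt_ne_zero (h : IsDressing D A t k l H) (hD : D ⊆ configSpace N) {s : X → ℂ}
    (hs2 : ∀ x, s x ^ 2 = (H (proj π x)).det) (x : X) : s x ≠ 0 := fun h0 =>
  h.det_proj_ne_zero hD π x (by rw [← hs2, h0, zero_pow two_ne_zero])

/-- The monodromy of `FΨ` is that of `Ψ`, up to the sign in the monodromy of the square root
of `det H`. -/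
lemma hasMonodromy_mul_of_sqrt {F Ψ : X → Mat2} {s : X → ℂ} (hs2 : ∀ x, s x ≠ 0)
    (hF : ∀ x, F x = (s x)⁻¹ • H (proj π x)) {T : X → X} {S M : Mat2} (hSS : S * S = 1) {c : X → ℂ}
        (hc : ∀ x, c x ≠ 0)
    (hH : ∀ x, H (proj π (T x)) = c x • (S * H (proj π x) * S)) {ε : ℂ} (hε : ε * ε = 1)
    (hsT : ∀ x, s (T x) = ε * (c x * s x)) (hM : HasMonodromy Ψ T S M) :
    HasMonodromy (fun x => F x * Ψ x) T S (ε • M) := fun x => by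
  have h1 : F (T x) = ε • (S * F x * S) := by
    have hε0 : ε ≠ 0 := fun h => by simp [h] at hε
    rw [hF, hF, hH, hsT, Matrix.mul_smul, Matrix.smul_mul, smul_smul, smul_smul]
    congr 1
    have := hs2 x
    have := hc x
    field_simp
    linear_combination -hε
  dsimp only
  rw [h1, hM x, Matrix.smul_mul, Matrix.mul_smul]
  congr 1
  simp only [mul_assoc]
  rw [← mul_assoc S S, hSS, one_mul]

variable [TopologicalSpace X]

lemma continuous_proj (hπ : IsCoveringMap π) : Continuous (proj π) :=
  continuous_subtype_val.comp hπ.continuous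

lemma IsDressing.continuous_comp_proj (h : IsDressing D A t k l H) (hπ : IsCoveringMap π) :
    Continuous fun x => H (proj π x) :=
  continuous_iff_continuousAt.2 fun x =>
    ContinuousAt.comp (g := H) (h.hasMatDeriv _ (par_mem π x) (proj π x).1).continuousAt
      (continuous_proj hπ).continuousAt

lemma IsDressing.exists_sqrt_det [SimplyConnectedSpace X] (h : IsDressing D A t k l H)
    (hDo : IsOpen D) (hD : D ⊆ configSpace N) (hπ : IsCoveringMap π) :
    ∃ s : X → ℂ, Continuous s ∧ ∀ x, s x ^ 2 = (H (proj π x)).det := by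
  have : LocallyPathConnectedSpace X :=
    locallyPathConnectedSpace_of_isLocalHomeomorph (isLocalHomeomorph_proj hDo hD hπ)
  exact exists_continuous_sqrt (h.continuous_comp_proj hπ).matrix_det (h.det_proj_ne_zero hD π)

/-- A closed condition on the points of the covering holds everywhere if it holds outside the
translates by the lattice of a point depending on the parameters. -/
lemma forall_of_forall_not_inLattice (hDo : IsOpen D) (hD : D ⊆ configSpace N)
    (hπ : IsCoveringMap π) {S : Set X} (hS : IsClosed S) (c : Param N → ℂ)
    (h : ∀ x, ¬ InLattice (proj π x).2.2 ((proj π x).1 - c (proj π x).2) → x ∈ S) (x : X) :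
    x ∈ S := by
  obtain ⟨φ, hx, hφ⟩ := exists_chart hDo hD hπ x
  set p := (proj π x).2
  set z := (proj π x).1
  have hx' : φ x = (z, p) := by rw [← hφ]
  have hmem : (z, p) ∈ φ.target := by rw [← hx']; exact φ.map_source hx
  have hinv : ∀ q ∈ φ.target, proj π (φ.symm q) = q := fun q hq => by rw [hφ, φ.right_inv hq]
  have hcont : Tendsto (fun y => ((y, p) : Total N)) (𝓝 z) (𝓝 (z, p)) :=
    (Continuous.prodMk_left p).tendsto z
  have h1 : Tendsto (fun y => φ.symm (y, p)) (𝓝[≠] z) (𝓝 x) := by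
    have := (φ.continuousAt_symm hmem).tendsto.comp hcont
    rw [← hx', φ.left_inv hx] at this
    exact this.mono_left nhdsWithin_le_nhds
  refine hS.mem_of_tendsto h1 ?_
  filter_upwards [eventually_not_inLattice (hD (par_mem π x)).1 z (c p),
    nhdsWithin_le_nhds (hcont.eventually (φ.open_target.mem_nhds hmem))] with y hy hy'
  apply h
  rw [hinv _ hy']
  exact hy

/-- The branches of `f / √(det f)` are the matrices `H / s` with a square root `s` of `det H`. -/
theorem exists_isNormalizedDressing {J : Param N → Fin 3 → ℂ}
    (hH : IsDressing D A t k l (dressMat 0 k l J)) (hD : D ⊆ configSpace N)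
    (hπ : IsCoveringMap π) {s : X → ℂ} (hs : Continuous s)
    (hs2 : ∀ x, s x ^ 2 = (dressMat 0 k l J (proj π x)).det) :
    IsNormalizedDressing π k l J fun x => (s x)⁻¹ • dressMat 0 k l J (proj π x) := by
  have hs0 := hH.sqrt_ne_zero hD hs2
  refine ⟨(hs.inv₀ hs0).smul (hH.continuous_comp_proj hπ), fun x hx => ?_⟩
  have hμ := (hD (par_mem π x)).1
  have hθ : theta1 (lam π x - ((par π x).1 k + (par π x).1 l) / 2) (par π x).2 ≠ 0 :=
    theta1_ne_zero hμ hx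
  have e : dressMat 0 k l J (proj π x) =
      theta1 (lam π x - ((par π x).1 k + (par π x).1 l) / 2) (par π x).2 •
        dressing k l (par π x) (J (par π x)) (lam π x) := dressMat_eq_smul_dressing hμ hx
  have h2 := hs2 x
  rw [e, Matrix.det_smul, Fintype.card_fin] at h2
  generalize theta1 (lam π x - ((par π x).1 k + (par π x).1 l) / 2) (par π x).2 = θ at e h2 hθ
  refine ⟨s x / θ, ?_, div_ne_zero (hs0 x) hθ, ?_⟩
  · rw [div_pow, h2, mul_div_cancel_left₀ _ (pow_ne_zero 2 hθ)]
  · dsimp only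
    rw [e, smul_smul, inv_div, div_eq_inv_mul]

theorem IsNormalizedDressing.exists_sqrt [SimplyConnectedSpace X] {J : Param N → Fin 3 → ℂ}
    {F : X → Mat2} (hF : IsNormalizedDressing π k l J F)
    (hH : IsDressing D A t k l (dressMat 0 k l J)) (hDo : IsOpen D) (hD : D ⊆ configSpace N)
    (hπ : IsCoveringMap π) :
    ∃ s : X → ℂ, Continuous s ∧ (∀ x, s x ^ 2 = (dressMat 0 k l J (proj π x)).det) ∧
      ∀ x, F x = (s x)⁻¹ • dressMat 0 k l J (proj π x) := by
  obtain ⟨s, hs, hs2⟩ := hH.exists_sqrt_det hDo hD hπ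
  have hF0 := exists_isNormalizedDressing hH hD hπ hs hs2
  have hs0 := hH.sqrt_ne_zero hD hs2
  set F0 : X → Mat2 := fun x => (s x)⁻¹ • dressMat 0 k l J (proj π x) with hF0def
  have hdet (x : X) : (F0 x).det = 1 := by
    rw [hF0def, Matrix.det_smul, Fintype.card_fin, ← hs2, ← mul_pow, inv_mul_cancel₀ (hs0 x),
      one_pow]
  -- the quotient of the two branches is a continuous function with values `1` and `-1`
  set ε : X → ℂ := fun x => (F x * (F0 x).adjugate).trace / 2 with hε
  have hεc : Continuous ε :=
    ((hF.1.matrix_mul hF0.1.matrix_adjugate).matrix_trace).div_const 2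
  have hmem : ∀ x, x ∈ {x : X | F x = ε x • F0 x ∧ ε x ^ 2 = 1} := by
    refine forall_of_forall_not_inLattice hDo hD hπ ?_ (fun p => (p.1 k + p.1 l) / 2)
      fun x hx => ?_
    · exact (isClosed_eq hF.1 (hεc.smul hF0.1)).inter
        (isClosed_eq (hεc.pow 2) continuous_const)
    · obtain ⟨s1, hs1, hs10, h1⟩ := hF.2 x hx
      obtain ⟨s2, hs2', hs20, h2⟩ := hF0.2 x hx
      have h3 : F x = (s2 / s1) • F0 x := by
        rw [h1, h2, smul_smul]
        congr 1
        field_simp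
      have h4 : ε x = s2 / s1 := by
        rw [hε]
        dsimp only
        rw [h3, Matrix.smul_mul, mul_adjugate_self, hdet, Matrix.trace_smul, one_smul,
          Matrix.trace_one]
        simp
      refine ⟨by rw [h4, h3], ?_⟩
      rw [h4, div_pow, hs1, hs2', div_self]
      rw [← hs1]
      exact pow_ne_zero 2 hs10
  have hsign := sign_of_sq_eq_sq hεc continuous_const (fun _ => one_ne_zero (α := ℂ))
    fun x => by rw [(hmem x).2, one_pow]
  rcases hsign with h1 | h1
  · exact ⟨s, hs, hs2, fun x => by rw [(hmem x).1, h1, one_smul]⟩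
  · refine ⟨fun x => -s x, hs.neg, fun x => by rw [neg_sq, hs2], fun x => ?_⟩
    rw [(hmem x).1, h1, hF0def, smul_smul, inv_neg, neg_one_mul]

variable {F Ψ : X → Mat2} {s : X → ℂ}

/-- The derivative of `FΨ`. -/
theorem IsDressing.hasCoverMatDeriv_mul (h : IsDressing D A t k l H) (hDo : IsOpen D)
    (hD : D ⊆ configSpace N) (hπ : IsCoveringMap π) (hs : Continuous s)
    (hs2 : ∀ x, s x ^ 2 = (H (proj π x)).det) (hF : ∀ x, F x = (s x)⁻¹ • H (proj π x)) (x : X)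
    (hΨ : HasCoverMatDeriv π Ψ (fun u => conn A (proj π x) u * Ψ x) x) :
    HasCoverMatDeriv π (fun x => F x * Ψ x)
      (fun u => newConn H A (proj π x) u * (F x * Ψ x)) x := by
  obtain ⟨φ, hx, hφ⟩ := exists_chart hDo hD hπ x
  rw [hasCoverMatDeriv_iff φ hφ hx] at hΨ ⊢
  have hmem : proj π x ∈ φ.target := by rw [hφ]; exact φ.map_source hx
  have hinv : ∀ q ∈ φ.target, proj π (φ.symm q) = q := fun q hq => by rw [hφ, φ.right_inv hq]
  have hxx : φ.symm (proj π x) = x := by rw [hφ, φ.left_inv hx]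
  have hHd := h.hasMatDeriv (proj π x).2 (par_mem π x) (proj π x).1
  obtain ⟨L, hL, hL'⟩ := hHd.hasFDerivAt_det
  have hs0 := h.sqrt_ne_zero hD hs2 x
  have hev : ∀ᶠ q in 𝓝 (proj π x), s (φ.symm q) ^ 2 = (H q).det := by
    filter_upwards [φ.open_target.mem_nhds hmem] with q hq
    rw [hs2, hinv q hq]
  have hσ := hasFDerivAt_of_sq_eq (s := fun q => s (φ.symm q))
    (hs.continuousAt.comp (φ.continuousAt_symm hmem)) hev hL (by rw [hxx]; exact hs0)
  have hσi := (hasDerivAt_inv (x := s (φ.symm (proj π x)))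
    (by rw [hxx]; exact hs0)).comp_hasFDerivAt (proj π x) hσ
  rw [hxx] at hσi
  have hσi' : HasFDerivAt (fun q => (s (φ.symm q))⁻¹) (-(s x ^ 2)⁻¹ • (2 * s x)⁻¹ • L)
    (proj π x) := hσi
  have h1 := (HasMatDeriv.smul hσi' hHd).mul hΨ
  refine (h1.congr_of_eventuallyEq ?_).congr_deriv fun u => ?_
  · filter_upwards [φ.open_target.mem_nhds hmem] with q hq
    rw [hF, hinv q hq]
  · have hg := gauge_mul_self (h.det_proj_ne_zero hD π x)
      (matDeriv H (proj π x) u + H (proj π x) * conn A (proj π x) u)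
    have htr : (H (proj π x) * conn A (proj π x) u * (H (proj π x)).adjugate).trace = 0 := by
      rw [Matrix.trace_mul_comm, ← mul_assoc, adjugate_mul_self, Matrix.smul_mul, one_mul,
        Matrix.trace_smul, trace_conn, smul_zero]
    rw [add_mul, Matrix.trace_add, htr, add_zero] at hg
    have e : newConn H A (proj π x) u * (F x * Ψ x) =
        (s x)⁻¹ • (newConn H A (proj π x) u * H (proj π x)) * Ψ x := by
      rw [hF, ← mul_assoc, Matrix.mul_smul]
    have htr' : L u = (matDeriv H (proj π x) u * (H (proj π x)).adjugate).trace := hL' u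
    rw [e, newConn, hg, ← hs2, hxx, ← htr']
    change ((-(s x ^ 2)⁻¹ * ((2 * s x)⁻¹ * L u)) • H (proj π x) +
      (s x)⁻¹ • matDeriv H (proj π x) u) * Ψ x +
      ((s x)⁻¹ • H (proj π x)) * (conn A (proj π x) u * Ψ x) = _
    rw [← mul_assoc _ _ (Ψ x), ← add_mul, Matrix.smul_mul]
    congr 1
    match_scalars <;> field_simp

/-- The function `FΨ` satisfies the linear system with the residues `newRes`. -/
theorem IsDressing.linearSystem_mul (h : IsDressing D A t k l H) (hDo : IsOpen D)
    (hD : D ⊆ configSpace N) (hS : SchlesingerSystem D A) (ht : ∀ j, t j ≠ 0) (hkl : k ≠ l)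
    (hπ : IsCoveringMap π) (hs : Continuous s)
    (hs2 : ∀ x, s x ^ 2 = (H (proj π x)).det) (hF : ∀ x, F x = (s x)⁻¹ • H (proj π x))
    (hΨ : LinearSystem π A Ψ) : LinearSystem π (newRes H A t k l) fun x => F x * Ψ x := by
  rw [linearSystem_iff] at hΨ ⊢
  refine fun x => ⟨?_, ?_⟩
  · have hs0 : s x ≠ 0 := fun h0 => by
      apply h.det_proj_ne_zero hD π x
      rw [← hs2, h0]; simp
    rw [Matrix.det_mul, (hΨ x).1, hF, Matrix.det_smul, Fintype.card_fin, ← hs2, ← mul_pow,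
      inv_mul_cancel₀ hs0, one_pow, one_mul]
  · obtain ⟨L, hL, hL'⟩ := h.hasCoverMatDeriv_mul hDo hD hπ hs hs2 hF x (hΨ x).2
    refine ⟨L, hL, fun u => ?_⟩
    rw [hL']
    dsimp only
    rw [show newConn H A (proj π x) u = conn (newRes H A t k l) (proj π x) u from
      h.newConn_eq_conn hDo hD hS ht hkl (par_mem π x) u (not_inLattice_proj π x)]

lemma LinearSystem.isLogDeriv (hΨ : LinearSystem π A Ψ) :
    IsLogDeriv π Ψ fun p z => conn A (z, p) (1, 0) := fun x => by
  obtain ⟨hdet, L, hL, hL'⟩ := linearSystem_iff.1 hΨ x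
  refine ⟨L, hL, ?_⟩
  rw [hL', mul_assoc, mul_inv_of_det (by rw [hdet]; exact one_ne_zero), mul_one]
  rfl

/-- The connection of a linear system that has a solution is flat. -/
lemma LinearSystem.curvature_eq_zero (hΨ : LinearSystem π A Ψ) (hDo : IsOpen D)
    (hD : D ⊆ configSpace N) (hπ : IsCoveringMap π) (x : X) {u v : Total N}
    {Du Dv : Total N → Mat2} (hu : HasMatDeriv (fun q => conn A q u) Du (proj π x))
    (hv : HasMatDeriv (fun q => conn A q v) Dv (proj π x)) :
    Du v - Dv u = conn A (proj π x) v * conn A (proj π x) u -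
      conn A (proj π x) u * conn A (proj π x) v := by
  rw [linearSystem_iff] at hΨ
  obtain ⟨φ, hx, hφ⟩ := exists_chart hDo hD hπ x
  have hmem : proj π x ∈ φ.target := by rw [hφ]; exact φ.map_source hx
  refine zero_curvature (Φ := fun q => Ψ (φ.symm q)) (Ω := conn A)
    (M := (Ψ (φ.symm (proj π x))).adjugate) ?_ ?_ hu hv
  · filter_upwards [φ.open_target.mem_nhds hmem] with q hq
    have h1 := (hasCoverMatDeriv_iff φ hφ (φ.map_target hq)).1 (hΨ (φ.symm q)).2
    have h2 : proj π (φ.symm q) = q := by rw [hφ, φ.right_inv hq]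
    rwa [h2] at h1
  · rw [mul_adjugate_self, (hΨ _).1, one_smul]

/-- The residues of a linear system that has a solution satisfy the Schlesinger system. -/
theorem LinearSystem.schlesingerSystem (hΨ : LinearSystem π A Ψ) (hDo : IsOpen D)
    (hD : D ⊆ configSpace N) (hπ : IsCoveringMap π) (hπs : Function.Surjective π)
    (htr : ∀ j p, (A j p).trace = 0) (hA : ∀ p ∈ D, ∀ j, ∃ X, HasMatDeriv (A j) X p) :
    SchlesingerSystem D A := by
  rw [schlesingerSystem_iff]
  intro p hp j
  choose dA hdA using hA p hp
  refine ⟨htr j p, hasMatDeriv_of_zero_curvature (hD hp) hdA htr (fun z hz v X Y hX hY => ?_) j⟩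
  obtain ⟨x, hx⟩ := hπs ⟨(z, p), hp, hz⟩
  have hx' : proj π x = (z, p) := by rw [proj, hx]
  rw [← hx'] at hX hY ⊢
  exact hΨ.curvature_eq_zero hDo hD hπ x hX hY

/-! ### Monodromy of solutions -/

lemma hasCoverMatDeriv_comp (hDo : IsOpen D) (hD : D ⊆ configSpace N) (hπ : IsCoveringMap π)
    {T : X → X} (hT : Continuous T) {τ : Total N → Total N} {τ' : Total N →L[ℂ] Total N}
    (hTτ : ∀ x, proj π (T x) = τ (proj π x)) {x : X} (hτ : HasFDerivAt τ τ' (proj π x))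
    {Δ : Total N → Mat2} (h : HasCoverMatDeriv π Ψ Δ (T x)) :
    HasCoverMatDeriv π (fun x => Ψ (T x)) (fun u => Δ (τ' u)) x := by
  obtain ⟨φ, hx, hφ⟩ := exists_chart hDo hD hπ x
  obtain ⟨ψ, hTx, hψ⟩ := exists_chart hDo hD hπ (T x)
  rw [hasCoverMatDeriv_iff φ hφ hx]
  rw [hasCoverMatDeriv_iff ψ hψ hTx, hTτ] at h
  have hmem : proj π x ∈ φ.target := by rw [hφ]; exact φ.map_source hx
  have hxx : φ.symm (proj π x) = x := by rw [hφ, φ.left_inv hx]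
  refine (h.comp (proj π x) hτ).congr_of_eventuallyEq ?_
  have hc : ContinuousAt (fun q => T (φ.symm q)) (proj π x) :=
    hT.continuousAt.comp (φ.continuousAt_symm hmem)
  have h1 : ∀ᶠ q in 𝓝 (proj π x), T (φ.symm q) ∈ ψ.source :=
    hc.eventually (ψ.open_source.mem_nhds (by simpa only [hxx] using hTx))
  filter_upwards [h1, φ.open_target.mem_nhds hmem] with q hq hq'
  have h2 : proj π (φ.symm q) = q := by rw [hφ, φ.right_inv hq']
  rw [← h2, ← hTτ, h2, hψ, ψ.left_inv hq]

/-- Two solutions of the linear system differ by a constant matrix. -/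
lemma exists_const_of_hasCoverMatDeriv [PreconnectedSpace X] [Nonempty X] (hDo : IsOpen D)
    (hD : D ⊆ configSpace N) (hπ : IsCoveringMap π) (hΨ : LinearSystem π A Ψ) {Φ : X → Mat2}
    (hΦ : ∀ x, HasCoverMatDeriv π Φ (fun u => conn A (proj π x) u * Φ x) x) :
    ∃ M : Mat2, ∀ x, Φ x = Ψ x * M := by
  rw [linearSystem_iff] at hΨ
  have h0 : ∀ x, HasCoverMatDeriv π (fun x => (Ψ x).adjugate * Φ x) (fun _ => 0) x := fun x => by
    obtain ⟨φ, hx, hφ⟩ := exists_chart hDo hD hπ x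
    have hxx : φ.symm (proj π x) = x := by rw [hφ, φ.left_inv hx]
    have h1 := (hasCoverMatDeriv_iff φ hφ hx).1 (hΨ x).2
    have h2 := (hasCoverMatDeriv_iff φ hφ hx).1 (hΦ x)
    rw [hasCoverMatDeriv_iff φ hφ hx]
    refine (h1.adjugate.mul h2).congr_deriv fun u => ?_
    rw [Matrix.adjugate_mul_distrib, adjugate_of_trace_eq_zero (trace_conn _ _ _), hxx, mul_neg,
      neg_mul, mul_assoc, neg_add_cancel]
  obtain ⟨x₀⟩ := ‹Nonempty X›
  refine ⟨(Ψ x₀).adjugate * Φ x₀, fun x => ?_⟩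
  rw [← eq_of_hasCoverMatDeriv_zero hDo hD hπ h0 x x₀, ← mul_assoc, mul_adjugate_self, (hΨ x).1,
    one_smul, one_mul]

/-- The monodromy of a solution under a lift `T` of a symmetry `τ` of the connection. -/
lemma LinearSystem.exists_hasMonodromy [PreconnectedSpace X] [Nonempty X] (hΨ : LinearSystem π A Ψ)
    (hDo : IsOpen D) (hD : D ⊆ configSpace N) (hπ : IsCoveringMap π)
    {T : X → X} (hT : Continuous T) {τ : Total N → Total N} {τ' : Total N →L[ℂ] Total N}
    (hTτ : ∀ x, proj π (T x) = τ (proj π x)) (hτ : ∀ q, HasFDerivAt τ τ' q) {S : Mat2}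
    (hSS : S * S = 1)
    (hS : ∀ x u, conn A (proj π (T x)) (τ' u) = S * conn A (proj π x) u * S) :
    ∃ M, HasMonodromy Ψ T S M := by
  have h1 : ∀ x, HasCoverMatDeriv π (fun x => S * Ψ (T x))
      (fun u => conn A (proj π x) u * (S * Ψ (T x))) x := fun x => by
    have h2 := hasCoverMatDeriv_comp hDo hD hπ hT hTτ (hτ _) (linearSystem_iff.1 hΨ (T x)).2
    obtain ⟨φ, hx, hφ⟩ := exists_chart hDo hD hπ x
    rw [hasCoverMatDeriv_iff φ hφ hx] at h2 ⊢
    refine (h2.const_mul S).congr_deriv fun u => ?_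
    rw [hS, ← mul_assoc, ← mul_assoc, ← mul_assoc, hSS, one_mul, mul_assoc]
  obtain ⟨M, hM⟩ := exists_const_of_hasCoverMatDeriv hDo hD hπ hΨ h1
  refine ⟨M, fun x => ?_⟩
  rw [mul_assoc, ← hM, ← mul_assoc, hSS, one_mul]

lemma exists_sign_sqrt [PreconnectedSpace X] (hs : Continuous s) (hs0 : ∀ x, s x ≠ 0) {T : X → X}
    (hT : Continuous T) {c : X → ℂ} (hcc : Continuous c) (hc : ∀ x, c x ≠ 0)
    (h : ∀ x, s (T x) ^ 2 = c x ^ 2 * s x ^ 2) :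
    ∃ ε : ℂ, (ε = 1 ∨ ε = -1) ∧ ∀ x, s (T x) = ε * (c x * s x) := by
  rcases sign_of_sq_eq_sq (hs.comp hT) (hcc.mul hs) (fun x => mul_ne_zero (hc x) (hs0 x))
    (fun x => by rw [Pi.mul_apply, mul_pow]; exact h x) with h1 | h1
  · exact ⟨1, Or.inl rfl, fun x => by rw [one_mul]; exact h1 x⟩
  · exact ⟨-1, Or.inr rfl, fun x => by rw [neg_one_mul]; exact h1 x⟩

end

/-! ### Square roots along homotopies -/

lemma exists_continuous_sqrt_square {f : unitInterval × unitInterval → ℂ} (hf : Continuous f)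
    (h0 : ∀ x, f x ≠ 0) :
    ∃ r : unitInterval × unitInterval → ℂ, Continuous r ∧ ∀ x, r x ^ 2 = f x := by
  set e : ℝ × ℝ → unitInterval × unitInterval := fun x =>
    (Set.projIcc 0 1 zero_le_one x.1, Set.projIcc 0 1 zero_le_one x.2)
  have he : Continuous e :=
    (continuous_projIcc.comp continuous_fst).prodMk (continuous_projIcc.comp continuous_snd)
  obtain ⟨s, hs, hs2⟩ := exists_continuous_sqrt (hf.comp he) fun x => h0 _
  refine ⟨fun x => s (x.1, x.2), hs.comp (by fun_prop), fun x => ?_⟩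
  rw [hs2]
  simp [e, Set.projIcc_val]

lemma exists_sign_of_sq_eq_sq {Y : Type*} [TopologicalSpace Y] [PreconnectedSpace Y] {s s' : Y → ℂ}
    (hs : Continuous s) (hs' : Continuous s') (h0 : ∀ y, s' y ≠ 0)
    (h : ∀ y, s y ^ 2 = s' y ^ 2) : ∃ δ : ℂ, δ ≠ 0 ∧ ∀ y, s y = δ * s' y := by
  rcases sign_of_sq_eq_sq hs hs' h0 h with h1 | h1
  · exact ⟨1, one_ne_zero, fun y => by rw [one_mul, h1]⟩
  · exact ⟨-1, by simp, fun y => by rw [neg_one_mul, h1]⟩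

/-- Let `f` be a function on the square `[0, 1]²` with `f(u, 1) = C(u)² f(u, 0)`. The number
`√f(u, 1) / (C(u) √f(u, 0))`, where the square root is continued along the side `{u} × [0, 1]`, does
not depend on `u`. -/
lemma sqrt_monodromy_square {f : unitInterval × unitInterval → ℂ} (hf : Continuous f)
    (h0 : ∀ x, f x ≠ 0) {C : unitInterval → ℂ} (hC : Continuous C) (hC0 : ∀ u, C u ≠ 0)
    (hfC : ∀ u, f (u, 1) = C u ^ 2 * f (u, 0)) {r₀ r₁ : unitInterval → ℂ} (hr₀ : Continuous r₀)
    (hr₁ : Continuous r₁) (hf₀ : ∀ t, r₀ t ^ 2 = f (0, t)) (hf₁ : ∀ t, r₁ t ^ 2 = f (1, t)) {ε : ℂ}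
    (h : r₁ 1 = ε * (C 1 * r₁ 0)) : r₀ 1 = ε * (C 0 * r₀ 0) := by
  obtain ⟨r, hr, hr2⟩ := exists_continuous_sqrt_square hf h0
  have hrne (x : unitInterval × unitInterval) : r x ≠ 0 := fun hx => by
    apply h0 x
    rw [← hr2, hx]; simp
  obtain ⟨δ₀, -, e₀⟩ := exists_sign_of_sq_eq_sq hr₀ (hr.comp (Continuous.prodMk_right 0))
    (fun t => hrne _) fun t => by simp only [Function.comp, hf₀, hr2]
  obtain ⟨δ₁, hδ₁, e₁⟩ := exists_sign_of_sq_eq_sq hr₁ (hr.comp (Continuous.prodMk_right 1))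
    (fun t => hrne _) fun t => by simp only [Function.comp, hf₁, hr2]
  obtain ⟨δ, -, e⟩ := exists_sign_of_sq_eq_sq (hr.comp (Continuous.prodMk_left 1))
    (hC.mul (hr.comp (Continuous.prodMk_left 0))) (fun u => mul_ne_zero (hC0 u) (hrne _))
    fun u => by
      rw [Pi.mul_apply, mul_pow]
      simp only [Function.comp, hr2, hfC]
  simp only [Function.comp, Pi.mul_apply] at e₀ e₁ e
  have h1 : δ = ε := by
    rw [e₁, e₁, e] at h
    have h2 : C 1 * r (1, 0) ≠ 0 := mul_ne_zero (hC0 1) (hrne _)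
    have h3 : (δ₁ * (C 1 * r (1, 0))) * (δ - ε) = 0 := by linear_combination h
    exact sub_eq_zero.1 ((mul_eq_zero.1 h3).resolve_left (mul_ne_zero hδ₁ h2))
  rw [e₀, e₀, e, h1]
  ring

/-- The parametrization of the unit circle by `[0, 1]`. -/
def circlePoint (t : unitInterval) : ℂ :=
  Complex.exp (2 * Real.pi * Complex.I * ((t : ℝ) : ℂ))

lemma continuous_circlePoint : Continuous circlePoint := by
  unfold circlePoint; fun_prop

lemma norm_circlePoint (t : unitInterval) : ‖circlePoint t‖ = 1 := by
  rw [circlePoint, show 2 * Real.pi * Complex.I * ((t : ℝ) : ℂ) =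
    ((2 * Real.pi * t : ℝ) : ℂ) * Complex.I by push_cast; ring, Complex.norm_exp_ofReal_mul_I]

lemma circlePoint_zero : circlePoint 0 = 1 := by simp [circlePoint]
lemma circlePoint_one : circlePoint 1 = 1 := by simp [circlePoint, Complex.exp_two_pi_mul_I]

/-- A nowhere vanishing function on a closed disc has a square root on its boundary. -/
lemma exists_sqrt_circle {h : ℂ → ℂ} {c : ℂ} {R : ℝ} (hR : 0 < R)
    (hc : ContinuousOn h (Metric.closedBall c R)) (h0 : ∀ z ∈ Metric.closedBall c R, h z ≠ 0) :
    ∃ q : unitInterval → ℂ, Continuous q ∧ (∀ t, q t ^ 2 = h (c + R * circlePoint t)) ∧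
      q 1 = q 0 := by
  have hmem (x : unitInterval × unitInterval) :
      c + (x.1 : ℝ) * (R * circlePoint x.2) ∈ Metric.closedBall c R := by
    rw [mem_closedBall_iff_norm, add_sub_cancel_left, norm_mul, norm_mul, norm_circlePoint,
      Complex.norm_real, Complex.norm_real, mul_one, Real.norm_of_nonneg x.1.2.1,
      Real.norm_of_nonneg hR.le]
    exact mul_le_of_le_one_left hR.le x.1.2.2
  have hcont : Continuous fun x : unitInterval × unitInterval =>
      c + ((x.1 : ℝ) : ℂ) * (R * circlePoint x.2) := by
    have := continuous_circlePoint
    fun_prop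
  have hf : Continuous fun x : unitInterval × unitInterval =>
      h (c + ((x.1 : ℝ) : ℂ) * (R * circlePoint x.2)) := hc.comp_continuous hcont hmem
  obtain ⟨r, hr, hr2⟩ := exists_continuous_sqrt_square hf fun x => h0 _ (hmem x)
  have hrne (x : unitInterval × unitInterval) : r x ≠ 0 := fun hx => by
    apply h0 _ (hmem x)
    rw [← hr2, hx]; simp
  refine ⟨fun t => r (1, t), hr.comp (Continuous.prodMk_right 1), fun t => by simp [hr2], ?_⟩
  -- the sign by which the root changes along the circle of radius `u R` does not depend on `u`
  have hsq : ∀ u, (r (u, 1)) ^ 2 = (r (u, 0)) ^ 2 := fun u => by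
    rw [hr2, hr2]
    simp only [circlePoint_zero, circlePoint_one]
  -- at the centre of the disc the square root is constant
  have hcen : ∀ t, r (0, t) = r (0, 0) := by
    obtain ⟨δ, -, hδ⟩ := exists_sign_of_sq_eq_sq (s := fun t => r (0, t)) (s' := fun _ => r (0, 0))
      (hr.comp (Continuous.prodMk_right 0)) continuous_const (fun _ => hrne _)
      fun t => by rw [hr2, hr2]; simp
    have h1 : δ = 1 := mul_right_cancel₀ (hrne (0, 0)) (by rw [← hδ 0, one_mul])
    intro t
    rw [hδ t, h1, one_mul]
  obtain ⟨δ, -, hδ⟩ := exists_sign_of_sq_eq_sq (s := fun u => r (u, 1)) (s' := fun u => r (u, 0))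
      (hr.comp (Continuous.prodMk_left 1)) (hr.comp (Continuous.prodMk_left 0))
      (fun _ => hrne _) hsq
  have h1 : δ = 1 := mul_right_cancel₀ (hrne (0, 0)) (by rw [← hδ 0, one_mul, hcen])
  change r (1, 1) = r (1, 0)
  rw [hδ 1, h1, one_mul]

/-! ### The monodromy of the square root of `det H` -/

lemma thetaD_one_lattice_ne_zero {μ a : ℂ} (hμ : 0 < μ.im) (ha : InLattice μ a) :
    thetaD 1 (1 / 2) (1 / 2) a μ ≠ 0 := by
  obtain ⟨b, d, hbd⟩ := exists_theta1_add_lattice (μ := μ) ha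
  have h1 : HasDerivAt (fun z => theta1 (z + a) μ) (-thetaD 1 (1 / 2) (1 / 2) a μ) 0 :=
    HasDerivAt.comp_add_const 0 a (by rw [zero_add]; exact hasDerivAt_theta1 a hμ)
  have h2 : HasDerivAt (fun z => Complex.exp (b + d * z)) (Complex.exp (b + d * 0) * (d * 1)) 0 :=
    (((hasDerivAt_id (0 : ℂ)).const_mul d).const_add b).cexp
  have h3 := h2.mul (hasDerivAt_theta1 0 hμ)
  have h4 := h1.unique (h3.congr_of_eventuallyEq (Eventually.of_forall hbd))
  rw [theta1_zero, mul_zero, zero_add] at h4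
  intro h0
  rw [h0, neg_zero] at h4
  exact mul_ne_zero (Complex.exp_ne_zero _) (neg_ne_zero.2 (thetaD_one_zero_ne_zero hμ)) h4.symm

/-- A function with a single, simple zero at the centre of a disc: its square root changes its sign
along the boundary. -/
lemma exists_sqrt_circle_of_simple_zero {f : ℂ → ℂ} {f' c : ℂ} {R : ℝ} (hR : 0 < R)
    (hf : Continuous f) (hd : HasDerivAt f f' c) (hf' : f' ≠ 0) (hfc : f c = 0)
    (h0 : ∀ z ∈ Metric.closedBall c R, z ≠ c → f z ≠ 0) :
    ∃ q : unitInterval → ℂ, Continuous q ∧ (∀ t, q t ^ 2 = f (c + R * circlePoint t)) ∧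
      q 1 = -q 0 := by
  have hfz (z : ℂ) : (z - c) * dslope f c z = f z := by
    have := sub_smul_dslope f c z
    rw [hfc, sub_zero, smul_eq_mul] at this
    exact this
  have hcont : ContinuousOn (dslope f c) (Metric.closedBall c R) :=
    ((continuousOn_dslope univ_mem).2 ⟨hf.continuousOn, hd.differentiableAt⟩).mono
      (Set.subset_univ _)
  obtain ⟨q, hq, hq2, hq1⟩ := exists_sqrt_circle hR hcont fun z hz => by
    by_cases hzc : z = c
    · rw [hzc, dslope_same, hd.deriv]; exact hf'
    · intro h
      apply h0 z hz hzc
      rw [← hfz, h, mul_zero]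
  obtain ⟨ρ, hρ⟩ := exists_sq_eq (R : ℂ)
  refine ⟨fun t => ρ * Complex.exp (Real.pi * Complex.I * ((t : ℝ) : ℂ)) * q t, by fun_prop,
    fun t => ?_, ?_⟩
  · rw [mul_pow, mul_pow, hρ, hq2, ← Complex.exp_nat_mul, ← hfz, circlePoint, add_sub_cancel_left]
    congr 3
    push_cast
    ring
  · simp [hq1, Complex.exp_pi_mul_I]

section

variable {N : ℕ} {D : Set (Param N)} {X : Type*} [TopologicalSpace X] {π : X → puncturedSpace D}
  {A : Fin N → Param N → Mat2} {t : Fin N → ℂ} {k l : Fin N} {H : Total N → Mat2} {s : X → ℂ}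
  {T : X → X}

lemma continuous_lam (hπ : IsCoveringMap π) : Continuous (lam π) :=
  continuous_fst.comp (continuous_proj hπ)

lemma continuous_theta1_sub {μ : ℂ} (hμ : 0 < μ.im) (a : ℂ) :
    Continuous fun z => theta1 (z - a) μ :=
  (differentiable_theta1 hμ).continuous.comp (continuous_id.sub continuous_const)

lemma hasDerivAt_theta1_sub {μ : ℂ} (hμ : 0 < μ.im) (a z : ℂ) :
    HasDerivAt (fun z => theta1 (z - a) μ) (-thetaD 1 (1 / 2) (1 / 2) (z - a) μ) z :=
  HasDerivAt.comp_sub_const z a (hasDerivAt_theta1 _ hμ)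

/-- The square root of `ϑ₁(z - a) ϑ₁(z - b)` changes its sign along a small circle around `a`. -/
lemma exists_sqrt_circle_theta1 {μ a b c K : ℂ} (hμ : 0 < μ.im) (hK : K ≠ 0)
    (hab : ¬ InLattice μ (a - b)) (hca : InLattice μ (c - a)) {R : ℝ} (hR : 0 < R)
    (ha : ∀ z ∈ Metric.closedBall c R, InLattice μ (z - a) → z = c)
    (hb : ∀ z ∈ Metric.closedBall c R, InLattice μ (z - b) → z = c) :
    ∃ q : unitInterval → ℂ, Continuous q ∧ (∀ t, q t ^ 2 =
      K * (theta1 (c + R * circlePoint t - a) μ * theta1 (c + R * circlePoint t - b) μ)) ∧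
      q 1 = -q 0 := by
  have hcb : ¬ InLattice μ (c - b) := fun h => hab (by
    have := h.sub hca
    rwa [sub_sub_sub_cancel_left] at this)
  have hz := (theta1_eq_zero_iff hμ).2 hca
  have hd := ((hasDerivAt_theta1_sub hμ a c).mul (hasDerivAt_theta1_sub hμ b c)).const_mul K
  rw [hz, zero_mul, add_zero] at hd
  refine exists_sqrt_circle_of_simple_zero
    (f := fun z => K * (theta1 (z - a) μ * theta1 (z - b) μ)) hR
    (continuous_const.mul ((continuous_theta1_sub hμ a).mul (continuous_theta1_sub hμ b))) hd
    (mul_ne_zero hK (mul_ne_zero (neg_ne_zero.2 (thetaD_one_lattice_ne_zero hμ hca))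
      (theta1_ne_zero hμ hcb))) ?_ fun z hzm hzc => ?_
  · rw [hz, zero_mul, mul_zero]
  · exact mul_ne_zero hK (mul_ne_zero (theta1_ne_zero hμ fun h => hzc (ha z hzm h))
      (theta1_ne_zero hμ fun h => hzc (hb z hzm h)))

/-- Along a loop around `λ_j`, the square root of `det H` changes its sign if and only if `j = k`
or `j = l`. -/
theorem IsDressing.sqrt_of_encircles (h : IsDressing D A t k l H) (hD : D ⊆ configSpace N)
    (hkl : k ≠ l) (hs : Continuous s) (hs2 : ∀ x, s x ^ 2 = (H (proj π x)).det) {j : Fin N}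
    (hE : Encircles π T j) :
    ∃ x, s (T x) = (if j = k ∨ j = l then -1 else 1) * s x := by
  obtain ⟨x, Γ, c, R, E, hpar, hc, hR, hball, hne, h0, hper, h1⟩ := hE
  refine ⟨x, ?_⟩
  obtain ⟨K, hK, hdet⟩ := h.det_eq (par π x) (par_mem π x)
  have hp : par π x ∈ configSpace N := hD (par_mem π x)
  have hμ := hp.1
  set p := par π x
  have hprod : Continuous fun z =>
      K * (theta1 (z - p.1 k) p.2 * theta1 (z - p.1 l) p.2) :=
    continuous_const.mul ((continuous_theta1_sub hμ _).mul (continuous_theta1_sub hμ _))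
  have hr0 : ∀ u, s (Γ u) ^ 2 =
      K * (theta1 (E (0, u) - p.1 k) p.2 * theta1 (E (0, u) - p.1 l) p.2) := fun u => by
    rw [hs2, ← hdet]
    congr 2
    exact Prod.ext (h0 u).symm (hpar u)
  have key : ∃ q : unitInterval → ℂ, Continuous q ∧ (∀ u, q u ^ 2 =
      K * (theta1 (c + R * circlePoint u - p.1 k) p.2 *
        theta1 (c + R * circlePoint u - p.1 l) p.2)) ∧
      q 1 = (if j = k ∨ j = l then -1 else 1) * q 0 := by
    by_cases hj : j = k ∨ j = l
    · simp only [if_pos hj, neg_one_mul]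
      rcases hj with rfl | rfl
      · exact exists_sqrt_circle_theta1 hμ hK (hp.2 _ _ hkl) hc hR (hball _) (hball _)
      · obtain ⟨q, hq, hq2, hq1⟩ :=
          exists_sqrt_circle_theta1 hμ hK (hp.2 _ _ hkl.symm) hc hR (hball j) (hball k)
        exact ⟨q, hq, fun u => by rw [hq2, mul_comm (theta1 _ _)], hq1⟩
    · simp only [if_neg hj, one_mul]
      have hj' := not_or.1 hj
      have hnl (i : Fin N) (hi : j ≠ i) (z : ℂ) (hz : z ∈ Metric.closedBall c R) :
          ¬ InLattice p.2 (z - p.1 i) := fun hl => by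
        have h2 := hball i z hz hl
        rw [h2] at hl
        have h3 := hl.sub hc
        rw [sub_sub_sub_cancel_left] at h3
        exact hp.2 j i hi h3
      exact exists_sqrt_circle hR hprod.continuousOn fun z hz =>
        mul_ne_zero hK (mul_ne_zero (theta1_ne_zero hμ (hnl k hj'.1 z hz))
          (theta1_ne_zero hμ (hnl l hj'.2 z hz)))
  obtain ⟨q, hq, hq2, hq1⟩ := key
  have := sqrt_monodromy_square
    (f := fun y => K * (theta1 (E y - p.1 k) p.2 * theta1 (E y - p.1 l) p.2))
    (hprod.comp E.continuous)
    (fun y => mul_ne_zero hK (mul_ne_zero (theta1_ne_zero hμ (hne y.1 y.2 k))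
      (theta1_ne_zero hμ (hne y.1 y.2 l))))
    (C := fun _ => 1) continuous_const (fun _ => one_ne_zero)
    (fun u => by simp only [hper u, one_pow, one_mul])
    (r₀ := fun u => s (Γ u)) (r₁ := q) (hs.comp Γ.continuous) hq hr0
    (fun u => by rw [hq2]; simp only [h1, circlePoint]) (by rw [one_mul]; exact hq1)
    (ε := if j = k ∨ j = l then -1 else 1)
  simpa only [one_mul, Γ.source, Γ.target] using this

/-- Along a path that avoids a cut from `λ_k` to `λ_l`, and translates `λ` by a period, the square
root of `det H` is multiplied by the square root of the factor of `det H` which is continuous in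
`λ_k` and `λ_l` and right for `λ_k = λ_l`: move `λ_k` to `λ_l` along the cut. -/
theorem IsDressing.sqrt_of_avoidsCut (h : IsDressing D A t k l H) (hD : D ⊆ configSpace N)
    (hπ : IsCoveringMap π) (hs : Continuous s) (hs2 : ∀ x, s x ^ 2 = (H (proj π x)).det)
    {ω : ℂ → ℂ} {m : ℂ → ℂ → ℂ} (hθ : ∀ z μ, theta1 (z + ω μ) μ = m z μ * theta1 z μ)
    (hmc : ∀ μ, Continuous fun z => m z μ) (hm0 : ∀ z μ, m z μ ≠ 0)
    (hm : ∀ z a b μ, m (z - (a + b) / 2) μ ^ 2 = m (z - a) μ * m (z - b) μ)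
    (hT : ∀ x, lam π (T x) = lam π x + ω (par π x).2) (hE : AvoidsCut π T k l) :
    ∃ x, s (T x) = m (lam π x - ((par π x).1 k + (par π x).1 l) / 2) (par π x).2 * s x := by
  obtain ⟨x, Γ, κ, hpar, hκ⟩ := hE
  refine ⟨x, ?_⟩
  obtain ⟨K, hK, hdet⟩ := h.det_eq (par π x) (par_mem π x)
  have hμ := (hD (par_mem π x)).1
  change 0 < (par π x).2.im at hμ
  have hlam : Continuous fun u => lam π (Γ u) := (continuous_lam hπ).comp Γ.continuous
  have hθc : Continuous fun z => theta1 z (par π x).2 := (differentiable_theta1 hμ).continuous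
  obtain ⟨ρ, hρ⟩ := exists_sq_eq K
  have hl1 : lam π (Γ 1) = lam π (Γ 0) + ω (par π x).2 := by rw [Γ.target, Γ.source, hT]
  have hκ1 : κ 1 = (par π x).1 l := κ.target
  have hθ1 (a : ℂ) : theta1 (lam π (Γ 1) - a) (par π x).2 =
      m (lam π (Γ 0) - a) (par π x).2 * theta1 (lam π (Γ 0) - a) (par π x).2 := by
    rw [hl1, ← hθ, add_sub_right_comm]
  have := sqrt_monodromy_square
    -- replace `λ_k` by the point `κ(u)` of the cut
    (f := fun y => K * (theta1 (lam π (Γ y.2) - κ y.1) (par π x).2 *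
      theta1 (lam π (Γ y.2) - (par π x).1 l) (par π x).2))
    (continuous_const.mul ((hθc.comp ((hlam.comp continuous_snd).sub
      (κ.continuous.comp continuous_fst))).mul
        (hθc.comp ((hlam.comp continuous_snd).sub continuous_const))))
    (fun y => mul_ne_zero hK (mul_ne_zero (theta1_ne_zero hμ (hκ y.1 y.2))
      (theta1_ne_zero hμ (by rw [← hκ1]; exact hκ 1 y.2))))
    (C := fun u => m (lam π (Γ 0) - (κ u + (par π x).1 l) / 2) (par π x).2)
    ((hmc (par π x).2).comp
      (continuous_const.sub ((κ.continuous.add continuous_const).div_const 2)))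
    (fun _ => hm0 _ _) (fun u => by rw [hm, hθ1, hθ1]; ring)
    (r₀ := fun u => s (Γ u)) (r₁ := fun u => ρ * theta1 (lam π (Γ u) - (par π x).1 l) (par π x).2)
    (hs.comp Γ.continuous) (continuous_const.mul (hθc.comp (hlam.sub continuous_const)))
    (fun u => by
      dsimp only
      rw [hs2, κ.source, ← hdet]
      congr 2
      exact Prod.ext rfl (hpar u))
    (fun u => by
      dsimp only
      rw [hκ1, mul_pow, hρ]; ring)
    (ε := 1)
    (by
      rw [hκ1, hθ1, add_self_div_two]; ring)
  simpa only [one_mul, Γ.source, Γ.target, κ.source] using this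

end

/-! ### Comparison of the monodromies -/

lemma sign_eq_of_exists {X : Type*} {s : X → ℂ} {T : X → X} {ε ε' : ℂ} {c : X → ℂ}
    (hs : ∀ x, s x ≠ 0) (hc : ∀ x, c x ≠ 0)
    (h : ∀ x, s (T x) = ε * (c x * s x)) (h' : ∃ x, s (T x) = ε' * (c x * s x)) : ε = ε' := by
  obtain ⟨x, hx⟩ := h'
  exact mul_right_cancel₀ (mul_ne_zero (hc x) (hs x)) ((h x).symm.trans hx)

lemma or_hasMonodromy_of_sign {X : Type*} {T : X → X} {S M : Mat2} {Φ : X → Mat2} {ε : ℂ}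
    (hε : ε = 1 ∨ ε = -1)
    (h : HasMonodromy Φ T S (ε • M)) : HasMonodromy Φ T S M ∨ HasMonodromy Φ T S (-M) := by
  rcases hε with rfl | rfl
  · exact Or.inl (by rwa [one_smul] at h)
  · exact Or.inr (by rwa [neg_one_smul] at h)

section

variable {N : ℕ} {D : Set (Param N)} {X : Type*} [TopologicalSpace X] {π : X → puncturedSpace D}
  {A : Fin N → Param N → Mat2} {t : Fin N → ℂ} {k l : Fin N} {H : Total N → Mat2}
  {F Ψ : X → Mat2} {s : X → ℂ} {T : X → X}

/-- Let `τ` be a symmetry of the connection, under which `H` is multiplied by a factor `c` (and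
conjugated with `S`), and let `T` be a lift of `τ` to the covering. The monodromies of `Ψ` and `FΨ`
under `T` agree up to the sign `ε` in `s ∘ T = ε c s`, where `s² = det H`. -/
lemma IsDressing.exists_hasMonodromy_mul [PreconnectedSpace X] [Nonempty X]
    (h : IsDressing D A t k l H) (hDo : IsOpen D) (hD : D ⊆ configSpace N) (hπ : IsCoveringMap π)
    (hs : Continuous s) (hs2 : ∀ x, s x ^ 2 = (H (proj π x)).det)
    (hF : ∀ x, F x = (s x)⁻¹ • H (proj π x)) (hΨ : LinearSystem π A Ψ) (hT : Continuous T)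
    {τ : Total N → Total N} {τ' : Total N →L[ℂ] Total N} (hTτ : ∀ x, proj π (T x) = τ (proj π x))
    (hτ : ∀ q, HasFDerivAt τ τ' q) {S : Mat2} (hSS : S * S = 1)
    (hS : ∀ x u, conn A (proj π (T x)) (τ' u) = S * conn A (proj π x) u * S)
    {c : X → ℂ} (hcc : Continuous c) (hc : ∀ x, c x ≠ 0)
    (hH : ∀ x, H (proj π (T x)) = c x • (S * H (proj π x) * S)) :
    ∃ (M : Mat2) (ε : ℂ), (ε = 1 ∨ ε = -1) ∧ (∀ x, s (T x) = ε * (c x * s x)) ∧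
      HasMonodromy Ψ T S M ∧ HasMonodromy (fun x => F x * Ψ x) T S (ε • M) := by
  obtain ⟨M, hM⟩ := hΨ.exists_hasMonodromy hDo hD hπ hT hTτ hτ hSS hS
  have hs0 := h.sqrt_ne_zero hD hs2
  obtain ⟨ε, hε, hsT⟩ := exists_sign_sqrt hs hs0 hT hcc hc fun x => by
    have hdet : S.det * S.det = 1 := by rw [← Matrix.det_mul, hSS, Matrix.det_one]
    rw [hs2, hs2, hH, Matrix.det_smul, Fintype.card_fin, Matrix.det_mul, Matrix.det_mul]
    linear_combination c x ^ 2 * (H (proj π x)).det * hdet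
  refine ⟨M, ε, hε, hsT, hM, hasMonodromy_mul_of_sqrt hs0 hF hSS hc hH ?_ hsT hM⟩
  rcases hε with rfl | rfl <;> simp

/-- The monodromy around a pole changes its sign exactly for the poles `λ_k` and `λ_l`. -/
theorem IsDressing.monodromy_encircles [PreconnectedSpace X] [Nonempty X]
    (h : IsDressing D A t k l H) (hDo : IsOpen D) (hD : D ⊆ configSpace N) (hkl : k ≠ l)
    (hπ : IsCoveringMap π) (hs : Continuous s) (hs2 : ∀ x, s x ^ 2 = (H (proj π x)).det)
    (hF : ∀ x, F x = (s x)⁻¹ • H (proj π x)) (hΨ : LinearSystem π A Ψ) (hT : Continuous T)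
    (hTπ : ∀ x, π (T x) = π x) {j : Fin N} (hE : Encircles π T j) :
    ∃ M : Mat2, HasMonodromy Ψ T 1 M ∧
      HasMonodromy (fun x => F x * Ψ x) T 1 (if j = k ∨ j = l then -M else M) := by
  have hTp (x : X) : proj π (T x) = proj π x := congrArg Subtype.val (hTπ x)
  obtain ⟨M, ε, -, hsT, hM, hM'⟩ := h.exists_hasMonodromy_mul hDo hD hπ hs hs2 hF hΨ hT
    (τ := fun q => q) hTp (fun q => hasFDerivAt_id q) (mul_one 1)
    (fun x u => by rw [hTp]; simp) (c := fun _ => 1) continuous_const (fun _ => one_ne_zero)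
    (fun x => by rw [hTp]; simp)
  refine ⟨M, hM, ?_⟩
  have hs0 := h.sqrt_ne_zero hD hs2
  have hε := sign_eq_of_exists (ε' := if j = k ∨ j = l then -1 else 1) hs0
    (fun _ => one_ne_zero) hsT (by
    obtain ⟨x, hx⟩ := h.sqrt_of_encircles hD hkl hs hs2 hE
    exact ⟨x, by rw [one_mul]; exact hx⟩)
  rw [hε, ite_smul, neg_one_smul, one_smul] at hM'
  exact hM'

/-- The monodromy along the `a`-cycle is preserved up to sign. -/
theorem IsDressing.monodromy_add_one [PreconnectedSpace X] [Nonempty X]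
    (h : IsDressing D A t k l H) (hDo : IsOpen D) (hD : D ⊆ configSpace N)
    (hπ : IsCoveringMap π) (hs : Continuous s) (hs2 : ∀ x, s x ^ 2 = (H (proj π x)).det)
    (hF : ∀ x, F x = (s x)⁻¹ • H (proj π x)) (hΨ : LinearSystem π A Ψ) (hT : Continuous T)
    (hTπ : ∀ x, lam π (T x) = lam π x + 1 ∧ par π (T x) = par π x) :
    ∃ M : Mat2, HasMonodromy Ψ T (pauli 2) M ∧
      (HasMonodromy (fun x => F x * Ψ x) T (pauli 2) M ∨
        HasMonodromy (fun x => F x * Ψ x) T (pauli 2) (-M)) ∧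
      (AvoidsCut π T k l → HasMonodromy (fun x => F x * Ψ x) T (pauli 2) M) := by
  have hTp (x : X) : proj π (T x) = ((proj π x).1 + 1, (proj π x).2) :=
    Prod.ext (hTπ x).1 (hTπ x).2
  obtain ⟨M, ε, hε, hsT, hM, hM'⟩ := h.exists_hasMonodromy_mul hDo hD hπ hs hs2 hF hΨ hT
    (τ := fun q => q + (1, 0)) (τ' := ContinuousLinearMap.id ℂ _)
    (fun x => by rw [hTp]; exact Prod.ext rfl (add_zero _).symm)
    (fun q => (hasFDerivAt_id q).add_const _) (pauli_mul_self 2)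
    (fun x u => by
      rw [hTp]
      exact conn_add_one (hD (par_mem π x)) u (not_inLattice_proj π x))
    (c := fun _ => -1) continuous_const (fun _ => by simp)
    (fun x => by rw [hTp]; exact h.add_one _ _)
  refine ⟨M, hM, or_hasMonodromy_of_sign hε hM', fun hE => ?_⟩
  have hs0 := h.sqrt_ne_zero hD hs2
  have hε1 : ε = 1 := sign_eq_of_exists hs0 (fun _ => by simp) hsT (by
    obtain ⟨x, hx⟩ := h.sqrt_of_avoidsCut hD hπ hs hs2 (ω := fun _ => 1) (m := fun _ _ => -1)
      (fun z μ => by rw [theta1_add_one, neg_one_mul]) (fun _ => continuous_const)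
      (fun _ _ => by simp) (fun _ _ _ _ => by simp) (fun x => (hTπ x).1) hE
    exact ⟨x, by rw [one_mul]; exact hx⟩)
  rwa [hε1, one_smul] at hM'

/-- The linear map `(λ, p) ↦ (λ + μ, p)`. -/
def addModule (N : ℕ) : Total N →L[ℂ] Total N :=
  (ContinuousLinearMap.fst ℂ ℂ (Param N) + (ContinuousLinearMap.snd ℂ (Fin N → ℂ) ℂ).comp
    (ContinuousLinearMap.snd ℂ ℂ (Param N))).prod (ContinuousLinearMap.snd ℂ ℂ (Param N))

lemma continuous_quasiFactor : Continuous fun x : ℂ × ℂ => quasiFactor x.1 x.2 := by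
  unfold quasiFactor
  fun_prop

/-- The monodromy along the `b`-cycle is preserved up to sign. The factor of `H` is the value at the
centre `(λ_k + λ_l)/2`, whose square is the product of the values at `λ_k` and `λ_l`. -/
theorem IsDressing.monodromy_add_module [PreconnectedSpace X] [Nonempty X]
    (h : IsDressing D A t k l H) (hDo : IsOpen D) (hD : D ⊆ configSpace N)
    (hπ : IsCoveringMap π) (hs : Continuous s) (hs2 : ∀ x, s x ^ 2 = (H (proj π x)).det)
    (hF : ∀ x, F x = (s x)⁻¹ • H (proj π x)) (hΨ : LinearSystem π A Ψ) (hT : Continuous T)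
    (hTπ : ∀ x, lam π (T x) = lam π x + (par π x).2 ∧ par π (T x) = par π x) :
    ∃ M : Mat2, HasMonodromy Ψ T (pauli 0) M ∧
      (HasMonodromy (fun x => F x * Ψ x) T (pauli 0) M ∨
        HasMonodromy (fun x => F x * Ψ x) T (pauli 0) (-M)) ∧
      (AvoidsCut π T k l → HasMonodromy (fun x => F x * Ψ x) T (pauli 0) M) := by
  have hTp (x : X) : proj π (T x) = ((proj π x).1 + (proj π x).2.2, (proj π x).2) :=
    Prod.ext (hTπ x).1 (hTπ x).2
  have hc0 (x : X) : -quasiFactor ((proj π x).1 - ((proj π x).2.1 k + (proj π x).2.1 l) / 2)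
      (proj π x).2.2 ≠ 0 := neg_ne_zero.2 (quasiFactor_ne_zero _ _)
  obtain ⟨M, ε, hε, hsT, hM, hM'⟩ := h.exists_hasMonodromy_mul hDo hD hπ hs hs2 hF hΨ hT
    (τ := addModule N) (τ' := addModule N) hTp (fun q => (addModule N).hasFDerivAt)
    (pauli_mul_self 0)
    (fun x u => by
      rw [hTp]
      exact conn_add_module (hD (par_mem π x)) u (not_inLattice_proj π x))
    (c := fun x => -quasiFactor ((proj π x).1 - ((proj π x).2.1 k + (proj π x).2.1 l) / 2)
      (proj π x).2.2)
    (by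
      have := continuous_proj hπ
      have hq := continuous_quasiFactor
      exact (hq.comp (f := fun x => ((proj π x).1 - ((proj π x).2.1 k + (proj π x).2.1 l) / 2,
        (proj π x).2.2)) (by fun_prop)).neg) hc0
    (fun x => by rw [hTp]; exact h.add_module _ _)
  refine ⟨M, hM, or_hasMonodromy_of_sign hε hM', fun hE => ?_⟩
  have hs0 := h.sqrt_ne_zero hD hs2
  have hε1 : ε = 1 := sign_eq_of_exists hs0 hc0 hsT (by
    obtain ⟨x, hx⟩ := h.sqrt_of_avoidsCut hD hπ hs hs2 (ω := fun μ => μ)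
      (m := fun z μ => -quasiFactor z μ) (fun z μ => theta1_add_module z μ)
      (fun μ => (continuous_quasiFactor.comp (Continuous.prodMk_left μ)).neg)
      (fun z μ => neg_ne_zero.2 (quasiFactor_ne_zero z μ))
      (fun z a b μ => by rw [neg_sq, quasiFactor_sq, neg_mul_neg]) (fun x => (hTπ x).1) hE
    exact ⟨x, by rw [one_mul]; exact hx⟩)
  rwa [hε1, one_smul] at hM'

end

end EllipticSchlesinger

end

open EllipticSchlesinger
theorem theorem3p3 {N : ℕ} (D : Set (Param N)) (hDopen : IsOpen D) (hD : D ⊆ configSpace N)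
    {X : Type*} [TopologicalSpace X] [SimplyConnectedSpace X]
    (π : X → puncturedSpace D) (hπ : IsCoveringMap π) (hπs : Function.Surjective π)
    (A : Fin N → Param N → Mat2) (hA : SchlesingerSystem D A)
    (Ψ : X → Mat2) (hΨ : LinearSystem π A Ψ)
    (t : Fin N → ℂ) (ht : ∀ j, ∀ n : ℤ, 2 * t j ≠ n)
    (G : Fin N → Param N → Mat2) (hG : ∀ p ∈ D, ∀ j, Diagonalizes (G j p) (t j) (A j p))
    (k l : Fin N) (hkl : k ≠ l)
    (hdet : ∀ p ∈ D, (firstColumns (G k p) (G l p)).det ≠ 0) :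
    (∀ p ∈ D, ∃! J : Fin 3 → ℂ, DefinesJ k l (firstColumns (G k p) (G l p)) p J) ∧
    ∀ J : Param N → Fin 3 → ℂ,
      (∀ p ∈ D, DefinesJ k l (firstColumns (G k p) (G l p)) p (J p)) →
      -- `det f` does not vanish identically in `λ`
      (∀ p ∈ D, ∃ z : ℂ, ¬ InLattice p.2 (z - (p.1 k + p.1 l) / 2) ∧
        (dressing k l p (J p) z).det ≠ 0) →
      (∃ F : X → Mat2, IsNormalizedDressing π k l J F) ∧
      ∀ F : X → Mat2, IsNormalizedDressing π k l J F →
        ∃ A' : Fin N → Param N → Mat2,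
          -- `A'` are the residues of `(∂Ψ'/∂λ) Ψ'⁻¹`, where `Ψ' = F Ψ`
          (∃ g : Param N → ℂ → Mat2, IsLogDeriv π (fun x => F x * Ψ x) g ∧
            ∀ p ∈ D, ∀ j, HasResidue (g p) (p.1 j) (A' j p)) ∧
          LinearSystem π A' (fun x => F x * Ψ x) ∧
          SchlesingerSystem D A' ∧
          -- the eigenvalues
          (∃ G' : Fin N → Param N → Mat2, ∀ p ∈ D, ∀ j,
            Diagonalizes (G' j p) (if j = k ∨ j = l then t j + 1 / 2 else t j) (A' j p)) ∧
          -- the monodromies around the poles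
          (∀ T : X → X, Continuous T → (∀ x, π (T x) = π x) → ∀ j, Encircles π T j →
            ∃ M : Mat2, HasMonodromy Ψ T 1 M ∧
              HasMonodromy (fun x => F x * Ψ x) T 1 (if j = k ∨ j = l then -M else M)) ∧
          -- the twist along the `a`-cycle
          (∀ T : X → X, Continuous T →
            (∀ x, lam π (T x) = lam π x + 1 ∧ par π (T x) = par π x) →
            ∃ M : Mat2, HasMonodromy Ψ T (pauli 2) M ∧
              (HasMonodromy (fun x => F x * Ψ x) T (pauli 2) M ∨
                HasMonodromy (fun x => F x * Ψ x) T (pauli 2) (-M)) ∧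
              (AvoidsCut π T k l → HasMonodromy (fun x => F x * Ψ x) T (pauli 2) M)) ∧
          -- the twist along the `b`-cycle
          (∀ T : X → X, Continuous T →
            (∀ x, lam π (T x) = lam π x + (par π x).2 ∧ par π (T x) = par π x) →
            ∃ M : Mat2, HasMonodromy Ψ T (pauli 0) M ∧
              (HasMonodromy (fun x => F x * Ψ x) T (pauli 0) M ∨
                HasMonodromy (fun x => F x * Ψ x) T (pauli 0) (-M)) ∧
              (AvoidsCut π T k l → HasMonodromy (fun x => F x * Ψ x) T (pauli 0) M)) := by
  have ht0 (j : Fin N) : t j ≠ 0 := by simpa using ht j 0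
  have ht1 (j : Fin N) : t j + 1 / 2 ≠ 0 := fun h => ht j (-1) (by
    push_cast
    linear_combination 2 * h)
  refine ⟨fun p hp => existsUnique_definesJ (hD hp) hkl (hdet p hp), fun J hJ hne => ?_⟩
  have hH := isDressing_dressMat hDopen hD hA ht0 hG hkl hdet hJ hne
  refine ⟨?_, fun F hF => ?_⟩
  · obtain ⟨s, hs, hs2⟩ := hH.exists_sqrt_det hDopen hD hπ
    exact ⟨_, exists_isNormalizedDressing hH hD hπ hs hs2⟩
  obtain ⟨s, hs, hs2, hFs⟩ := hF.exists_sqrt hH hDopen hD hπ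
  have hΨ' := hH.linearSystem_mul hDopen hD hA ht0 hkl hπ hs hs2 hFs hΨ
  have hdA (p : Param N) (hp : p ∈ D) (j : Fin N) :=
    hH.exists_hasMatDeriv_newRes hD hkl hp (fun i => ⟨_, (schlesingerSystem_iff.1 hA p hp i).2⟩) j
  refine ⟨newRes (dressMat 0 k l J) A t k l, ⟨_, hΨ'.isLogDeriv, fun p hp j =>
    hasResidue_conn (hD hp) (trace_newRes _ _ _ _ _ _ _)⟩, hΨ',
    hΨ'.schlesingerSystem hDopen hD hπ hπs (fun j p => trace_newRes _ _ _ _ _ j p) hdA, ?_,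
    fun T hT hTπ j hE => hH.monodromy_encircles hDopen hD hkl hπ hs hs2 hFs hΨ hT hTπ hE,
    fun T hT hTπ => hH.monodromy_add_one hDopen hD hπ hs hs2 hFs hΨ hT hTπ,
    fun T hT hTπ => hH.monodromy_add_module hDopen hD hπ hs hs2 hFs hΨ hT hTπ⟩
  have hex (j : Fin N) (p : Param N) : ∃ G' : Mat2, p ∈ D → Diagonalizes G'
      (if j = k ∨ j = l then t j + 1 / 2 else t j) (newRes (dressMat 0 k l J) A t k l j p) := by
    by_cases hp : p ∈ D
    · obtain ⟨G', hG'⟩ := hH.exists_diagonalizes_newRes hD hkl ht1 hp (hG p hp j)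
      exact ⟨G', fun _ => hG'⟩
    · exact ⟨1, fun h => absurd h hp⟩
  choose G' hG' using hex
  exact ⟨G', fun p hp j => hG' j p hp⟩
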